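/- Let $\beta>2$ and $\langle x\rangle=(1+|x|^2)^{1/2}$. Let $V\colon\mathbb R^3\to\mathbb R$ be measurable with $|V(x)|\lesssim\langle x\rangle^{-\beta}$, let $B\in C^1(\mathbb R^3;\mathbb R^3)$ satisfy $\nabla\cdot B=0$ and $|B(x)|\lesssim\langle x\rangle^{-\beta-1}$, and let $A\in C^1(\mathbb R^3;\mathbb R^3)$ satisfy $\operatorname{rot}A=B$ and $|A(x)|\lesssim\langle x\rangle^{-\beta}$. With $P=-i\nabla$ let $$H=(P-A)^2+V=-\Delta+W,\qquad W=-P\cdot A-A\cdot P+|A|^2+V .$$ For $k,s\in\mathbb R$ let $H^{k,s}$ be the space of tempered distributions $u$ on $\mathbb R^3$ with norm $\|\langle x\rangle^s(1-\Delta)^{k/2}u\|_{L^2}<\infty$. Let $G_0$ be the integral operator with kernel $\frac1{4\pi|x-y|}$, extended by continuity from Schwartz functions to $H^{-1,s}$, $s>\frac12$. Write $A_j=D_jC_j$, $j=1,2,3$, with measurable real functions satisfying $|D_j(x)|,|C_j(x)|\lesssim\langle x\rangle^{-\beta/2}$. Let $v=|V|^{1/2}$, and let $U(x)=-1$ if $V(x)<0$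 and $U(x)=1$ otherwise. On $\mathscr K=L^2(\mathbb R^3)\oplus L^2(\mathbb R^3;\mathbb C^3)\oplus L^2(\mathbb R^3;\mathbb C^3)\oplus L^2(\mathbb R^3;\mathbb C^3)$ let $$w=\begin{bmatrix}v& A_1& A_2& A_3& C_1& C_2& C_3& D_1P_1& D_2P_2& D_3P_3\end{bmatrix}^T,\qquad \mathcal U=\begin{bmatrix}U&0&0&0\\0&\mathbf 1_3&0&0\\0&0&0&-\mathbf 1_3\\0&0&-\mathbf 1_3&0\end{bmatrix},$$ and let $w^*$ be the adjoint of $w$ with respect to the $L^2$ duality. Let $$\operatorname{null}(H)=\Big\{u\in\bigcap_{r<-1/2}H^{1,r} : Hu=0 \text{ in the sense of distributions}\Big\},\qquad M_s=\{u\in H^{1,-s} : (1+G_0W)u=0\}.$$ Then $w^*$ maps $\mathscr K$ into $H^{-1,\beta/2}$, $G_0w^*$ maps $\mathscr K$ into $H^{1,-\beta/2}$, and $M_0=\mathcal U+wG_0w^*$ is a well-defined bounded operator on $\mathscr K$ with the following properties. 1. $\dim\ker M_0<\infty$. 2. $0$ is not an accumulation point of the spectrum $\sigma(M_0)$, and if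 $0\in\sigma(M_0)$ then $\ker M_0\neq\{0\}$. Thus either $M_0$ has a bounded inverse, or $0$ is an isolated point of $\sigma(M_0)$ and an eigenvalue of finite multiplicity. 3. $\operatorname{null}(H)=M_s$ for all $\frac12<s<\beta-\frac12$, and $T_1=-G_0w^*|_{\ker M_0}$ is a linear bijection of $\ker M_0$ onto this space, with inverse $T_2=\mathcal U w|_{\operatorname{null}(H)}$. -/

import Mathlib

open MeasureTheory Filter Topology
open scoped SchwartzMap LineDeriv Laplacian ENNReal

noncomputable section

namespace MagneticSchrodinger

/-- Physical space. -/
abbrev R3 : Type := EuclideanSpace ℝ (Fin 3)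

/-- Complex tempered distributions on physical space. -/
abbrev Dist : Type := 𝓢'(R3, ℂ)

/-- The Hilbert space of square integrable functions. -/
abbrev L2 : Type := Lp ℂ 2 (volume : Measure R3)

/-- A Schwartz function seen as a tempered distribution. -/
def schwartzDist (φ : 𝓢(R3, ℂ)) : Dist :=
  SchwartzMap.toTemperedDistributionCLM R3 ℂ volume φ

/-- A square integrable function seen as a tempered distribution. -/
def ofL2 (f : L2) : Dist := Lp.toTemperedDistributionCLM ℂ (volume : Measure R3) 2 f

theorem ofL2_injective : Function.Injective ofL2 := by
  have h := Lp.ker_toTemperedDistributionCLM_eq_bot (F := ℂ) (μ := (volume : Measure R3)) (p := 2)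
  exact LinearMap.ker_eq_bot.mp h

/-! ### Weighted Sobolev spaces -/

/-- `⟨x⟩ ^ s = (1 + |x| ^ 2) ^ (s / 2)`. -/
def japanese (s : ℝ) (x : R3) : ℝ := (1 + ‖x‖ ^ 2) ^ (s / 2)

/-- Multiplication of distributions by `⟨x⟩ ^ s`. -/
def weight (s : ℝ) : Dist →L[ℂ] Dist :=
  TemperedDistribution.smulLeftCLM ℂ (fun x : R3 => (japanese s x : ℂ))

/-- `(1 - Δ) ^ (k / 2)`. The Fourier transform used here has the kernel `exp (-2 π i x ⬝ ξ)`, so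
the symbol of `1 - Δ` is `1 + |2 π ξ| ^ 2 = ⟨2 π ξ⟩ ^ 2`. -/
def bessel (k : ℝ) : Dist →L[ℂ] Dist :=
  TemperedDistribution.fourierMultiplierCLM ℂ
    (fun ξ : R3 => (japanese k ((2 * Real.pi) • ξ) : ℂ))

/-- `⟨x⟩ ^ s (1 - Δ) ^ (k / 2) u` is the square integrable function `f`; then the norm of `u` in
`H ^ {k, s}` is the `L²` norm of `f`. -/
def SobolevRep (k s : ℝ) (u : Dist) (f : L2) : Prop :=
  weight s (bessel k u) = ofL2 f

/-- The weighted Sobolev space `H ^ {k, s}`, as a space of tempered distributions. -/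
def sobolev (k s : ℝ) : Submodule ℂ Dist :=
  (LinearMap.range (Lp.toTemperedDistributionCLM ℂ (volume : Measure R3) 2).toLinearMap).comap
    ((weight s).comp (bessel k)).toLinearMap

/-- `H ^ {k, s - 0}`, the intersection of the spaces `H ^ {k, r}`, `r < s`. -/
def sobolevMinus (k s : ℝ) : Submodule ℂ Dist := ⨅ r : ℝ, ⨅ _ : r < s, sobolev k r

theorem hasTemperateGrowth_japanese (s : ℝ) :
    (fun x : R3 => (japanese s x : ℂ)).HasTemperateGrowth := by
  unfold japanese
  fun_prop

theorem hasTemperateGrowth_symbol (k : ℝ) :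
    (fun ξ : R3 => (japanese k ((2 * Real.pi) • ξ) : ℂ)).HasTemperateGrowth := by
  have h : (fun ξ : R3 => ((2 * Real.pi) • ContinuousLinearMap.id ℝ R3) ξ).HasTemperateGrowth :=
    ContinuousLinearMap.hasTemperateGrowth _
  exact (hasTemperateGrowth_japanese k).comp h

theorem mem_sobolev_iff {k s : ℝ} {u : Dist} :
    u ∈ sobolev k s ↔ ∃ f : L2, SobolevRep k s u f := by
  constructor
  · rintro ⟨f, hf⟩
    exact ⟨f, hf.symm⟩
  · rintro ⟨f, hf⟩
    exact ⟨f, hf.symm⟩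

/-! ### Multiplication by a function, momentum, and the Hamiltonian -/

/-- The distribution `T` is the function `f`. -/
def IsFunction (T : Dist) (f : R3 → ℂ) : Prop :=
  LocallyIntegrable f ∧ ∀ φ : 𝓢(R3, ℂ), Integrable (fun x => φ x * f x) ∧ T φ = ∫ x, φ x * f x

/-- `S = m T`: the distribution `T` is a function `f`, and `S` is the function `m f`. -/
def IsMul (m : R3 → ℝ) (T S : Dist) : Prop :=
  ∃ f : R3 → ℂ, IsFunction T f ∧ IsFunction S (fun x => (m x : ℂ) * f x)

theorem IsFunction.ae_eq {T : Dist} {f g : R3 → ℂ} (hf : IsFunction T f) (hg : IsFunction T g) :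
    f =ᵐ[volume] g := by
  apply ae_eq_of_integral_contDiff_smul_eq hf.1 hg.1
  intro g' hs hc
  have hg₁ : HasCompactSupport (Complex.ofRealCLM ∘ g') := hc.comp_left rfl
  have hg₂ : ContDiff ℝ (⊤ : ℕ∞) (Complex.ofRealCLM ∘ g') := Complex.ofRealCLM.contDiff.comp hs
  have h := (hf.2 (hg₁.toSchwartzMap hg₂)).2.symm.trans (hg.2 (hg₁.toSchwartzMap hg₂)).2
  simpa [Complex.real_smul] using h

theorem IsMul.unique {m : R3 → ℝ} {T S S' : Dist} (h : IsMul m T S) (h' : IsMul m T S') :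
    S = S' := by
  obtain ⟨f, hf, hS⟩ := h
  obtain ⟨f', hf', hS'⟩ := h'
  ext φ
  rw [(hS.2 φ).2, (hS'.2 φ).2]
  refine integral_congr_ae ?_
  filter_upwards [hf.ae_eq hf'] with x hx
  rw [hx]

open Classical in
/-- The product `m T` of a function `m` and a distribution `T` that is a function
(`0` when there is no such product). -/
def mul (m : R3 → ℝ) (T : Dist) : Dist :=
  if h : ∃ S, IsMul m T S then h.choose else 0

/-- The momentum `P_j = - i ∂_j`, in the sense of distributions. -/
def momentum (j : Fin 3) (T : Dist) : Dist :=
  (-Complex.I) • ∂_{(EuclideanSpace.single j (1 : ℝ) : R3)} T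

/-- The perturbation `W = - P ⬝ A - A ⬝ P + |A| ^ 2 + V`. -/
def pertW (V : R3 → ℝ) (A : R3 → R3) (u : Dist) : Dist :=
  -(∑ j, momentum j (mul (fun x => A x j) u)) - (∑ j, mul (fun x => A x j) (momentum j u))
    + mul (fun x => ‖A x‖ ^ 2) u + mul V u

/-- The magnetic Schrödinger operator `H = (P - A) ^ 2 + V = - Δ + W`, in the sense of
distributions. -/
def hamiltonian (V : R3 → ℝ) (A : R3 → R3) (u : Dist) : Dist := -(Δ u) + pertW V A u

/-- The zero-energy solutions: `u` in `H ^ {1, - 1/2 - 0}` with `H u = 0`. -/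
def nullSpace (V : R3 → ℝ) (A : R3 → R3) : Set Dist :=
  {u | u ∈ sobolevMinus 1 (-(1 / 2)) ∧ hamiltonian V A u = 0}

/-! ### The operator `G₀` -/

/-- The integral operator with kernel `1 / (4 π |x - y|)` on Schwartz functions. -/
def newton (φ : 𝓢(R3, ℂ)) (x : R3) : ℂ :=
  ∫ y, (((4 * Real.pi * ‖x - y‖)⁻¹ : ℝ) : ℂ) * φ y

/-- `u = G₀ g`, where `g` belongs to `H ^ {-1, s}` for some `s > 1 / 2`: the integral operator with
kernel `1 / (4 π |x - y|)` is extended by continuity from Schwartz functions to `H ^ {-1, s}`. -/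
def IsG0 (g u : Dist) : Prop :=
  ∃ s : ℝ, 1 / 2 < s ∧ ∃ (f : L2) (φ : ℕ → 𝓢(R3, ℂ)) (F : ℕ → L2),
    SobolevRep (-1) s g f ∧ (∀ n, SobolevRep (-1) s (schwartzDist (φ n)) (F n)) ∧
    Tendsto F atTop (𝓝 f) ∧
    ∀ ψ : 𝓢(R3, ℂ), Tendsto (fun n => ∫ x, newton (φ n) x * ψ x) atTop (𝓝 (u ψ))

open Classical in
/-- The operator `G₀` on the union of the spaces `H ^ {-1, s}`, `s > 1 / 2`
(`0` outside its domain). -/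
def G0 (g : Dist) : Dist := if h : ∃ u, IsG0 g u then h.choose else 0

/-- The space `M` of all `u` in `H ^ {1, -s}` with `(1 + G₀ W) u = 0`. -/
def spaceM (V : R3 → ℝ) (A : R3 → R3) (s : ℝ) : Set Dist :=
  {u | u ∈ sobolev 1 (-s) ∧ u + G0 (pertW V A u) = 0}

/-! ### The auxiliary space and the factorization -/

/-- The ten components: one for `v`, three for the `A_j`, three for the `C_j`, three for the
`D_j P_j`. -/
abbrev Slot : Type := Unit ⊕ (Fin 3 ⊕ (Fin 3 ⊕ Fin 3))

/-- The Hilbert space `L² ⊕ L²(ℂ³) ⊕ L²(ℂ³) ⊕ L²(ℂ³)`. -/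
abbrev auxK : Type := PiLp 2 (fun _ : Slot => L2)

abbrev slotV : Slot := Sum.inl ()
abbrev slotA (j : Fin 3) : Slot := Sum.inr (Sum.inl j)
abbrev slotC (j : Fin 3) : Slot := Sum.inr (Sum.inr (Sum.inl j))
abbrev slotD (j : Fin 3) : Slot := Sum.inr (Sum.inr (Sum.inr j))

open Classical in
/-- The element of `L²` that is the distribution `T` (`0` if there is none). -/
def toL2 (T : Dist) : L2 := if h : ∃ f : L2, T = ofL2 f then h.choose else 0

/-- `v = |V| ^ (1/2)`. -/
def sqrtAbs (V : R3 → ℝ) (x : R3) : ℝ := Real.sqrt |V x|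

/-- The function `U`, equal to `-1` where `V < 0` and to `1` elsewhere. -/
def signU (V : R3 → ℝ) (x : R3) : ℝ := if V x < 0 then -1 else 1

/-- `w = (v, A_j, C_j, D_j P_j)ᵀ`. -/
def opw (V : R3 → ℝ) (A : R3 → R3) (C D : Fin 3 → R3 → ℝ) (u : Dist) : auxK :=
  WithLp.toLp 2 fun i => match i with
    | Sum.inl _ => toL2 (mul (sqrtAbs V) u)
    | Sum.inr (Sum.inl j) => toL2 (mul (fun x => A x j) u)
    | Sum.inr (Sum.inr (Sum.inl j)) => toL2 (mul (C j) u)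
    | Sum.inr (Sum.inr (Sum.inr j)) => toL2 (mul (D j) (momentum j u))

/-- The adjoint `w* = (v, A_j, C_j, P_j D_j)`, with values in the distributions. -/
def opwStar (V : R3 → ℝ) (A : R3 → R3) (C D : Fin 3 → R3 → ℝ) (f : auxK) : Dist :=
  mul (sqrtAbs V) (ofL2 (f slotV))
    + (∑ j, mul (fun x => A x j) (ofL2 (f (slotA j))))
    + (∑ j, mul (C j) (ofL2 (f (slotC j))))
    + ∑ j, momentum j (mul (D j) (ofL2 (f (slotD j))))

/-- The block operator matrix `𝒰`: multiplication by `U`, the identity, and minus the exchange of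
the last two blocks. -/
def calU (V : R3 → ℝ) (f : auxK) : auxK :=
  WithLp.toLp 2 fun i => match i with
    | Sum.inl _ => toL2 (mul (signU V) (ofL2 (f slotV)))
    | Sum.inr (Sum.inl j) => f (slotA j)
    | Sum.inr (Sum.inr (Sum.inl j)) => -f (slotD j)
    | Sum.inr (Sum.inr (Sum.inr j)) => -f (slotC j)

/-! ### The assumptions on the fields -/

/-- The partial derivative `∂_i F_j` of a vector field. -/
def pd (F : R3 → R3) (i j : Fin 3) (x : R3) : ℝ :=
  fderiv ℝ F x (EuclideanSpace.single i 1) j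

/-- The assumptions on the electric potential `V` and the magnetic field `B`. -/
structure FieldAssumption (β : ℝ) (V : R3 → ℝ) (B : R3 → R3) : Prop where
  measurable_V : Measurable V
  decay_V : ∃ c : ℝ, ∀ x, |V x| ≤ c * japanese (-β) x
  contDiff_B : ContDiff ℝ 1 B
  div_B : ∀ x, pd B 0 0 x + pd B 1 1 x + pd B 2 2 x = 0
  decay_B : ∃ c : ℝ, ∀ x, ‖B x‖ ≤ c * japanese (-β - 1) x

/-- `A` is a continuously differentiable vector potential of `B` that decays like
`⟨x⟩ ^ (-β)`. -/
structure IsVectorPotential (β : ℝ) (B A : R3 → R3) : Prop where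
  contDiff_A : ContDiff ℝ 1 A
  curl_A : ∀ x, pd A 1 2 x - pd A 2 1 x = B x 0 ∧ pd A 2 0 x - pd A 0 2 x = B x 1 ∧
    pd A 0 1 x - pd A 1 0 x = B x 2
  decay_A : ∃ c : ℝ, ∀ x, ‖A x‖ ≤ c * japanese (-β) x

/-- `A_j = D_j C_j` with `C_j` and `D_j` decaying like `⟨x⟩ ^ (-β / 2)`. -/
structure IsSplitting (β : ℝ) (A : R3 → R3) (C D : Fin 3 → R3 → ℝ) : Prop where
  measurable_C : ∀ j, Measurable (C j)
  measurable_D : ∀ j, Measurable (D j)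
  split : ∀ j x, A x j = D j x * C j x
  decay_C : ∃ c : ℝ, ∀ j x, |C j x| ≤ c * japanese (-(β / 2)) x
  decay_D : ∃ c : ℝ, ∀ j x, |D j x| ≤ c * japanese (-(β / 2)) x

end MagneticSchrodinger

end

open MagneticSchrodinger

/-! Put ρ = β/2 > 1. The problem is transported to L². The operator 𝒲 = w(1-Δ)^{-1/2}⟨x⟩^ρ
(`fieldOp`) is bounded from L² to 𝒦, its adjoint is ⟨x⟩^ρ(1-Δ)^{-1/2}w*, and M₀ = 𝒰 + 𝒲
(⟨x⟩^{-ρ}(1-Δ)G₀⟨x⟩^{-ρ}) 𝒲*. Since (1-Δ)G₀ = G₀ + 1, the middle factor is K + X with K =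
⟨x⟩^{-ρ}G₀⟨x⟩^{-ρ} and X = ⟨x⟩^{-2ρ}.

K is Hilbert–Schmidt because ρ > 1 (`memLp_weightedKernel`). The term 𝒲X𝒲* need not be compact, but
every block of it other than the D–D block contains the operator ⟨x⟩^{-ρ}(1-Δ)^{-1/2}⟨x⟩^{-ρ}, which
is compact (`isCompactOperator_weightedMult_japanese`). Hence M₀ = 𝒰 + F + compact, where F is the
D–D block. The D–D entry of 𝒰 is zero, so F𝒰F = 0, and together with 𝒰² = 1 this makes 𝒰 - 𝒰F𝒰 a
left inverse of 𝒰 + F. So M₀ has a left parametrix (`auxOp_parametrix`). This gives a kernel of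
finite dimension (`finiteDimensional_ker_of_parametrix`), and with self-adjointness a spectral gap
at 0 (`spectrum_of_parametrix`).

The correspondence of solutions is algebra based on w*𝒰w = W (`pertW_eq`): if M₀f = 0 and u =
-G₀w*f, then 𝒰f = wu, so f = 𝒰wu and u = -G₀w*𝒰wu = -G₀Wu, and the argument reverses. That M_s is
the null space for every s (`spaceM_eq_nullSpace`) uses -ΔG₀ = 1. From M_s to the null space, decay
is improved by a bootstrap: W gains β powers and G₀ costs barely more than 2. In the other direction
u + G₀Wu is harmonic, and a Liouville theorem (`eq_zero_of_laplacian_eq_zero`) kills it.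

Two analytic inputs carry this. The multipliers (1-Δ)^{-1/2} and P_j(1-Δ)^{-1/2} are bounded on
every weighted L² space (`norm_weighted_multS`): even integer powers of the squared weight by
commutators with the coordinates, intermediate powers by interpolation, negative ones by duality.
The Newton potential is multiplication by (4π²|ξ|²)⁻¹ on the Fourier side
(`integral_newton_mul_eq_fourier`), so it commutes with multipliers and satisfies (1-Δ)G₀ = G₀ + 1.
-/

noncomputable section

namespace MagneticSchrodinger

/-! ### Operators with a left parametrix on a Hilbert space -/

section Hilbert

variable {H K : Type*} [NormedAddCommGroup H] [InnerProductSpace ℂ H] [CompleteSpace H]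
  [NormedAddCommGroup K] [InnerProductSpace ℂ K] [CompleteSpace K]

-- Because ‖S*z‖² = ⟨SS*z, z⟩ ≤ ‖SS*z‖ ‖z‖, a finite net for the image of the unit ball under SS*
-- yields one for its image under S*. It serves to pass from (1-Δ)⁻¹ to (1-Δ)^{-1/2}.
open ContinuousLinearMap in
theorem isCompactOperator_adjoint_of_comp_adjoint (S : H →L[ℂ] K)
    (h : IsCompactOperator (S ∘L adjoint S)) : IsCompactOperator (adjoint S) := by
  have key : ∀ z, ‖adjoint S z‖ ^ 2 ≤ ‖(S ∘L adjoint S) z‖ * ‖z‖ := by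
    intro z
    have h1 : inner ℂ (adjoint S z) (adjoint S z) = inner ℂ ((S ∘L adjoint S) z) z :=
      adjoint_inner_right S (adjoint S z) z
    have h2 := inner_self_eq_norm_sq_to_K (𝕜 := ℂ) (adjoint S z)
    rw [h1] at h2
    have h3 := norm_inner_le_norm (𝕜 := ℂ) ((S ∘L adjoint S) z) z
    rw [h2] at h3
    simpa using h3
  rw [← ContinuousLinearMap.coe_coe, isCompactOperator_iff_isCompact_closure_image_closedBall _ one_pos]
  have hc := ((isCompactOperator_iff_isCompact_closure_image_closedBall
    (S ∘L adjoint S).toLinearMap one_pos).1 h)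
  have htb : TotallyBounded ((S ∘L adjoint S) '' Metric.closedBall 0 1) :=
    hc.totallyBounded.subset subset_closure
  refine TotallyBounded.isCompact_of_isClosed (TotallyBounded.closure ?_) isClosed_closure
  rw [Metric.totallyBounded_iff]
  intro ε hε
  -- Two points of the unit ball are at distance at most 2, so mesh ε²/4 gives ‖S*(x - p y)‖² ≤
  -- ε²/2.
  obtain ⟨t, ht, hfin, hcov⟩ := Metric.finite_approx_of_totallyBounded htb (ε ^ 2 / 4) (by positivity)
  choose! p hp using fun y (hy : y ∈ t) => ht hy
  refine ⟨(fun y => adjoint S (p y)) '' t, hfin.image _, ?_⟩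
  rintro _ ⟨x, hx, rfl⟩
  obtain ⟨y, hy, hxy⟩ := Set.mem_iUnion₂.1 (hcov ⟨x, hx, rfl⟩)
  refine Set.mem_iUnion₂.2 ⟨_, ⟨y, hy, rfl⟩, ?_⟩
  have hpx := (hp y hy).1
  rw [mem_closedBall_zero_iff] at hx hpx
  rw [Metric.mem_ball, dist_eq_norm, ← (hp y hy).2, ← map_sub] at hxy
  rw [Metric.mem_ball, dist_eq_norm, coe_coe, ← map_sub]
  have h1 := key (x - p y)
  have h2 : ‖x - p y‖ ≤ 2 := (norm_sub_le _ _).trans (by linarith)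
  have h3 : ‖adjoint S (x - p y)‖ ^ 2 < ε ^ 2 := by
    have := mul_le_mul hxy.le h2 (norm_nonneg _) (by positivity)
    nlinarith [sq_pos_of_pos hε]
  exact lt_of_pow_lt_pow_left₀ 2 hε.le h3

-- The lower bound gives injectivity and a closed range; the orthogonal complement of the range lies
-- in the kernel of the adjoint, which is trivial.
open ContinuousLinearMap in
theorem isUnit_of_bounded_below (T : H →L[ℂ] H) {c : ℝ} (hc : 0 < c)
    (h : ∀ x, c * ‖x‖ ≤ ‖T x‖) (h' : ∀ x, adjoint T x = 0 → x = 0) : IsUnit T := by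
  rw [ContinuousLinearMap.isUnit_iff_bijective]
  have hanti : AntilipschitzWith (Real.toNNReal c⁻¹) T := by
    refine T.antilipschitz_of_bound fun x => ?_
    rw [Real.coe_toNNReal _ (by positivity), inv_mul_eq_div, le_div_iff₀ hc, mul_comm]
    exact h x
  refine ⟨hanti.injective, ?_⟩
  have hcl : IsClosed (T.range : Set H) := by
    have := hanti.isClosed_range T.uniformContinuous
    rw [LinearMap.coe_range]
    exact this
  have : T.rangeᗮ = ⊥ := by
    rw [Submodule.eq_bot_iff]
    intro x hx
    refine h' x ?_
    rw [← inner_self_eq_zero (𝕜 := ℂ), adjoint_inner_right]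
    exact hx _ ⟨_, rfl⟩
  have hcompl : CompleteSpace T.range := hcl.completeSpace_coe
  rw [Submodule.orthogonal_eq_bot_iff] at this
  exact LinearMap.range_eq_top.1 this

/-- On the kernel of M the identity QM = 1 + C reads C = -1, so the identity map of the kernel is
compact. -/
theorem finiteDimensional_ker_of_parametrix (M Q C : H →L[ℂ] H) (hC : IsCompactOperator C)
    (hQ : Q ∘L M = 1 + C) : FiniteDimensional ℂ (LinearMap.ker M.toLinearMap) := by
  have hmem : ∀ x ∈ LinearMap.ker M.toLinearMap, C x = -x := by
    intro x hx
    have := congrArg (fun T => T x) hQ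
    have hx : M x = 0 := hx
    simp [hx] at this
    exact (neg_eq_of_add_eq_zero_right this.symm).symm
  have : CompleteSpace (LinearMap.ker M.toLinearMap) :=
    (M.isClosed_ker).completeSpace_coe
  have h1 : ∀ x ∈ LinearMap.ker M.toLinearMap, C.toLinearMap x ∈ LinearMap.ker M.toLinearMap := by
    intro x hx
    have := hmem x hx
    simp only [ContinuousLinearMap.coe_coe, this]
    exact neg_mem hx
  have h2 := (IsCompactOperator.restrict' (f := C.toLinearMap) hC h1).neg
  refine FiniteDimensional.of_isCompactOperator_id (𝕜 := ℂ) ?_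
  convert! h2 using 1
  funext x
  ext
  simp [LinearMap.restrict_apply, hmem x x.2]

/-- An operator with a left parametrix is bounded below on the orthogonal complement of its
kernel. -/
theorem bounded_below_of_parametrix (M Q C : H →L[ℂ] H) (hC : IsCompactOperator C)
    (hQ : Q ∘L M = 1 + C) :
    ∃ c > 0, ∀ x ∈ (LinearMap.ker M.toLinearMap)ᗮ, c * ‖x‖ ≤ ‖M x‖ := by
  -- Otherwise there are unit vectors of the complement with M xₙ → 0. As xₙ = QM xₙ - C xₙ, a
  -- subsequence converges, and its limit is a unit vector in both the kernel and its complement.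
  by_contra! hcon
  have h1 : ∀ n : ℕ, ∃ x ∈ (LinearMap.ker M.toLinearMap)ᗮ, ‖x‖ = 1 ∧ ‖M x‖ < 1 / ((n : ℝ) + 1) := by
    intro n
    obtain ⟨x, hx, hlt⟩ := hcon (1 / ((n : ℝ) + 1)) (by positivity)
    have hx0 : x ≠ 0 := by
      rintro rfl
      simp at hlt
    have hn : 0 < ‖x‖ := norm_pos_iff.2 hx0
    refine ⟨((‖x‖⁻¹ : ℝ) : ℂ) • x, Submodule.smul_mem _ _ hx, ?_, ?_⟩
    · rw [norm_smul]
      simp [hn.ne']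
    · rw [map_smul, norm_smul]
      simp only [Complex.norm_real, norm_inv, norm_norm]
      rw [inv_mul_lt_iff₀ hn, mul_comm]
      exact hlt
  choose x hx hx1 hMx using h1
  have hM0 : Tendsto (fun n => M (x n)) atTop (𝓝 0) := by
    rw [tendsto_zero_iff_norm_tendsto_zero]
    exact squeeze_zero (fun _ => norm_nonneg _) (fun n => (hMx n).le)
      tendsto_one_div_add_atTop_nhds_zero_nat
  obtain ⟨k, hk, hk'⟩ := IsCompactOperator.image_closedBall_subset_compact (f := C.toLinearMap) hC 1
  obtain ⟨y, -, ψ, hψ, hy⟩ := hk.tendsto_subseq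
    (fun n => hk' ⟨x n, by simp [hx1], rfl⟩)
  have hlim : Tendsto (fun n => x (ψ n)) atTop (𝓝 (-y)) := by
    have h2 : ∀ n, x (ψ n) = Q (M (x (ψ n))) - C (x (ψ n)) := by
      intro n
      have := congrArg (fun T => T (x (ψ n))) hQ
      simp at this
      simp [this]
    have h3 : Tendsto (fun n => Q (M (x (ψ n)))) atTop (𝓝 (Q 0)) :=
      (Q.continuous.tendsto 0).comp (hM0.comp hψ.tendsto_atTop)
    have h4 := h3.sub hy
    rw [map_zero, zero_sub] at h4
    refine h4.congr fun n => ?_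
    simp only [Function.comp_apply, ContinuousLinearMap.coe_coe]
    exact (h2 n).symm
  have hnorm : ‖-y‖ = 1 := by
    refine tendsto_nhds_unique hlim.norm ?_
    simp [hx1]
  have hker : -y ∈ LinearMap.ker M.toLinearMap := by
    have := (M.continuous.tendsto _).comp hlim
    exact tendsto_nhds_unique this (hM0.comp hψ.tendsto_atTop)
  have hperp : -y ∈ (LinearMap.ker M.toLinearMap)ᗮ :=
    (Submodule.isClosed_orthogonal _).mem_of_tendsto hlim (Eventually.of_forall fun n => hx _)
  have := Submodule.inner_right_of_mem_orthogonal hker hperp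
  rw [inner_self_eq_zero] at this
  rw [this] at hnorm
  simp at hnorm

open ContinuousLinearMap in
/-- The spectrum of a self-adjoint operator with a left parametrix near the origin. -/
theorem spectrum_of_parametrix (M Q C : H →L[ℂ] H) (hM : adjoint M = M)
    (hC : IsCompactOperator C) (hQ : Q ∘L M = 1 + C) :
    (∃ ε : ℝ, 0 < ε ∧ ∀ z ∈ spectrum ℂ M, z ≠ 0 → ε ≤ ‖z‖) ∧
      (0 ∈ spectrum ℂ M → LinearMap.ker M.toLinearMap ≠ ⊥) := by
  obtain ⟨c, hc, hlow⟩ := bounded_below_of_parametrix M Q C hC hQ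
  constructor
  · refine ⟨c, hc, fun z hz hz0 => ?_⟩
    by_contra! hzc
    set N := LinearMap.ker M.toLinearMap with hN
    have : CompleteSpace N := M.isClosed_ker.completeSpace_coe
    -- All w of modulus |z| are treated at once, so that the bound serves M - z and its adjoint. M -
    -- w is -w on the kernel and is bounded below by c - |z| on the complement, which the
    -- self-adjoint M preserves; the two images are orthogonal, so Pythagoras combines the bounds.
    have hb : ∀ w : ℂ, ‖w‖ = ‖z‖ → ∀ x, min ‖z‖ (c - ‖z‖) * ‖x‖ ≤ ‖M x - w • x‖ := by
      intro w hw x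
      obtain ⟨a, ha, b, hb, rfl⟩ := Submodule.exists_add_mem_mem_orthogonal (K := N) x
      have hMa : M a = 0 := ha
      have hMb : M b ∈ Nᗮ := by
        rw [Submodule.mem_orthogonal]
        intro u hu
        have hu : M u = 0 := hu
        rw [← adjoint_inner_left, hM, hu, inner_zero_left]
      have h1 : M (a + b) - w • (a + b) = -(w • a) + (M b - w • b) := by
        rw [map_add, hMa, smul_add]; abel
      have horth1 : inner ℂ a b = 0 := Submodule.inner_right_of_mem_orthogonal ha hb
      have horth2 : inner ℂ (-(w • a)) (M b - w • b) = 0 :=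
        Submodule.inner_right_of_mem_orthogonal (neg_mem (Submodule.smul_mem _ _ ha))
          (sub_mem hMb (Submodule.smul_mem _ _ hb))
      have hp1 := norm_add_sq_eq_norm_sq_add_norm_sq_of_inner_eq_zero a b horth1
      have hp2 := norm_add_sq_eq_norm_sq_add_norm_sq_of_inner_eq_zero _ _ horth2
      rw [h1]
      set δ := min ‖z‖ (c - ‖z‖) with hδ
      have hδ0 : 0 ≤ δ := le_min (norm_nonneg _) (by linarith)
      have e1 : δ * ‖a‖ ≤ ‖-(w • a)‖ := by
        rw [norm_neg, norm_smul, hw]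
        exact mul_le_mul_of_nonneg_right (min_le_left _ _) (norm_nonneg _)
      have e2 : δ * ‖b‖ ≤ ‖M b - w • b‖ := by
        have h3 := norm_sub_norm_le (M b) (w • b)
        rw [norm_smul, hw] at h3
        have h4 := hlow b hb
        have h5 : δ * ‖b‖ ≤ (c - ‖z‖) * ‖b‖ :=
          mul_le_mul_of_nonneg_right (min_le_right _ _) (norm_nonneg _)
        linarith
      refine le_of_sq_le_sq ?_ (norm_nonneg _)
      rw [mul_pow]
      have e3 := mul_self_le_mul_self (by positivity) e1
      have e4 := mul_self_le_mul_self (by positivity) e2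
      nlinarith
    refine hz ?_
    have hu : IsUnit (M - algebraMap ℂ (H →L[ℂ] H) z) := by
      refine isUnit_of_bounded_below _ (c := min ‖z‖ (c - ‖z‖))
        (lt_min (norm_pos_iff.2 hz0) (by linarith)) (fun x => ?_) (fun x hx => ?_)
      · simpa [Algebra.algebraMap_eq_smul_one] using hb z rfl x
      · have h1 := hb (starRingEnd ℂ z) (by simp) x
        have h2 : M x - (starRingEnd ℂ z) • x = 0 := by
          rw [Algebra.algebraMap_eq_smul_one, map_sub, map_smulₛₗ, hM] at hx
          have h3 : adjoint (1 : H →L[ℂ] H) = 1 := by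
            ext1 u; refine ext_inner_left ℂ fun v => ?_
            rw [adjoint_inner_right]; simp
          rw [h3] at hx
          simpa using hx
        rw [h2, norm_zero] at h1
        have hpos : 0 < min ‖z‖ (c - ‖z‖) := lt_min (norm_pos_iff.2 hz0) (by linarith)
        have : ‖x‖ ≤ 0 := by
          by_contra! hx0
          nlinarith
        exact norm_le_zero_iff.1 this
    have := hu.neg
    rw [neg_sub] at this
    exact this
  · intro h0 hker
    refine h0 ?_
    have hu : IsUnit M := by
      refine isUnit_of_bounded_below _ hc (fun x => hlow x ?_) (fun x hx => ?_)
      · rw [hker]; simp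
      · rw [hM] at hx
        have : x ∈ LinearMap.ker M.toLinearMap := hx
        rwa [hker, Submodule.mem_bot] at this
    rw [spectrum.mem_resolventSet_iff, map_zero, zero_sub]
    exact hu.neg

/-- A Hilbert–Schmidt operator is compact. -/
theorem isCompactOperator_of_summable {ι : Type*} (e : HilbertBasis ι ℂ H) (T : H →L[ℂ] K)
    (h : Summable fun i => ‖T (e i)‖ ^ 2) : IsCompactOperator T := by
  classical
  -- Finite rank truncations. By Cauchy–Schwarz and Bessel's inequality the norm of a tail is at
  -- most the square root of the corresponding tail of Σ‖T eᵢ‖².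
  let F : Finset ι → H →L[ℂ] K := fun s => ∑ i ∈ s, (innerSL ℂ (e i)).smulRight (T (e i))
  have hF : ∀ s, IsCompactOperator (F s) := by
    intro s
    have : F s ∈ compactOperator (RingHom.id ℂ) H K := by
      refine Submodule.sum_mem _ fun i _ => ?_
      have h1 : IsCompactOperator (innerSL ℂ (e i)) :=
        isCompactOperator_of_locallyCompactSpace_dom _
      exact h1.clm_comp (ContinuousLinearMap.toSpanSingleton ℂ (T (e i)))
    exact this
  refine isCompactOperator_of_tendsto (l := atTop) (F := F) ?_ (Eventually.of_forall hF)
  rw [Metric.tendsto_atTop]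
  intro ε hε
  obtain ⟨s, hs⟩ := (summable_iff_vanishing.1 h) (Metric.ball 0 (ε ^ 2 / 4))
    (Metric.ball_mem_nhds _ (by positivity))
  refine ⟨s, fun s' hs' => ?_⟩
  rw [dist_eq_norm]
  refine lt_of_le_of_lt (b := ε / 2) ?_ (by linarith)
  refine ContinuousLinearMap.opNorm_le_bound _ (by positivity) fun f => ?_
  have hsum : HasSum (fun i => (innerSL ℂ (e i)).smulRight (T (e i)) f) (T f) := by
    have := (e.hasSum_repr f).mapL T
    simpa [HilbertBasis.repr_apply_apply] using this
  have hlim : Tendsto (fun s'' : Finset ι => ‖F s' f - F s'' f‖) atTop (𝓝 ‖F s' f - T f‖) := by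
    refine ((tendsto_const_nhds).sub ?_).norm
    have h9 : (fun s'' : Finset ι => F s'' f) =
        fun s'' => ∑ i ∈ s'', (innerSL ℂ (e i)).smulRight (T (e i)) f := by
      funext s''
      simp [F]
    rw [h9]
    exact hsum
  refine le_of_tendsto hlim ?_
  filter_upwards [eventually_ge_atTop s'] with s'' hs''
  have h1 : F s'' f - F s' f = ∑ i ∈ s'' \ s', (innerSL ℂ (e i)).smulRight (T (e i)) f := by
    simp only [F, _root_.sum_apply]
    rw [← Finset.sum_sdiff hs'', add_sub_cancel_right]
  rw [norm_sub_rev, h1]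
  have h2 : ‖∑ i ∈ s'' \ s', (innerSL ℂ (e i)).smulRight (T (e i)) f‖ ≤
      ∑ i ∈ s'' \ s', ‖inner ℂ (e i) f‖ * ‖T (e i)‖ := by
    refine (norm_sum_le _ _).trans (Finset.sum_le_sum fun i _ => ?_)
    simp [norm_smul]
  refine h2.trans ?_
  have h3 := Finset.sum_mul_sq_le_sq_mul_sq (s'' \ s') (fun i => ‖inner ℂ (e i) f‖)
    (fun i => ‖T (e i)‖)
  have h4 : ∑ i ∈ s'' \ s', ‖inner ℂ (e i) f‖ ^ 2 ≤ ‖f‖ ^ 2 :=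
    e.orthonormal.sum_inner_products_le f
  have h5 : ∑ i ∈ s'' \ s', ‖T (e i)‖ ^ 2 < ε ^ 2 / 4 := by
    have h6 := hs (s'' \ s') (Finset.sdiff_disjoint.mono_right hs')
    rw [mem_ball_zero_iff, Real.norm_of_nonneg (Finset.sum_nonneg fun _ _ => by positivity)] at h6
    exact h6
  refine le_of_sq_le_sq (h3.trans ?_) (by positivity)
  calc _ ≤ ‖f‖ ^ 2 * (ε ^ 2 / 4) := mul_le_mul h4 h5.le
        (Finset.sum_nonneg fun _ _ => by positivity) (by positivity)
    _ = _ := by ring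

end Hilbert

/-! ### Integral operators with square integrable kernels -/

section Kernel

variable {α : Type*} [MeasurableSpace α] (μ : Measure α) [SFinite μ]

theorem memLp_tensor {f g : α → ℂ} (hf : MemLp f 2 μ) (hg : MemLp g 2 μ) :
    MemLp (fun z : α × α => g z.1 * starRingEnd ℂ (f z.2)) 2 (μ.prod μ) := by
  have hm : AEStronglyMeasurable (fun z : α × α => g z.1 * starRingEnd ℂ (f z.2)) (μ.prod μ) :=
    (hg.1.comp_fst).mul
      ((Complex.continuous_conj.comp_aestronglyMeasurable hf.1).comp_snd)
  rw [memLp_two_iff_integrable_sq_norm hm]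
  have h1 := (hg.integrable_norm_pow two_ne_zero).mul_prod (hf.integrable_norm_pow two_ne_zero)
  simpa [mul_pow] using h1

/-- `g ⊗ conj f`. -/
def tensor (g f : Lp ℂ 2 μ) : Lp ℂ 2 (μ.prod μ) :=
  (memLp_tensor μ (Lp.memLp f) (Lp.memLp g)).toLp _

theorem coeFn_tensor (g f : Lp ℂ 2 μ) :
    tensor μ g f =ᵐ[μ.prod μ] fun z => g z.1 * starRingEnd ℂ (f z.2) :=
  MemLp.coeFn_toLp _

/-- Fubini. In particular an orthonormal system tensors to an orthonormal system. -/
theorem inner_tensor (g f g' f' : Lp ℂ 2 μ) :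
    inner ℂ (tensor μ g f) (tensor μ g' f') = inner ℂ g g' * inner ℂ f' f := by
  rw [L2.inner_def, L2.inner_def, L2.inner_def, ← integral_prod_mul]
  refine integral_congr_ae ?_
  filter_upwards [coeFn_tensor μ g f, coeFn_tensor μ g' f'] with z h1 h2
  rw [h1, h2]
  simp
  ring

theorem norm_tensor (g f : Lp ℂ 2 μ) : ‖tensor μ g f‖ = ‖g‖ * ‖f‖ := by
  have h := inner_tensor μ g f g f
  rw [inner_self_eq_norm_sq_to_K, inner_self_eq_norm_sq_to_K, inner_self_eq_norm_sq_to_K] at h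
  have h' : ‖tensor μ g f‖ ^ 2 = (‖g‖ * ‖f‖) ^ 2 := by
    rw [mul_pow]
    exact_mod_cast h
  exact (pow_left_inj₀ (norm_nonneg _) (by positivity) two_ne_zero).1 h'

theorem tensor_add_left (g g' f : Lp ℂ 2 μ) :
    tensor μ (g + g') f = tensor μ g f + tensor μ g' f := by
  apply Lp.ext
  have h0 := (Measure.quasiMeasurePreserving_fst (μ := μ) (ν := μ)).ae (Lp.coeFn_add g g')
  filter_upwards [coeFn_tensor μ (g + g') f, coeFn_tensor μ g f, coeFn_tensor μ g' f,
    Lp.coeFn_add (tensor μ g f) (tensor μ g' f), h0] with z h1 h2 h3 h4 h5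
  rw [h1, h4, Pi.add_apply, h2, h3, h5, Pi.add_apply, add_mul]

theorem tensor_add_right (g f f' : Lp ℂ 2 μ) :
    tensor μ g (f + f') = tensor μ g f + tensor μ g f' := by
  apply Lp.ext
  have h0 := (Measure.quasiMeasurePreserving_snd (μ := μ) (ν := μ)).ae (Lp.coeFn_add f f')
  filter_upwards [coeFn_tensor μ g (f + f'), coeFn_tensor μ g f, coeFn_tensor μ g f',
    Lp.coeFn_add (tensor μ g f) (tensor μ g f'), h0] with z h1 h2 h3 h4 h5
  rw [h1, h4, Pi.add_apply, h2, h3, h5, Pi.add_apply, map_add, mul_add]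

theorem tensor_smul_left (c : ℂ) (g f : Lp ℂ 2 μ) :
    tensor μ (c • g) f = c • tensor μ g f := by
  apply Lp.ext
  have h0 := (Measure.quasiMeasurePreserving_fst (μ := μ) (ν := μ)).ae (Lp.coeFn_smul c g)
  filter_upwards [coeFn_tensor μ (c • g) f, coeFn_tensor μ g f,
    Lp.coeFn_smul c (tensor μ g f), h0] with z h1 h2 h4 h5
  rw [h1, h4, Pi.smul_apply, h2, h5, Pi.smul_apply, smul_mul_assoc]

theorem tensor_smul_right (c : ℂ) (g f : Lp ℂ 2 μ) :
    tensor μ g (c • f) = starRingEnd ℂ c • tensor μ g f := by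
  apply Lp.ext
  have h0 := (Measure.quasiMeasurePreserving_snd (μ := μ) (ν := μ)).ae (Lp.coeFn_smul c f)
  filter_upwards [coeFn_tensor μ g (c • f), coeFn_tensor μ g f,
    Lp.coeFn_smul (starRingEnd ℂ c) (tensor μ g f), h0] with z h1 h2 h4 h5
  rw [h1, h4, Pi.smul_apply, h2, h5, Pi.smul_apply]
  simp [mul_left_comm]

/-- The functional `g ↦ ⟪κ, g ⊗ conj f⟫`. -/
def kernelFunctional (κ : Lp ℂ 2 (μ.prod μ)) (f : Lp ℂ 2 μ) : Lp ℂ 2 μ →L[ℂ] ℂ :=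
  LinearMap.mkContinuous
    { toFun := fun g => inner ℂ κ (tensor μ g f)
      map_add' := fun g g' => by rw [tensor_add_left, inner_add_right]
      map_smul' := fun c g => by rw [tensor_smul_left, inner_smul_right]; rfl }
    (‖κ‖ * ‖f‖) (fun g => by
      refine (norm_inner_le_norm (𝕜 := ℂ) κ (tensor μ g f)).trans (le_of_eq ?_)
      rw [norm_tensor]; ring)

/-- The integral operator with kernel `κ`. -/
def kernelOp (κ : Lp ℂ 2 (μ.prod μ)) : Lp ℂ 2 μ →L[ℂ] Lp ℂ 2 μ :=
  LinearMap.mkContinuous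
    { toFun := fun f => (InnerProductSpace.toDual ℂ (Lp ℂ 2 μ)).symm (kernelFunctional μ κ f)
      map_add' := fun f f' => by
        rw [← map_add]
        congr 1
        ext g
        change inner ℂ κ (tensor μ g (f + f')) = _
        rw [tensor_add_right, inner_add_right]
        rfl
      map_smul' := fun c f => by
        rw [RingHom.id_apply]
        refine (InnerProductSpace.toDual ℂ (Lp ℂ 2 μ)).injective ?_
        rw [LinearIsometryEquiv.apply_symm_apply, map_smulₛₗ, LinearIsometryEquiv.apply_symm_apply]
        ext g
        change inner ℂ κ (tensor μ g (c • f)) = _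
        rw [tensor_smul_right, inner_smul_right]
        rfl }
    ‖κ‖ (fun f => by
      simp only [LinearMap.coe_mk, AddHom.coe_mk, LinearIsometryEquiv.norm_map]
      exact LinearMap.mkContinuous_norm_le _ (by positivity) _)

theorem inner_kernelOp_left (κ : Lp ℂ 2 (μ.prod μ)) (f g : Lp ℂ 2 μ) :
    inner ℂ (kernelOp μ κ f) g = inner ℂ κ (tensor μ g f) := by
  change inner ℂ ((InnerProductSpace.toDual ℂ (Lp ℂ 2 μ)).symm (kernelFunctional μ κ f)) g = _
  rw [InnerProductSpace.toDual_symm_apply]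
  rfl

theorem inner_kernelOp (κ : Lp ℂ 2 (μ.prod μ)) (f g : Lp ℂ 2 μ) :
    inner ℂ g (kernelOp μ κ f) = inner ℂ (tensor μ g f) κ := by
  rw [← inner_conj_symm, inner_kernelOp_left, inner_conj_symm]

/-- The matrix entries of the operator in a Hilbert basis are the coefficients of κ along the
orthonormal system e_a ⊗ conj e_b. Bessel's inequality makes them square summable; completeness of
that system is not needed. -/
theorem isCompactOperator_kernelOp (κ : Lp ℂ 2 (μ.prod μ)) :
    IsCompactOperator (kernelOp μ κ) := by
  classical
  obtain ⟨w, e, -⟩ := exists_hilbertBasis ℂ (Lp ℂ 2 μ)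
  refine isCompactOperator_of_summable e _ ?_
  have horth : Orthonormal ℂ (fun p : w × w => tensor μ (e p.1) (e p.2)) := by
    rw [orthonormal_iff_ite]
    rintro ⟨a, b⟩ ⟨a', b'⟩
    have h := orthonormal_iff_ite.1 e.orthonormal
    rw [inner_tensor, h, h]
    by_cases h1 : a = a' <;> by_cases h2 : b = b' <;> simp [h1, h2, Ne.symm]
  have hs : Summable fun p : w × w => ‖inner ℂ (tensor μ (e p.1) (e p.2)) κ‖ ^ 2 :=
    horth.inner_products_summable κ
  -- Summation over the first index at fixed b produces ‖T e_b‖² by Parseval.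
  have h2 := hs.prod_symm.prod
  refine h2.congr fun b => ?_
  have h3 := e.tsum_inner_mul_inner (kernelOp μ κ (e b)) (kernelOp μ κ (e b))
  rw [inner_self_eq_norm_sq_to_K] at h3
  have h4 : ∀ a, inner ℂ (kernelOp μ κ (e b)) (e a) * inner ℂ (e a) (kernelOp μ κ (e b)) =
      ((‖inner ℂ (tensor μ (e a) (e b)) κ‖ ^ 2 : ℝ) : ℂ) := by
    intro a
    rw [inner_kernelOp, ← inner_conj_symm, inner_kernelOp, Complex.conj_mul']
    simp
  simp_rw [h4] at h3
  rw [← Complex.ofReal_tsum] at h3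
  simp only [Prod.swap_prod_mk]
  exact Complex.ofReal_injective (by rw [h3]; simp)

end Kernel

/-! ### The Japanese bracket -/

theorem japanese_pos (s : ℝ) (x : R3) : 0 < japanese s x := by
  unfold japanese; positivity

theorem one_le_japanese_one (x : R3) : 1 ≤ japanese 1 x :=
  Real.one_le_rpow (by nlinarith [sq_nonneg ‖x‖]) (by norm_num)

theorem japanese_eq_rpow (s : ℝ) (x : R3) : japanese s x = japanese 1 x ^ s := by
  unfold japanese
  rw [← Real.rpow_mul (by positivity)]
  congr 1; ring

theorem japanese_add (s t : ℝ) (x : R3) : japanese (s + t) x = japanese s x * japanese t x := by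
  unfold japanese
  rw [← Real.rpow_add (by positivity)]
  congr 1; ring

theorem japanese_zero (x : R3) : japanese 0 x = 1 := by simp [japanese]

theorem japanese_neg (s : ℝ) (x : R3) : japanese (-s) x = (japanese s x)⁻¹ := by
  unfold japanese
  rw [neg_div, Real.rpow_neg (by positivity)]

theorem japanese_two (x : R3) : japanese 2 x = 1 + ‖x‖ ^ 2 := by
  simp [japanese]

theorem japanese_mono {s t : ℝ} (h : s ≤ t) (x : R3) : japanese s x ≤ japanese t x := by
  rw [japanese_eq_rpow s, japanese_eq_rpow t]
  exact Real.rpow_le_rpow_of_exponent_le (one_le_japanese_one x) h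

theorem japanese_le_one {s : ℝ} (h : s ≤ 0) (x : R3) : japanese s x ≤ 1 := by
  rw [← japanese_zero x]; exact japanese_mono h x

theorem japanese_sq (s : ℝ) (x : R3) : japanese s x ^ 2 = japanese (2 * s) x := by
  rw [two_mul, japanese_add, sq]

theorem continuous_japanese (s : ℝ) : Continuous (japanese s) := by
  unfold japanese
  refine Continuous.rpow_const (by fun_prop) fun x => Or.inl (by positivity)

theorem japanese_symm (s : ℝ) (x : R3) : japanese s (-x) = japanese s x := by
  simp [japanese]

theorem japanese_one_sq (x : R3) : japanese 1 x ^ 2 = 1 + ‖x‖ ^ 2 := by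
  rw [japanese_sq, mul_one, japanese_two]

theorem norm_le_japanese (x : R3) : ‖x‖ ≤ japanese 1 x :=
  le_of_sq_le_sq (by rw [japanese_one_sq]; linarith) (japanese_pos _ _).le

/-- ⟨x⟩ is the length of the vector (1, x), so this is a triangle inequality. -/
theorem japanese_one_le_add_norm (x y : R3) : japanese 1 x ≤ japanese 1 y + ‖x - y‖ := by
  refine le_of_sq_le_sq ?_ (add_nonneg (japanese_pos _ _).le (norm_nonneg _))
  have h1 : ‖x‖ ≤ ‖y‖ + ‖x - y‖ := by
    have := norm_add_le y (x - y)
    simpa using this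
  have h2 := norm_le_japanese y
  have h3 := norm_nonneg (x - y)
  have h4 := norm_nonneg x
  rw [add_sq, japanese_one_sq, japanese_one_sq]
  nlinarith

theorem japanese_one_le_add (x y : R3) : japanese 1 x ≤ japanese 1 y + japanese 1 (x - y) :=
  (japanese_one_le_add_norm x y).trans (by linarith [norm_le_japanese (x - y)])

/-! ### The weighted Newton kernel is Hilbert–Schmidt -/

theorem integrable_japanese {q : ℝ} (hq : 3 < q) : Integrable (japanese (-q)) := by
  have h := integrable_rpow_neg_one_add_norm_sq (E := R3) (μ := volume) (r := q)
    (by simpa using hq)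
  unfold japanese
  exact h

/-- The comparison of powers behind `integrable_kernel`. -/
theorem rpow_kernel_bound {a q r A B : ℝ} (hA : 1 ≤ A) (hAB : A ≤ B) (hr : q ≤ r)
    (hq : 2 * q ≤ a + r) : A ^ (-a) * B ^ (-r) ≤ A ^ (-q) * B ^ (-q) := by
  have hA0 : 0 < A := by linarith
  have hB0 : 0 < B := by linarith
  have h1 : B ^ (-r) = B ^ (-(r - q)) * B ^ (-q) := by
    rw [← Real.rpow_add hB0]; congr 1; ring
  have h2 : B ^ (-(r - q)) ≤ A ^ (-(r - q)) :=
    Real.rpow_le_rpow_of_nonpos hA0 hAB (by linarith)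
  have h3 : A ^ (-a) * A ^ (-(r - q)) ≤ A ^ (-q) := by
    rw [← Real.rpow_add hA0]
    exact Real.rpow_le_rpow_of_exponent_le hA (by linarith)
  rw [h1, ← mul_assoc]
  refine mul_le_mul_of_nonneg_right ?_ (by positivity)
  exact (mul_le_mul_of_nonneg_left h2 (by positivity)).trans h3

theorem rpow_neg_le_of_le_two_mul {r A B : ℝ} (hA : 0 < A) (hAB : A ≤ 2 * B) (hr : 0 ≤ r) :
    B ^ (-r) ≤ 2 ^ r * A ^ (-r) := by
  have hB : 0 < B := by linarith
  have h1 : (2 * B) ^ (-r) ≤ A ^ (-r) := Real.rpow_le_rpow_of_nonpos hA hAB (by linarith)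
  rw [Real.mul_rpow (by norm_num) hB.le, Real.rpow_neg (by norm_num : (0:ℝ) ≤ 2)] at h1
  have h2 : (0 : ℝ) < 2 ^ r := by positivity
  rwa [inv_mul_le_iff₀ h2] at h1

/-- The square of the kernel of `⟨x⟩^{-a} G₀ ⟨x⟩^{-b}`, up to a constant. -/
theorem kernel_bound {a b : ℝ} (ha : 1 / 2 < a) (hb : 1 / 2 < b) (hab : 2 < a + b) :
    ∃ q : ℝ, 3 < q ∧ ∃ K : ℝ, 0 ≤ K ∧ ∀ x y : R3,
      japanese (-(2 * a)) x * (‖x - y‖ ^ 2)⁻¹ * japanese (-(2 * b)) y ≤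
        K * (japanese (-q) x * japanese (-q) y) + K * (japanese (-q) y *
          (japanese (-q) (x - y) + (Metric.ball (0 : R3) 1).indicator (fun z => (‖z‖ ^ 2)⁻¹) (x - y))) := by
  -- q ≤ 2a + 2 and q ≤ 2b + 2 are needed when one bracket absorbs the exponent 2 of the squared
  -- Newton kernel, and 2q must not exceed the total exponent 2a + 2b + 2. The requirement q > 3,
  -- integrability of ⟨x⟩^{-q}, is then exactly a > 1/2, b > 1/2, a + b > 2.
  set q := min (min (2 * a + 2) (2 * b + 2)) (a + b + 1) with hqdef
  have hq1 : q ≤ 2 * a + 2 := (min_le_left _ _).trans (min_le_left _ _)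
  have hq2 : q ≤ 2 * b + 2 := (min_le_left _ _).trans (min_le_right _ _)
  have hq3 : q ≤ a + b + 1 := min_le_right _ _
  have hq : 3 < q := lt_min (lt_min (by linarith) (by linarith)) (by linarith)
  refine ⟨q, hq, 2 * 2 ^ (2 * a + 2 : ℝ) * 2 ^ (2 : ℝ) * 2 ^ (2 * b : ℝ), by positivity, fun x y => ?_⟩
  have t1 : (1 : ℝ) ≤ 2 ^ (2 * a + 2 : ℝ) := Real.one_le_rpow (by norm_num) (by linarith)
  have t2 : (1 : ℝ) ≤ 2 ^ (2 : ℝ) := Real.one_le_rpow (by norm_num) (by norm_num)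
  have t3 : (1 : ℝ) ≤ 2 ^ (2 * b : ℝ) := Real.one_le_rpow (by norm_num) (by linarith)
  have t4 : (2 : ℝ) ^ (2 * a : ℝ) ≤ 2 ^ (2 * a + 2 : ℝ) :=
    Real.rpow_le_rpow_of_exponent_le (by norm_num) (by linarith)
  set K := 2 * (2 : ℝ) ^ (2 * a + 2 : ℝ) * 2 ^ (2 : ℝ) * 2 ^ (2 * b : ℝ) with hK
  have hX := one_le_japanese_one x
  have hY := one_le_japanese_one y
  have hZ := one_le_japanese_one (x - y)
  have jq := japanese_eq_rpow
  have hpos := japanese_pos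
  have hsymm : japanese 1 (y - x) = japanese 1 (x - y) := by
    rw [← japanese_symm, neg_sub]
  rw [japanese_eq_rpow (-(2 * a)), japanese_eq_rpow (-(2 * b)), japanese_eq_rpow (-q) x,
    japanese_eq_rpow (-q) y, japanese_eq_rpow (-q) (x - y)]
  have hxy := japanese_one_le_add x y
  have hyx := japanese_one_le_add y x
  rw [hsymm] at hyx
  have hzx : japanese 1 (x - y) ≤ japanese 1 x + japanese 1 y := by
    have := japanese_one_le_add (x - y) x
    rwa [show x - y - x = -y by abel, japanese_symm] at this
  have hxy' := japanese_one_le_add_norm x y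
  have hXsq := japanese_one_sq (x - y)
  set X := japanese 1 x
  set Y := japanese 1 y
  set Z := japanese 1 (x - y)
  have hX0 : 0 < X := by linarith
  have hY0 : 0 < Y := by linarith
  have hZ0 : 0 < Z := by linarith
  -- Near the diagonal ⟨x⟩ and ⟨y⟩ are comparable, and the singularity is kept because it is locally
  -- integrable in dimension three.
  by_cases hn : ‖x - y‖ < 1
  · have hmem : x - y ∈ Metric.ball (0 : R3) 1 := by simpa using hn
    rw [Set.indicator_of_mem hmem]
    have e1 : X ^ (-(2 * a)) ≤ 2 ^ (2 * a) * Y ^ (-(2 * a)) := by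
      refine rpow_neg_le_of_le_two_mul hY0 ?_ (by linarith)
      have : Y ≤ X + ‖x - y‖ := by
        rw [norm_sub_rev]; exact japanese_one_le_add_norm y x
      linarith
    have e2 : Y ^ (-(2 * a)) * Y ^ (-(2 * b)) ≤ Y ^ (-q) := by
      rw [← Real.rpow_add hY0]
      exact Real.rpow_le_rpow_of_exponent_le hY (by linarith)
    have hKK : (2 : ℝ) ^ (2 * a) ≤ K := by
      rw [hK]
      have : (0:ℝ) < 2 ^ (2 * a + 2 : ℝ) := by positivity
      calc (2 : ℝ) ^ (2 * a) ≤ 2 ^ (2 * a + 2 : ℝ) := t4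
        _ ≤ 2 * 2 ^ (2 * a + 2 : ℝ) * 1 * 1 := by linarith
        _ ≤ _ := by gcongr
    set n := (‖x - y‖ ^ 2)⁻¹
    have hn0 : 0 ≤ n := by positivity
    calc X ^ (-(2 * a)) * n * Y ^ (-(2 * b))
        ≤ (2 ^ (2 * a) * Y ^ (-(2 * a))) * n * Y ^ (-(2 * b)) := by gcongr
      _ = 2 ^ (2 * a) * n * (Y ^ (-(2 * a)) * Y ^ (-(2 * b))) := by ring
      _ ≤ K * n * Y ^ (-q) := by gcongr
      _ ≤ K * (X ^ (-q) * Y ^ (-q)) + (K * (Y ^ (-q) * Z ^ (-q)) + K * n * Y ^ (-q)) := by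
        have : 0 ≤ K := by positivity
        have h1 : 0 ≤ K * (X ^ (-q) * Y ^ (-q)) := by positivity
        have h2 : 0 ≤ K * (Y ^ (-q) * Z ^ (-q)) := by positivity
        linarith
      _ = _ := by ring
  · have hind : 0 ≤ (Metric.ball (0 : R3) 1).indicator (fun z => (‖z‖ ^ 2)⁻¹) (x - y) :=
      Set.indicator_nonneg (fun z _ => by positivity) _
    set I := (Metric.ball (0 : R3) 1).indicator (fun z => (‖z‖ ^ 2)⁻¹) (x - y)
    push Not at hn
    have hz : (‖x - y‖ ^ 2)⁻¹ ≤ 2 * Z ^ (-(2:ℝ)) := by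
      have : Z ^ (-(2:ℝ)) = (Z ^ 2)⁻¹ := by
        rw [Real.rpow_neg hZ0.le]; norm_num
      rw [this, hXsq, ← div_eq_mul_inv, inv_eq_one_div, div_le_div_iff₀ (by positivity) (by positivity)]
      nlinarith
    have hK0 : 0 ≤ K := by positivity
    have main : X ^ (-(2 * a)) * (2 * Z ^ (-(2:ℝ))) * Y ^ (-(2 * b)) ≤
        K * (X ^ (-q) * Y ^ (-q)) + K * (Y ^ (-q) * Z ^ (-q)) := by
      have n1 : 0 ≤ K * (X ^ (-q) * Y ^ (-q)) := by positivity
      have n2 : 0 ≤ K * (Y ^ (-q) * Z ^ (-q)) := by positivity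
      -- Each of ⟨x⟩, ⟨y⟩, ⟨x-y⟩ is at most the sum of the other two, so the two largest agree up to
      -- a factor 2. Their powers are merged into a power of one of them, and `rpow_kernel_bound`
      -- moves the excess exponent to the smallest bracket.
      rcases le_total X Y with h1 | h1
      · rcases le_total X Z with h2 | h2
        · have e1 : Z ^ (-(2:ℝ)) ≤ 2 ^ (2:ℝ) * Y ^ (-(2:ℝ)) :=
            rpow_neg_le_of_le_two_mul hY0 (by linarith) (by norm_num)
          have e2 : X ^ (-(2 * a)) * Y ^ (-(2 + 2 * b)) ≤ X ^ (-q) * Y ^ (-q) :=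
            rpow_kernel_bound hX h1 (by linarith) (by linarith)
          have e3 : Y ^ (-(2 + 2 * b)) = Y ^ (-(2:ℝ)) * Y ^ (-(2 * b)) := by
            rw [← Real.rpow_add hY0]; congr 1; ring
          have hKK : 2 * (2 : ℝ) ^ (2 : ℝ) ≤ K := by
            rw [hK]
            calc 2 * (2 : ℝ) ^ (2 : ℝ) = 2 * 1 * 2 ^ (2 : ℝ) * 1 := by ring
              _ ≤ _ := by gcongr
          calc X ^ (-(2 * a)) * (2 * Z ^ (-(2:ℝ))) * Y ^ (-(2 * b))
              ≤ X ^ (-(2 * a)) * (2 * (2 ^ (2:ℝ) * Y ^ (-(2:ℝ)))) * Y ^ (-(2 * b)) := by gcongr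
            _ = 2 * 2 ^ (2:ℝ) * (X ^ (-(2 * a)) * Y ^ (-(2 + 2 * b))) := by rw [e3]; ring
            _ ≤ K * (X ^ (-q) * Y ^ (-q)) := by gcongr
            _ ≤ _ := by linarith
        · have e1 : X ^ (-(2 * a)) ≤ 2 ^ (2 * a) * Y ^ (-(2 * a)) :=
            rpow_neg_le_of_le_two_mul hY0 (by linarith) (by linarith)
          have e2 : Z ^ (-(2:ℝ)) * Y ^ (-(2 * a + 2 * b)) ≤ Z ^ (-q) * Y ^ (-q) :=
            rpow_kernel_bound hZ (by linarith) (by linarith) (by linarith)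
          have e3 : Y ^ (-(2 * a + 2 * b)) = Y ^ (-(2 * a)) * Y ^ (-(2 * b)) := by
            rw [← Real.rpow_add hY0]; congr 1; ring
          have hKK : 2 * (2 : ℝ) ^ (2 * a) ≤ K := by
            rw [hK]
            calc 2 * (2 : ℝ) ^ (2 * a) ≤ 2 * 2 ^ (2 * a + 2) * 1 * 1 := by linarith
              _ ≤ _ := by gcongr
          calc X ^ (-(2 * a)) * (2 * Z ^ (-(2:ℝ))) * Y ^ (-(2 * b))
              ≤ (2 ^ (2 * a) * Y ^ (-(2 * a))) * (2 * Z ^ (-(2:ℝ))) * Y ^ (-(2 * b)) := by gcongr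
            _ = 2 * 2 ^ (2 * a) * (Z ^ (-(2:ℝ)) * Y ^ (-(2 * a + 2 * b))) := by rw [e3]; ring
            _ ≤ K * (Z ^ (-q) * Y ^ (-q)) := by gcongr
            _ = K * (Y ^ (-q) * Z ^ (-q)) := by ring
            _ ≤ _ := by linarith
      · rcases le_total Y Z with h2 | h2
        · have e1 : Z ^ (-(2:ℝ)) ≤ 2 ^ (2:ℝ) * X ^ (-(2:ℝ)) :=
            rpow_neg_le_of_le_two_mul hX0 (by linarith) (by norm_num)
          have e2 : Y ^ (-(2 * b)) * X ^ (-(2 + 2 * a)) ≤ Y ^ (-q) * X ^ (-q) :=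
            rpow_kernel_bound hY h1 (by linarith) (by linarith)
          have e3 : X ^ (-(2 + 2 * a)) = X ^ (-(2:ℝ)) * X ^ (-(2 * a)) := by
            rw [← Real.rpow_add hX0]; congr 1; ring
          have hKK : 2 * (2 : ℝ) ^ (2 : ℝ) ≤ K := by
            rw [hK]
            calc 2 * (2 : ℝ) ^ (2 : ℝ) = 2 * 1 * 2 ^ (2 : ℝ) * 1 := by ring
              _ ≤ _ := by gcongr
          calc X ^ (-(2 * a)) * (2 * Z ^ (-(2:ℝ))) * Y ^ (-(2 * b))
              ≤ X ^ (-(2 * a)) * (2 * (2 ^ (2:ℝ) * X ^ (-(2:ℝ)))) * Y ^ (-(2 * b)) := by gcongr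
            _ = 2 * 2 ^ (2:ℝ) * (Y ^ (-(2 * b)) * X ^ (-(2 + 2 * a))) := by rw [e3]; ring
            _ ≤ K * (Y ^ (-q) * X ^ (-q)) := by gcongr
            _ = K * (X ^ (-q) * Y ^ (-q)) := by ring
            _ ≤ _ := by linarith
        · have e1 : X ^ (-(2 * a)) ≤ 2 ^ (2 * a) * Y ^ (-(2 * a)) :=
            rpow_neg_le_of_le_two_mul hY0 (by linarith) (by linarith)
          have e2 : Z ^ (-(2:ℝ)) * Y ^ (-(2 * a + 2 * b)) ≤ Z ^ (-q) * Y ^ (-q) :=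
            rpow_kernel_bound hZ h2 (by linarith) (by linarith)
          have e3 : Y ^ (-(2 * a + 2 * b)) = Y ^ (-(2 * a)) * Y ^ (-(2 * b)) := by
            rw [← Real.rpow_add hY0]; congr 1; ring
          have hKK : 2 * (2 : ℝ) ^ (2 * a) ≤ K := by
            rw [hK]
            calc 2 * (2 : ℝ) ^ (2 * a) ≤ 2 * 2 ^ (2 * a + 2) * 1 * 1 := by linarith
              _ ≤ _ := by gcongr
          calc X ^ (-(2 * a)) * (2 * Z ^ (-(2:ℝ))) * Y ^ (-(2 * b))
              ≤ (2 ^ (2 * a) * Y ^ (-(2 * a))) * (2 * Z ^ (-(2:ℝ))) * Y ^ (-(2 * b)) := by gcongr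
            _ = 2 * 2 ^ (2 * a) * (Z ^ (-(2:ℝ)) * Y ^ (-(2 * a + 2 * b))) := by rw [e3]; ring
            _ ≤ K * (Z ^ (-q) * Y ^ (-q)) := by gcongr
            _ = K * (Y ^ (-q) * Z ^ (-q)) := by ring
            _ ≤ _ := by linarith
    calc X ^ (-(2 * a)) * (‖x - y‖ ^ 2)⁻¹ * Y ^ (-(2 * b))
        ≤ X ^ (-(2 * a)) * (2 * Z ^ (-(2:ℝ))) * Y ^ (-(2 * b)) := by gcongr
      _ ≤ _ := main
      _ ≤ _ := by
        have : 0 ≤ K * (Y ^ (-q) * I) := by positivity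
        linarith

theorem locallyIntegrable_norm_sq_inv : LocallyIntegrable (fun z : R3 => (‖z‖ ^ 2)⁻¹) := by
  refine locallyIntegrable_of_norm_le_rpow (C := 1) (α := 2) (by simp) (by norm_num) ?_ ?_
  · refine Eventually.of_forall fun x => ?_
    simp
  · exact Measurable.aestronglyMeasurable (by fun_prop)

/-- The kernel of `⟨x⟩^{-a} G₀ ⟨x⟩^{-b}`. -/
def weightedKernel (a b : ℝ) (z : R3 × R3) : ℂ :=
  ((japanese (-a) z.1 * (4 * Real.pi * ‖z.1 - z.2‖)⁻¹ * japanese (-b) z.2 : ℝ) : ℂ)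

theorem measurable_weightedKernel (a b : ℝ) : Measurable (weightedKernel a b) := by
  unfold weightedKernel
  have h1 := (continuous_japanese (-a)).measurable
  have h2 := (continuous_japanese (-b)).measurable
  fun_prop

/-- `kernel_bound` dominates the squared kernel by a product ⟨x⟩^{-q}⟨y⟩^{-q} and by the integrand
of a convolution of two integrable functions. -/
theorem memLp_weightedKernel {a b : ℝ} (ha : 1 / 2 < a) (hb : 1 / 2 < b) (hab : 2 < a + b) :
    MemLp (weightedKernel a b) 2 ((volume : Measure R3).prod volume) := by
  have hm : AEStronglyMeasurable (weightedKernel a b) ((volume : Measure R3).prod volume) :=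
    (measurable_weightedKernel a b).aestronglyMeasurable
  rw [memLp_two_iff_integrable_sq_norm hm]
  obtain ⟨q, hq, K, hK, hbound⟩ := kernel_bound ha hb hab
  have hj := integrable_japanese hq
  have hball : Integrable ((Metric.ball (0 : R3) 1).indicator (fun z : R3 => (‖z‖ ^ 2)⁻¹)) :=
    (integrable_indicator_iff measurableSet_ball).2
      (((locallyIntegrable_norm_sq_inv).integrableOn_isCompact
        (isCompact_closedBall (0 : R3) 1)).mono_set Metric.ball_subset_closedBall)
  have h1 := (hj.mul_prod hj).const_mul K
  have h2 := (Integrable.convolution_integrand (ContinuousLinearMap.mul ℝ ℝ) hj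
    (hj.add hball)).const_mul K
  refine ((h1.add h2).const_mul ((4 * Real.pi) ^ 2)⁻¹).mono' (hm.norm.pow 2) ?_
  refine Eventually.of_forall fun z => ?_
  have h := hbound z.1 z.2
  have e : ‖weightedKernel a b z‖ ^ 2 = ((4 * Real.pi) ^ 2)⁻¹ *
      (japanese (-(2 * a)) z.1 * (‖z.1 - z.2‖ ^ 2)⁻¹ * japanese (-(2 * b)) z.2) := by
    unfold weightedKernel
    rw [Complex.norm_real, Real.norm_eq_abs, sq_abs, mul_pow, mul_pow, japanese_sq, japanese_sq,
      inv_pow, mul_pow]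
    rw [show 2 * -a = -(2 * a) by ring, show 2 * -b = -(2 * b) by ring, mul_inv]
    ring
  rw [Real.norm_of_nonneg (by positivity), e]
  refine mul_le_mul_of_nonneg_left ?_ (by positivity)
  simpa using h

/-- The operator `⟨x⟩^{-a} G₀ ⟨x⟩^{-b}` on square integrable functions
(`0` for inadmissible exponents). -/
def weightedNewton (a b : ℝ) : L2 →L[ℂ] L2 := by
  classical
  exact if h : 1 / 2 < a ∧ 1 / 2 < b ∧ 2 < a + b then
    kernelOp volume ((memLp_weightedKernel h.1 h.2.1 h.2.2).toLp _) else 0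

theorem isCompactOperator_weightedNewton (a b : ℝ) :
    IsCompactOperator (weightedNewton a b) := by
  classical
  unfold weightedNewton
  split_ifs
  · exact isCompactOperator_kernelOp _ _
  · exact isCompactOperator_zero

theorem inner_weightedNewton {a b : ℝ} (ha : 1 / 2 < a) (hb : 1 / 2 < b) (hab : 2 < a + b)
    (f g : L2) :
    Integrable (fun z : R3 × R3 => starRingEnd ℂ (g z.1) * weightedKernel a b z * f z.2)
        ((volume : Measure R3).prod volume) ∧
      inner ℂ g (weightedNewton a b f) =
        ∫ z : R3 × R3, starRingEnd ℂ (g z.1) * weightedKernel a b z * f z.2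
          ∂((volume : Measure R3).prod volume) := by
  have hκ := memLp_weightedKernel ha hb hab
  have hop : weightedNewton a b = kernelOp volume (hκ.toLp _) := by
    unfold weightedNewton
    rw [dif_pos ⟨ha, hb, hab⟩]
  have hae : (fun z : R3 × R3 => inner ℂ (tensor volume g f z) (hκ.toLp _ z))
      =ᵐ[(volume : Measure R3).prod volume]
      fun z => starRingEnd ℂ (g z.1) * weightedKernel a b z * f z.2 := by
    filter_upwards [coeFn_tensor volume g f, hκ.coeFn_toLp] with z h1 h2
    rw [h1, h2]
    simp
    ring
  constructor
  · exact (L2.integrable_inner (tensor volume g f) (hκ.toLp _)).congr hae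
  · rw [hop, inner_kernelOp, L2.inner_def]
    exact integral_congr_ae hae

open ContinuousLinearMap in
theorem adjoint_weightedNewton (a : ℝ) :
    adjoint (weightedNewton a a) = weightedNewton a a := by
  by_cases h : 1 / 2 < a ∧ 1 / 2 < a ∧ 2 < a + a
  · symm
    rw [eq_adjoint_iff]
    intro f g
    rw [← inner_conj_symm, (inner_weightedNewton h.1 h.2.1 h.2.2 f g).2,
      (inner_weightedNewton h.1 h.2.1 h.2.2 g f).2, ← integral_conj,
      ← integral_prod_swap]
    refine integral_congr_ae (Eventually.of_forall fun z => ?_)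
    simp [weightedKernel, norm_sub_rev z.1 z.2, Complex.conj_ofNat]
    ring
  · unfold weightedNewton
    rw [dif_neg h, map_zero]

/-! ### Symbols -/

/-- The `j`-th vector of the standard basis. -/
def unitVec (j : Fin 3) : R3 := EuclideanSpace.single j (1 : ℝ)

theorem inner_unitVec (x : R3) (j : Fin 3) : inner ℝ x (unitVec j) = x j := by
  simp [unitVec, EuclideanSpace.inner_single_right]

/-- Smooth functions of temperate growth whose derivatives up to order `n` are bounded. -/
def IsSymbol : ℕ → (R3 → ℂ) → Prop
  | 0, m => m.HasTemperateGrowth ∧ ∃ c : ℝ, ∀ ξ, ‖m ξ‖ ≤ c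
  | n + 1, m => (m.HasTemperateGrowth ∧ ∃ c : ℝ, ∀ ξ, ‖m ξ‖ ≤ c) ∧
      ∀ j, IsSymbol n (fun ξ => fderiv ℝ m ξ (unitVec j))

theorem IsSymbol.zero_order {n : ℕ} {m : R3 → ℂ} (h : IsSymbol n m) : IsSymbol 0 m := by
  cases n with
  | zero => exact h
  | succ n => exact h.1

theorem IsSymbol.temperate {n : ℕ} {m : R3 → ℂ} (h : IsSymbol n m) : m.HasTemperateGrowth :=
  h.zero_order.1

theorem IsSymbol.differentiable {n : ℕ} {m : R3 → ℂ} (h : IsSymbol n m) : Differentiable ℝ m :=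
  h.temperate.1.differentiable (by simp)

theorem IsSymbol.of_succ : ∀ {n : ℕ} {m : R3 → ℂ}, IsSymbol (n + 1) m → IsSymbol n m
  | 0, _, h => h.1
  | _ + 1, _, h => ⟨h.1, fun j => (h.2 j).of_succ⟩

theorem IsSymbol.const (n : ℕ) (c : ℂ) : IsSymbol n (fun _ => c) := by
  induction n generalizing c with
  | zero => exact ⟨.const c, ‖c‖, fun _ => le_rfl⟩
  | succ n ih =>
    refine ⟨⟨.const c, ‖c‖, fun _ => le_rfl⟩, fun j => ?_⟩
    simpa using ih 0

theorem IsSymbol.add {n : ℕ} {m m' : R3 → ℂ} (h : IsSymbol n m) (h' : IsSymbol n m') :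
    IsSymbol n (fun ξ => m ξ + m' ξ) := by
  induction n generalizing m m' with
  | zero =>
    obtain ⟨h1, c, hc⟩ := h
    obtain ⟨h1', c', hc'⟩ := h'
    exact ⟨h1.add h1', c + c', fun ξ => (norm_add_le _ _).trans (add_le_add (hc ξ) (hc' ξ))⟩
  | succ n ih =>
    obtain ⟨h1, c, hc⟩ := h.1
    obtain ⟨h1', c', hc'⟩ := h'.1
    refine ⟨⟨h1.add h1', c + c',
      fun ξ => (norm_add_le _ _).trans (add_le_add (hc ξ) (hc' ξ))⟩, fun j => ?_⟩
    convert ih (h.2 j) (h'.2 j) using 2 with ξ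
    rw [fderiv_fun_add (h.differentiable ξ) (h'.differentiable ξ)]
    rfl

theorem IsSymbol.mul {n : ℕ} {m m' : R3 → ℂ} (h : IsSymbol n m) (h' : IsSymbol n m') :
    IsSymbol n (fun ξ => m ξ * m' ξ) := by
  have h0 : ∀ {k : ℕ} {m m' : R3 → ℂ}, IsSymbol k m → IsSymbol k m' →
      IsSymbol 0 (fun ξ => m ξ * m' ξ) := by
    intro k m m' h h'
    obtain ⟨h1, c, hc⟩ := h.zero_order
    obtain ⟨h1', c', hc'⟩ := h'.zero_order
    refine ⟨h1.mul h1', c * c', fun ξ => ?_⟩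
    rw [norm_mul]
    exact mul_le_mul (hc ξ) (hc' ξ) (norm_nonneg _) ((norm_nonneg _).trans (hc ξ))
  induction n generalizing m m' with
  | zero => exact h0 h h'
  | succ n ih =>
    refine ⟨h0 h h', fun j => ?_⟩
    convert (ih h.of_succ (h'.2 j)).add (ih h'.of_succ (h.2 j)) using 2 with ξ
    rw [fderiv_fun_mul (h.differentiable ξ) (h'.differentiable ξ)]
    simp

/-- The symbol of `(1 - Δ) ^ (k / 2)`. -/
def besselSymbol (k : ℝ) (ξ : R3) : ℂ := (japanese k ((2 * Real.pi) • ξ) : ℂ)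

/-- The symbol of `P_j (1 - Δ) ^ (- 1 / 2)`. -/
def rieszSymbol (j : Fin 3) (ξ : R3) : ℂ :=
  ((2 * Real.pi * inner ℝ ξ (unitVec j) : ℝ) : ℂ) * besselSymbol (-1) ξ

theorem besselSymbol_temperate (k : ℝ) : (besselSymbol k).HasTemperateGrowth :=
  hasTemperateGrowth_symbol k

theorem besselSymbol_add (k l : ℝ) (ξ : R3) :
    besselSymbol (k + l) ξ = besselSymbol k ξ * besselSymbol l ξ := by
  simp [besselSymbol, japanese_add]

theorem coordSymbol_temperate (j : Fin 3) :
    (fun ξ : R3 => ((2 * Real.pi * inner ℝ ξ (unitVec j) : ℝ) : ℂ)).HasTemperateGrowth := by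
  fun_prop

theorem rieszSymbol_temperate (j : Fin 3) : (rieszSymbol j).HasTemperateGrowth :=
  (coordSymbol_temperate j).mul (besselSymbol_temperate (-1))

theorem norm_besselSymbol (ξ : R3) : ‖besselSymbol (-1) ξ‖ ≤ 1 := by
  rw [besselSymbol, Complex.norm_real, Real.norm_of_nonneg (japanese_pos _ _).le]
  exact japanese_le_one (by norm_num) _

theorem norm_rieszSymbol (j : Fin 3) (ξ : R3) : ‖rieszSymbol j ξ‖ ≤ 1 := by
  have h1 : |2 * Real.pi * inner ℝ ξ (unitVec j)| ≤ japanese 1 ((2 * Real.pi) • ξ) := by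
    refine le_trans ?_ (norm_le_japanese _)
    have h2 := abs_real_inner_le_norm ((2 * Real.pi) • ξ) (unitVec j)
    rw [real_inner_smul_left] at h2
    simpa [unitVec] using h2
  rw [rieszSymbol, norm_mul, besselSymbol, Complex.norm_real, Complex.norm_real, Real.norm_eq_abs,
    Real.norm_of_nonneg (japanese_pos _ _).le, japanese_neg, ← div_eq_mul_inv,
    div_le_one (japanese_pos _ _)]
  exact h1

theorem fderiv_besselSymbol (j : Fin 3) (ξ : R3) :
    fderiv ℝ (besselSymbol (-1)) ξ (unitVec j) =
      -(2 * Real.pi : ℂ) * (rieszSymbol j ξ * (besselSymbol (-1) ξ * besselSymbol (-1) ξ)) := by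
  have h1 : HasFDerivAt (fun ξ : R3 => 1 + ‖(2 * Real.pi) • ξ‖ ^ 2)
      ((2 * Real.pi) ^ 2 • ((2 : ℕ) • innerSL ℝ ξ)) ξ := by
    have h2 : (fun ξ : R3 => 1 + ‖(2 * Real.pi) • ξ‖ ^ 2) =
        fun ξ : R3 => 1 + (2 * Real.pi) ^ 2 * ‖ξ‖ ^ 2 := by
      funext ξ
      rw [norm_smul, mul_pow, Real.norm_eq_abs, sq_abs]
    rw [h2]
    have := ((hasStrictFDerivAt_norm_sq ξ).hasFDerivAt.const_mul ((2 * Real.pi) ^ 2)).const_add 1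
    simpa using this
  have h3 := h1.rpow_const (p := -1 / 2) (Or.inl (by positivity))
  have h4 : HasFDerivAt (besselSymbol (-1)) _ ξ := Complex.ofRealCLM.hasFDerivAt.comp ξ h3
  rw [h4.fderiv]
  have hb : ∀ x : R3, japanese (-1) x * (japanese (-1) x * japanese (-1) x) =
      (1 + ‖x‖ ^ 2) ^ (-1 / 2 - 1 : ℝ) := by
    intro x
    rw [← japanese_add, ← japanese_add]
    unfold japanese
    congr 1; norm_num
  have hb' := hb ((2 * Real.pi) • ξ)
  simp only [ContinuousLinearMap.comp_apply, _root_.smul_apply, innerSL_apply_apply,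
    Complex.ofRealCLM_apply, smul_eq_mul, nsmul_eq_mul, rieszSymbol, besselSymbol]
  rw [← hb']
  push_cast
  ring

theorem fderiv_rieszSymbol (i j : Fin 3) (ξ : R3) :
    fderiv ℝ (rieszSymbol j) ξ (unitVec i) =
      (2 * Real.pi * inner ℝ (unitVec i) (unitVec j) : ℂ) * besselSymbol (-1) ξ +
      -(2 * Real.pi : ℂ) * (rieszSymbol j ξ * (rieszSymbol i ξ * besselSymbol (-1) ξ)) := by
  have h1 : HasFDerivAt (fun ξ : R3 => ((2 * Real.pi * inner ℝ ξ (unitVec j) : ℝ) : ℂ))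
      (Complex.ofRealCLM.comp ((2 * Real.pi) • (innerSL ℝ (unitVec j)))) ξ := by
    have h2 : HasFDerivAt (fun ξ : R3 => 2 * Real.pi * inner ℝ ξ (unitVec j))
        ((2 * Real.pi) • (innerSL ℝ (unitVec j))) ξ := by
      have := ((innerSL ℝ (unitVec j)).hasFDerivAt (x := ξ)).const_mul (2 * Real.pi)
      simpa [real_inner_comm] using this
    exact Complex.ofRealCLM.hasFDerivAt.comp ξ h2
  have h2 : DifferentiableAt ℝ (besselSymbol (-1)) ξ :=
    (besselSymbol_temperate (-1)).1.differentiable (by simp) ξ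
  have h3 : rieszSymbol j = fun ξ => ((2 * Real.pi * inner ℝ ξ (unitVec j) : ℝ) : ℂ) *
      besselSymbol (-1) ξ := rfl
  rw [h3, fderiv_fun_mul h1.differentiableAt h2, h1.fderiv]
  simp only [_root_.add_apply, _root_.smul_apply, fderiv_besselSymbol,
    ContinuousLinearMap.comp_apply, innerSL_apply_apply, Complex.ofRealCLM_apply, smul_eq_mul,
    rieszSymbol, real_inner_comm (unitVec j) (unitVec i)]
  push_cast
  ring

/-- The induction is joint because the first derivatives of both kinds of symbol are polynomials in
the symbols of both kinds. -/
theorem isSymbol_bessel_riesz (n : ℕ) :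
    IsSymbol n (besselSymbol (-1)) ∧ ∀ j, IsSymbol n (rieszSymbol j) := by
  induction n with
  | zero => exact ⟨⟨besselSymbol_temperate _, 1, norm_besselSymbol⟩,
      fun j => ⟨rieszSymbol_temperate j, 1, norm_rieszSymbol j⟩⟩
  | succ n ih =>
    refine ⟨⟨⟨besselSymbol_temperate _, 1, norm_besselSymbol⟩, fun j => ?_⟩,
      fun j => ⟨⟨rieszSymbol_temperate j, 1, norm_rieszSymbol j⟩, fun i => ?_⟩⟩
    · simp_rw [fderiv_besselSymbol]
      exact (IsSymbol.const n _).mul ((ih.2 j).mul (ih.1.mul ih.1))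
    · simp_rw [fderiv_rieszSymbol]
      exact ((IsSymbol.const n _).mul ih.1).add
        ((IsSymbol.const n _).mul ((ih.2 j).mul ((ih.2 i).mul ih.1)))

/-- Real symbols with bounded derivatives of all orders. -/
structure IsRealSymbol (m : R3 → ℂ) : Prop where
  symbol : ∀ n, IsSymbol n m
  conj_eq : ∀ ξ, starRingEnd ℂ (m ξ) = m ξ

theorem isRealSymbol_bessel : IsRealSymbol (besselSymbol (-1)) :=
  ⟨fun n => (isSymbol_bessel_riesz n).1, fun ξ => by simp [besselSymbol]⟩

theorem isRealSymbol_riesz (j : Fin 3) : IsRealSymbol (rieszSymbol j) :=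
  ⟨fun n => (isSymbol_bessel_riesz n).2 j, fun ξ => by
    simp [rieszSymbol, besselSymbol, Complex.conj_ofNat]⟩

/-! ### Weighted estimates for Fourier multipliers on Schwartz functions -/

/-- Multiplication of Schwartz functions by `⟨x⟩ ^ s`. -/
def weightS (s : ℝ) : 𝓢(R3, ℂ) →L[ℂ] 𝓢(R3, ℂ) :=
  SchwartzMap.smulLeftCLM ℂ (fun x : R3 => (japanese s x : ℂ))

/-- Fourier multipliers on Schwartz functions. -/
def multS (m : R3 → ℂ) : 𝓢(R3, ℂ) →L[ℂ] 𝓢(R3, ℂ) := SchwartzMap.fourierMultiplierCLM ℂ m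

/-- Multiplication of Schwartz functions by a coordinate. -/
def coordS (j : Fin 3) : 𝓢(R3, ℂ) →L[ℝ] 𝓢(R3, ℂ) :=
  SchwartzMap.smulLeftCLM ℂ (fun x : R3 => inner ℝ x (unitVec j))

theorem weightS_apply (s : ℝ) (φ : 𝓢(R3, ℂ)) (x : R3) :
    weightS s φ x = (japanese s x : ℂ) * φ x := by
  simp [weightS, SchwartzMap.smulLeftCLM_apply_apply (hasTemperateGrowth_japanese s)]

theorem coordS_apply (j : Fin 3) (φ : 𝓢(R3, ℂ)) (x : R3) :
    coordS j φ x = (x j : ℂ) * φ x := by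
  rw [coordS, SchwartzMap.smulLeftCLM_apply_apply (by fun_prop), inner_unitVec]
  simp

theorem weightS_weightS (s t : ℝ) (φ : 𝓢(R3, ℂ)) : weightS s (weightS t φ) = weightS (s + t) φ := by
  ext x
  simp [weightS_apply, japanese_add]
  ring

theorem weightS_zero (φ : 𝓢(R3, ℂ)) : weightS 0 φ = φ := by
  ext x
  simp [weightS_apply, japanese_zero]

theorem multS_apply (m : R3 → ℂ) (φ : 𝓢(R3, ℂ)) :
    multS m φ = FourierTransform.fourierInv
      (SchwartzMap.smulLeftCLM ℂ m (FourierTransform.fourier φ)) := rfl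

theorem lineDeriv_smulLeft {m : R3 → ℂ} (hm : m.HasTemperateGrowth)
    (v : R3) (hm' : (fun ξ => fderiv ℝ m ξ v).HasTemperateGrowth) (f : 𝓢(R3, ℂ)) :
    ∂_{v} (SchwartzMap.smulLeftCLM ℂ m f) =
      SchwartzMap.smulLeftCLM ℂ (fun ξ => fderiv ℝ m ξ v) f
        + SchwartzMap.smulLeftCLM ℂ m (∂_{v} f) := by
  ext x
  rw [SchwartzMap.lineDerivOp_apply_eq_fderiv, _root_.add_apply,
    SchwartzMap.smulLeftCLM_apply_apply hm, SchwartzMap.smulLeftCLM_apply_apply hm',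
    SchwartzMap.lineDerivOp_apply_eq_fderiv]
  have h1 : (SchwartzMap.smulLeftCLM ℂ m f : R3 → ℂ) = fun x => m x * f x := by
    funext x
    rw [SchwartzMap.smulLeftCLM_apply_apply hm, smul_eq_mul]
  rw [h1, fderiv_fun_mul (hm.1.differentiable (by simp) x) f.differentiableAt]
  simp
  ring

/-- The coordinate x_j is a multiple of ∂_j on the Fourier side, so the Leibniz rule computes its
commutator with m(D). The result is again a multiplier, with the bounded symbol ∂_j m. -/
theorem coordS_multS {n : ℕ} {m : R3 → ℂ} (hm : IsSymbol (n + 1) m) (j : Fin 3) (φ : 𝓢(R3, ℂ)) :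
    coordS j (multS m φ) = multS m (coordS j φ) +
      (-(2 * Real.pi * Complex.I)⁻¹ : ℂ) • multS (fun ξ => fderiv ℝ m ξ (unitVec j)) φ := by
  have h0 : (2 * Real.pi * Complex.I : ℂ) ≠ 0 := by
    simp [Real.pi_ne_zero]
  have h1 := SchwartzMap.fourierInv_lineDerivOp_eq
    (SchwartzMap.smulLeftCLM ℂ m (FourierTransform.fourier φ)) (unitVec j)
  rw [lineDeriv_smulLeft hm.temperate _ (hm.2 j).temperate, SchwartzMap.lineDerivOp_fourier_eq,
    FourierTransform.fourier_smul, map_smul, FourierTransform.fourierInv_add,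
    FourierTransform.fourierInv_smul] at h1
  change multS (fun ξ => fderiv ℝ m ξ (unitVec j)) φ +
    (-(2 * Real.pi * Complex.I)) • multS m (coordS j φ) =
    (-(2 * Real.pi * Complex.I)) • coordS j (multS m φ) at h1
  have h2 := congrArg (fun u => (-(2 * Real.pi * Complex.I)⁻¹ : ℂ) • u) h1
  simp only [smul_add, smul_smul] at h2
  rw [neg_mul_neg, inv_mul_cancel₀ h0, one_smul, one_smul] at h2
  rw [← h2, add_comm]

/-- `∫ |φ|² w`. -/
def energy (w : R3 → ℝ) (φ : 𝓢(R3, ℂ)) : ℝ≥0∞ :=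
  ∫⁻ x, ENNReal.ofReal (‖φ x‖ ^ 2 * w x)

theorem energy_weight (s : ℝ) (φ : 𝓢(R3, ℂ)) :
    energy (japanese (2 * s)) φ = ENNReal.ofReal (‖(weightS s φ).toLp 2‖ ^ 2) := by
  have h1 : ‖(weightS s φ).toLp 2‖ ^ 2 = ∫ x, ‖φ x‖ ^ 2 * japanese (2 * s) x := by
    have h2 := inner_self_eq_norm_sq_to_K (𝕜 := ℂ) ((weightS s φ).toLp 2 : L2)
    rw [SchwartzMap.inner_toL2_toL2_eq _ _ volume] at h2
    have h3 : (∫ x, inner ℂ (weightS s φ x) (weightS s φ x)) =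
        ((∫ x, ‖φ x‖ ^ 2 * japanese (2 * s) x : ℝ) : ℂ) := by
      rw [← integral_complex_ofReal]
      refine integral_congr_ae (Eventually.of_forall fun x => ?_)
      simp only [inner_self_eq_norm_sq_to_K, weightS_apply, norm_mul, Complex.norm_real,
        Real.norm_eq_abs, abs_of_pos (japanese_pos s x), ← japanese_sq, Complex.coe_algebraMap]
      push_cast
      ring
    rw [h3] at h2
    refine Complex.ofReal_injective ?_
    rw [h2]
    exact Complex.ofReal_pow _ _
  rw [h1, ofReal_integral_eq_lintegral_ofReal]
  · rfl
  · have h2 := ((weightS s φ).memLp 2 volume).integrable_norm_pow two_ne_zero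
    refine h2.congr (Eventually.of_forall fun x => ?_)
    simp only [weightS_apply, norm_mul, Complex.norm_real, Real.norm_eq_abs, mul_pow,
      ← japanese_sq, sq_abs]
    ring
  · exact Eventually.of_forall fun x => mul_nonneg (by positivity) (japanese_pos _ _).le

theorem energy_mono {w w' : R3 → ℝ} (h : ∀ x, w x ≤ w' x) (φ : 𝓢(R3, ℂ)) :
    energy w φ ≤ energy w' φ :=
  lintegral_mono fun x => ENNReal.ofReal_le_ofReal
    (mul_le_mul_of_nonneg_left (h x) (by positivity))

theorem energy_add_le {w : R3 → ℝ} (hw : ∀ x, 0 ≤ w x) (hwm : Measurable w) (φ ψ : 𝓢(R3, ℂ)) :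
    energy w (φ + ψ) ≤ 2 * energy w φ + 2 * energy w ψ := by
  have hφ : Measurable fun x => φ x := φ.continuous.measurable
  have hψ : Measurable fun x => ψ x := ψ.continuous.measurable
  unfold energy
  rw [← lintegral_const_mul _ (by fun_prop), ← lintegral_const_mul _ (by fun_prop),
    ← lintegral_add_left (by fun_prop)]
  refine lintegral_mono fun x => ?_
  have h2 : ∀ r : ℝ, 2 * ENNReal.ofReal r = ENNReal.ofReal (2 * r) := fun r => by
    rw [ENNReal.ofReal_mul (by norm_num)]; simp
  rw [h2, h2, ← ENNReal.ofReal_add (by have := hw x; positivity) (by have := hw x; positivity)]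
  refine ENNReal.ofReal_le_ofReal ?_
  have h3 : ‖φ x + ψ x‖ ^ 2 ≤ 2 * ‖φ x‖ ^ 2 + 2 * ‖ψ x‖ ^ 2 := by
    have := norm_add_le (φ x) (ψ x)
    have h4 := pow_le_pow_left₀ (norm_nonneg _) this 2
    nlinarith [sq_nonneg (‖φ x‖ - ‖ψ x‖)]
  rw [_root_.add_apply]
  nlinarith [mul_le_mul_of_nonneg_right h3 (hw x)]

theorem energy_smul {w : R3 → ℝ} (c : ℂ) (φ : 𝓢(R3, ℂ)) :
    energy w (c • φ) = ENNReal.ofReal (‖c‖ ^ 2) * energy w φ := by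
  unfold energy
  rw [← lintegral_const_mul' _ _ ENNReal.ofReal_ne_top]
  refine lintegral_congr fun x => ?_
  rw [← ENNReal.ofReal_mul (by positivity), _root_.smul_apply, norm_smul]
  congr 1; ring

/-- As ⟨x⟩² = 1 + Σ x_j², two further powers of the weight cost one multiplication by a coordinate.
This drives the induction on the weight. -/
theorem energy_succ (s : ℝ) (φ : 𝓢(R3, ℂ)) :
    energy (japanese (s + 2)) φ =
      energy (japanese s) φ + ∑ j, energy (japanese s) (coordS j φ) := by
  have hφ : Measurable fun x => φ x := φ.continuous.measurable
  have hj := (continuous_japanese s).measurable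
  have hm : ∀ j : Fin 3, Measurable fun x => coordS j φ x := fun j => (coordS j φ).continuous.measurable
  unfold energy
  rw [← lintegral_finsetSum _ (fun j _ => by have := hm j; fun_prop),
    ← lintegral_add_left (by fun_prop)]
  refine lintegral_congr fun x => ?_
  have hp := japanese_pos s x
  rw [← ENNReal.ofReal_sum_of_nonneg (fun j _ => by positivity),
    ← ENNReal.ofReal_add (by positivity) (Finset.sum_nonneg fun j _ => by positivity)]
  congr 1
  simp_rw [coordS_apply, norm_mul, Complex.norm_real, Real.norm_eq_abs, mul_pow, sq_abs]
  rw [japanese_add, japanese_two, EuclideanSpace.real_norm_sq_eq, mul_add, mul_add, Finset.mul_sum,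
    Finset.mul_sum]
  congr 1
  · ring
  · exact Finset.sum_congr rfl fun j _ => by ring

/-- Plancherel: m(D) is multiplication by a bounded function on the Fourier side. -/
theorem energy_multS_zero {m : R3 → ℂ} (hm : IsSymbol 0 m) :
    ∃ C : NNReal, ∀ φ, energy (japanese 0) (multS m φ) ≤ C * energy (japanese 0) φ := by
  obtain ⟨hm1, c, hc⟩ := hm
  have e : ∀ φ : 𝓢(R3, ℂ), energy (japanese 0) φ = ENNReal.ofReal (‖φ.toLp 2‖ ^ 2) := by
    intro φ
    have := energy_weight 0 φ
    rwa [mul_zero, weightS_zero] at this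
  refine ⟨Real.toNNReal (c ^ 2), fun φ => ?_⟩
  have h1 : ‖(multS m φ).toLp 2‖ =
      ‖(SchwartzMap.smulLeftCLM ℂ m (FourierTransform.fourier φ)).toLp 2‖ := by
    rw [← SchwartzMap.norm_fourier_toL2_eq, multS_apply, FourierTransform.fourier_fourierInv_eq]
  rw [e, h1, ← e, e φ, ← SchwartzMap.norm_fourier_toL2_eq, ← e]
  change _ ≤ ENNReal.ofReal (c ^ 2) * _
  unfold energy
  rw [← lintegral_const_mul' _ _ ENNReal.ofReal_ne_top]
  refine lintegral_mono fun x => ?_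
  rw [← ENNReal.ofReal_mul (by positivity)]
  refine ENNReal.ofReal_le_ofReal ?_
  rw [SchwartzMap.smulLeftCLM_apply_apply hm1, norm_smul, mul_pow, ← mul_assoc]
  refine mul_le_mul_of_nonneg_right (mul_le_mul_of_nonneg_right ?_ (by positivity))
    (japanese_pos _ _).le
  exact pow_le_pow_left₀ (norm_nonneg _) (hc x) 2

/-- After `energy_succ`, each x_j m(D)φ is replaced by m(D)x_jφ and a commutator term, both
controlled at the previous weight. -/
theorem energy_multS_nat (n : ℕ) {m : R3 → ℂ} (hm : IsSymbol n m) :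
    ∃ C : NNReal, ∀ φ, energy (japanese (2 * n)) (multS m φ) ≤ C * energy (japanese (2 * n)) φ := by
  induction n generalizing m with
  | zero => simpa using energy_multS_zero hm
  | succ n ih =>
    obtain ⟨C, hC⟩ := ih hm.of_succ
    choose C' hC' using fun j => ih (hm.2 j)
    set c : ℝ := ‖(-(2 * Real.pi * Complex.I)⁻¹ : ℂ)‖ ^ 2 with hc
    -- The factors 2 come from `energy_add_le`, and c is the squared modulus of the coefficient of
    -- the commutator.
    refine ⟨C + ∑ j : Fin 3, (2 * C + 2 * (Real.toNNReal c * C' j)), fun φ => ?_⟩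
    have hs : (2 * ((n + 1 : ℕ) : ℝ)) = 2 * n + 2 := by push_cast; ring
    rw [hs]
    have hmono : energy (japanese (2 * n)) φ ≤ energy (japanese (2 * n + 2)) φ :=
      energy_mono (fun x => japanese_mono (by linarith) x) φ
    have hcoord : ∀ j, energy (japanese (2 * n)) (coordS j φ) ≤ energy (japanese (2 * n + 2)) φ := by
      intro j
      rw [energy_succ]
      exact (Finset.single_le_sum (f := fun j => energy (japanese (2 * n)) (coordS j φ))
        (fun _ _ => zero_le) (Finset.mem_univ j)).trans le_add_self
    set E := energy (japanese (2 * n + 2)) φ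
    rw [energy_succ]
    push_cast
    rw [add_mul, Finset.sum_mul]
    refine add_le_add ((hC φ).trans (mul_le_mul_right hmono _)) (Finset.sum_le_sum fun j _ => ?_)
    rw [coordS_multS hm]
    refine (energy_add_le (fun x => (japanese_pos _ _).le)
      (continuous_japanese _).measurable _ _).trans ?_
    rw [energy_smul, add_mul]
    refine add_le_add ?_ ?_
    · rw [mul_assoc]
      exact mul_le_mul_right ((hC _).trans (mul_le_mul_right (hcoord j) _)) _
    · rw [mul_assoc (2 : ℝ≥0∞) _ E, mul_assoc (Real.toNNReal c : ℝ≥0∞)]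
      exact mul_le_mul_right (mul_le_mul_right ((hC' j φ).trans (mul_le_mul_right hmono _))
        (Real.toNNReal c : ℝ≥0∞)) _

/-! ### Interpolation -/

theorem energy_const_mul {c : ℝ} (hc : 0 ≤ c) (w : R3 → ℝ) (φ : 𝓢(R3, ℂ)) :
    energy (fun x => c * w x) φ = ENNReal.ofReal c * energy w φ := by
  unfold energy
  rw [← lintegral_const_mul' _ _ ENNReal.ofReal_ne_top]
  refine lintegral_congr fun x => ?_
  rw [← ENNReal.ofReal_mul hc]
  congr 1; ring

/-- The weight interpolating between `⟨x⟩ ^ s` and `t⁻¹ ⟨x⟩ ^ (s + 2)`. -/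
def interpWeight (s t : ℝ) (x : R3) : ℝ := japanese s x * (japanese 2 x / (t + japanese 2 x))

/-- The cutoff `t / (t + ⟨x⟩²)`. -/
def interpCutoff (t : ℝ) (x : R3) : ℂ :=
  ((t / (t + 1) : ℝ) : ℂ) * (japanese (-2) ((Real.sqrt (t + 1))⁻¹ • x) : ℂ)

theorem interpCutoff_temperate (t : ℝ) : (interpCutoff t).HasTemperateGrowth := by
  have h : (fun ξ : R3 => ((Real.sqrt (t + 1))⁻¹ •
      ContinuousLinearMap.id ℝ R3) ξ).HasTemperateGrowth :=
    ContinuousLinearMap.hasTemperateGrowth _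
  exact (Function.HasTemperateGrowth.const _).mul ((hasTemperateGrowth_japanese (-2)).comp h)

/-- t + ⟨x⟩² = (t + 1)(1 + |x|²/(t + 1)), so the cutoff is a rescaled bracket. Its definition has
that form to make temperate growth immediate. -/
theorem interpCutoff_eq {t : ℝ} (ht : 0 < t) (x : R3) :
    interpCutoff t x = ((t / (t + japanese 2 x) : ℝ) : ℂ) := by
  rw [interpCutoff, ← Complex.ofReal_mul, japanese_neg, japanese_two, japanese_two, norm_smul,
    mul_pow, norm_inv, inv_pow, Real.norm_of_nonneg (Real.sqrt_nonneg _),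
    Real.sq_sqrt (by positivity)]
  congr 1
  field_simp
  ring

/-- The weight is ab/(a + b) with a = ⟨x⟩^s and b = t⁻¹⟨x⟩^{s+2}; its energy is therefore the
minimum of ∫ a|f₀|² + b|f₁|² over φ = f₀ + f₁. The minimizing splitting is explicit and consists of
Schwartz functions. The two hypotheses apply to T f₀ and T f₁, because the weight is at most a and
at most b. -/
theorem energy_interpWeight_le (T : 𝓢(R3, ℂ) →L[ℂ] 𝓢(R3, ℂ)) (s : ℝ) (C : NNReal)
    (h0 : ∀ φ, energy (japanese s) (T φ) ≤ C * energy (japanese s) φ)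
    (h1 : ∀ φ, energy (japanese (s + 2)) (T φ) ≤ C * energy (japanese (s + 2)) φ)
    {t : ℝ} (ht : 0 < t) (φ : 𝓢(R3, ℂ)) :
    energy (interpWeight s t) (T φ) ≤ 2 * C * energy (interpWeight s t) φ := by
  have hJ : ∀ x, 0 < japanese 2 x := japanese_pos 2
  have hs : ∀ x, 0 < japanese s x := japanese_pos s
  have hq := interpCutoff_temperate t
  set f₁ := SchwartzMap.smulLeftCLM ℂ (interpCutoff t) φ with hf1
  set f₀ := φ - f₁ with hf0
  have e1 : ∀ x, f₁ x = ((t / (t + japanese 2 x) : ℝ) : ℂ) * φ x := fun x => by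
    rw [hf1, SchwartzMap.smulLeftCLM_apply_apply hq, interpCutoff_eq ht, smul_eq_mul]
  have e0 : ∀ x, f₀ x = ((japanese 2 x / (t + japanese 2 x) : ℝ) : ℂ) * φ x := fun x => by
    rw [hf0, _root_.sub_apply, e1]
    have : t / (t + japanese 2 x) = 1 - japanese 2 x / (t + japanese 2 x) := by
      have := hJ x
      field_simp
      ring
    rw [this]
    push_cast
    ring
  have hw0 : ∀ x, interpWeight s t x ≤ japanese s x := fun x => by
    have h1 : japanese 2 x / (t + japanese 2 x) ≤ 1 := by
      rw [div_le_one (by have := hJ x; positivity)]; linarith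
    exact mul_le_of_le_one_right (hs x).le h1
  have hw1 : ∀ x, interpWeight s t x ≤ t⁻¹ * japanese (s + 2) x := fun x => by
    rw [japanese_add, interpWeight, mul_left_comm]
    refine mul_le_mul_of_nonneg_left ?_ (hs x).le
    rw [div_eq_inv_mul]
    refine mul_le_mul_of_nonneg_right ?_ (hJ x).le
    exact inv_anti₀ ht (by linarith [hJ x])
  have hsum : φ = f₀ + f₁ := by rw [hf0]; abel
  have hsplit : energy (interpWeight s t) φ =
      energy (japanese s) f₀ + energy (fun x => t⁻¹ * japanese (s + 2) x) f₁ := by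
    have m0 : Measurable fun x => f₀ x := f₀.continuous.measurable
    have mj := (continuous_japanese s).measurable
    unfold energy
    rw [← lintegral_add_left (by fun_prop)]
    refine lintegral_congr fun x => ?_
    have := hJ x
    have := hs x
    have := japanese_pos (s + 2) x
    rw [← ENNReal.ofReal_add (by positivity) (by positivity)]
    congr 1
    rw [e0, e1, norm_mul, norm_mul, Complex.norm_real, Complex.norm_real,
      Real.norm_of_nonneg (by positivity), Real.norm_of_nonneg (by positivity), interpWeight]
    simp only [japanese_add]
    field_simp
    ring
  have hnn : ∀ x, 0 ≤ interpWeight s t x := fun x => by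
    have := hJ x
    have := hs x
    unfold interpWeight
    positivity
  have hmeas : Measurable (interpWeight s t) := by
    have mj := (continuous_japanese s).measurable
    have m2 := (continuous_japanese 2).measurable
    unfold interpWeight
    fun_prop
  calc energy (interpWeight s t) (T φ)
      = energy (interpWeight s t) (T f₀ + T f₁) := by rw [← map_add, ← hsum]
    _ ≤ 2 * energy (interpWeight s t) (T f₀) + 2 * energy (interpWeight s t) (T f₁) :=
        energy_add_le hnn hmeas _ _
    _ ≤ 2 * (C * energy (japanese s) f₀) +
        2 * (C * energy (fun x => t⁻¹ * japanese (s + 2) x) f₁) := by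
      refine add_le_add (mul_le_mul_right ((energy_mono hw0 _).trans (h0 f₀)) _)
        (mul_le_mul_right ((energy_mono hw1 _).trans ?_) _)
      rw [energy_const_mul (by positivity), energy_const_mul (by positivity), mul_left_comm]
      exact mul_le_mul_right (h1 f₁) _
    _ = _ := by rw [hsplit]; ring

theorem integrableOn_rpow_div_add_one {θ : ℝ} (h0 : 0 < θ) (h1 : θ < 1) :
    IntegrableOn (fun t : ℝ => t ^ (θ - 1) / (t + 1)) (Set.Ioi 0) := by
  have hm : ∀ S : Set ℝ, AEStronglyMeasurable (fun t : ℝ => t ^ (θ - 1) / (t + 1))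
      (volume.restrict S) := fun S => Measurable.aestronglyMeasurable (by fun_prop)
  rw [← Set.Ioc_union_Ioi_eq_Ioi zero_le_one]
  refine IntegrableOn.union ?_ ?_
  · have h2 : IntegrableOn (fun t : ℝ => t ^ (θ - 1)) (Set.Ioc 0 1) :=
      (intervalIntegrable_iff_integrableOn_Ioc_of_le zero_le_one).1
        (intervalIntegral.intervalIntegrable_rpow' (by linarith))
    refine Integrable.mono' h2 (hm _) ?_
    filter_upwards [ae_restrict_mem measurableSet_Ioc] with t ht
    have := ht.1
    rw [Real.norm_of_nonneg (by positivity)]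
    exact div_le_self (by positivity) (by linarith)
  · have h2 : IntegrableOn (fun t : ℝ => t ^ (θ - 2)) (Set.Ioi 1) :=
      integrableOn_Ioi_rpow_of_lt (by linarith) one_pos
    refine Integrable.mono' h2 (hm _) ?_
    filter_upwards [ae_restrict_mem measurableSet_Ioi] with t ht
    have ht : 1 < t := ht
    have ht0 : 0 < t := by linarith
    rw [Real.norm_of_nonneg (by positivity), div_le_iff₀ (by positivity)]
    have h3 : t ^ (θ - 1) = t ^ (θ - 2) * t := by
      rw [← Real.rpow_add_one ht0.ne']; congr 1; ring
    rw [h3]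
    exact mul_le_mul_of_nonneg_left (by linarith) (by positivity)

/-- The constant in the representation of a power as a superposition of resolvents. -/
def interpConst (θ : ℝ) : ℝ≥0∞ := ∫⁻ t in Set.Ioi (0 : ℝ), ENNReal.ofReal (t ^ (θ - 1) / (t + 1))

theorem interpConst_ne_top {θ : ℝ} (h0 : 0 < θ) (h1 : θ < 1) : interpConst θ ≠ ⊤ :=
  ((lintegral_ofReal_le_lintegral_enorm _).trans_lt (integrableOn_rpow_div_add_one h0 h1).2).ne

theorem interpConst_ne_zero (θ : ℝ) : interpConst θ ≠ 0 := by
  intro h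
  rw [interpConst, lintegral_eq_zero_iff (by fun_prop)] at h
  have h2 : ∀ᵐ t ∂(volume.restrict (Set.Ioi (0 : ℝ))), False := by
    filter_upwards [h, ae_restrict_mem measurableSet_Ioi] with t ht ht'
    have ht' : 0 < t := ht'
    rw [Pi.zero_apply, ENNReal.ofReal_eq_zero] at ht
    have : 0 < t ^ (θ - 1) / (t + 1) := by positivity
    linarith
  have h3 : volume.restrict (Set.Ioi (0 : ℝ)) = 0 := ae_eq_bot.1 (eventually_false_iff_eq_bot.1 h2)
  rw [Measure.restrict_eq_zero] at h3
  simp at h3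

/-- The scaling t = aτ reduces the integral to the one that defines `interpConst`. -/
theorem lintegral_resolvent {θ a : ℝ} (h0 : 0 < θ) (h1 : θ < 1) (ha : 0 < a) :
    ∫⁻ t in Set.Ioi (0 : ℝ), ENNReal.ofReal (t ^ (θ - 1) * (a / (t + a))) =
      ENNReal.ofReal (a ^ θ) * interpConst θ := by
  have hint := integrableOn_rpow_div_add_one h0 h1
  have hcongr : ∀ t ∈ Set.Ioi (0 : ℝ), t ^ (θ - 1) * (a / (t + a)) =
      a ^ (θ - 1) * (fun t : ℝ => t ^ (θ - 1) / (t + 1)) (a⁻¹ * t) := by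
    intro t ht
    have ht : 0 < t := ht
    simp only
    rw [Real.mul_rpow (by positivity) ht.le, Real.inv_rpow ha.le]
    field_simp
  rw [setLIntegral_congr_fun measurableSet_Ioi fun t ht => by rw [hcongr t ht]]
  have hint2 : IntegrableOn (fun x => (fun t : ℝ => t ^ (θ - 1) / (t + 1)) (a⁻¹ * x)) (Set.Ioi 0) := by
    refine (integrableOn_Ioi_comp_mul_left_iff (fun t : ℝ => t ^ (θ - 1) / (t + 1)) 0
      (inv_pos.2 ha)).2 ?_
    simpa using hint
  have hnn : ∀ b : ℝ, 0 < b →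
      0 ≤ᵐ[volume.restrict (Set.Ioi (0:ℝ))] fun x => (b * x) ^ (θ - 1) / (b * x + 1) := by
    intro b hb
    filter_upwards [ae_restrict_mem measurableSet_Ioi] with t ht
    have ht : 0 < t := ht
    simp only [Pi.zero_apply]
    positivity
  rw [interpConst]
  have hc := ofReal_integral_eq_lintegral_ofReal hint (by simpa using hnn 1 one_pos)
  have hc2 := ofReal_integral_eq_lintegral_ofReal hint2 (hnn a⁻¹ (by positivity))
  rw [← hc, ← ENNReal.ofReal_mul (by positivity)]
  simp_rw [ENNReal.ofReal_mul (show 0 ≤ a ^ (θ - 1) by positivity)]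
  rw [lintegral_const_mul' _ _ ENNReal.ofReal_ne_top, ← hc2, ← ENNReal.ofReal_mul (by positivity),
    integral_comp_mul_left_Ioi (fun t : ℝ => t ^ (θ - 1) / (t + 1)) 0 (inv_pos.2 ha)]
  congr 1
  rw [mul_zero, inv_inv, smul_eq_mul, ← mul_assoc, ← Real.rpow_add_one ha.ne', sub_add_cancel]

theorem lintegral_interpWeight {θ : ℝ} (h0 : 0 < θ) (h1 : θ < 1) (s : ℝ) (φ : 𝓢(R3, ℂ)) :
    ∫⁻ t in Set.Ioi (0 : ℝ), ENNReal.ofReal (t ^ (θ - 1)) * energy (interpWeight s t) φ =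
      interpConst θ * energy (japanese (s + 2 * θ)) φ := by
  have mφ : Measurable fun x => φ x := φ.continuous.measurable
  have mj := (continuous_japanese s).measurable
  have m2 := (continuous_japanese 2).measurable
  unfold energy
  simp_rw [← lintegral_const_mul' _ _ ENNReal.ofReal_ne_top]
  rw [lintegral_lintegral_swap]
  · rw [← lintegral_const_mul' _ _ (interpConst_ne_top h0 h1)]
    refine lintegral_congr fun x => ?_
    have hJ := japanese_pos 2 x
    have hs := japanese_pos s x
    have h2 : ∀ t ∈ Set.Ioi (0 : ℝ), ENNReal.ofReal (t ^ (θ - 1)) *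
        ENNReal.ofReal (‖φ x‖ ^ 2 * interpWeight s t x) =
        ENNReal.ofReal (‖φ x‖ ^ 2 * japanese s x) *
          ENNReal.ofReal (t ^ (θ - 1) * (japanese 2 x / (t + japanese 2 x))) := by
      intro t ht
      have ht : 0 < t := ht
      rw [← ENNReal.ofReal_mul (by positivity), ← ENNReal.ofReal_mul (by positivity), interpWeight]
      congr 1; ring
    rw [setLIntegral_congr_fun measurableSet_Ioi h2, lintegral_const_mul' _ _ ENNReal.ofReal_ne_top,
      lintegral_resolvent h0 h1 hJ, ← mul_assoc, mul_comm, ← ENNReal.ofReal_mul (by positivity)]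
    congr 2
    rw [japanese_add, mul_assoc, japanese_eq_rpow 2, ← Real.rpow_mul (japanese_pos _ _).le,
      ← japanese_eq_rpow]
  · unfold interpWeight
    have : Measurable fun z : ℝ × R3 => φ z.2 := mφ.comp measurable_snd
    have : Measurable fun z : ℝ × R3 => japanese s z.2 := mj.comp measurable_snd
    have : Measurable fun z : ℝ × R3 => japanese 2 z.2 := m2.comp measurable_snd
    refine Measurable.aemeasurable ?_
    simp only [Function.uncurry_def]
    fun_prop

/-- The bound of `energy_interpWeight_le` is uniform in t. Integrated against t^{θ-1} dt it becomes
the claim times `interpConst θ`, which is finite and nonzero. -/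
theorem energy_interpolation (T : 𝓢(R3, ℂ) →L[ℂ] 𝓢(R3, ℂ)) (s : ℝ) (C : NNReal)
    (h0 : ∀ φ, energy (japanese s) (T φ) ≤ C * energy (japanese s) φ)
    (h1 : ∀ φ, energy (japanese (s + 2)) (T φ) ≤ C * energy (japanese (s + 2)) φ)
    {θ : ℝ} (hθ0 : 0 < θ) (hθ1 : θ < 1) (φ : 𝓢(R3, ℂ)) :
    energy (japanese (s + 2 * θ)) (T φ) ≤ 2 * C * energy (japanese (s + 2 * θ)) φ := by
  rw [← ENNReal.mul_le_mul_iff_right (interpConst_ne_zero θ) (interpConst_ne_top hθ0 hθ1),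
    mul_left_comm, ← lintegral_interpWeight hθ0 hθ1, ← lintegral_interpWeight hθ0 hθ1,
    ← lintegral_const_mul' _ _ (by finiteness)]
  refine setLIntegral_mono' measurableSet_Ioi fun t ht => ?_
  rw [mul_left_comm]
  exact mul_le_mul_right (energy_interpWeight_le T s C h0 h1 ht φ) _

theorem energy_multS {m : R3 → ℂ} (hm : ∀ n, IsSymbol n m) {s : ℝ} (hs : 0 ≤ s) :
    ∃ C : NNReal, ∀ φ, energy (japanese (2 * s)) (multS m φ) ≤ C * energy (japanese (2 * s)) φ := by
  obtain ⟨C, hC⟩ := energy_multS_nat ⌊s⌋₊ (hm _)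
  obtain ⟨C', hC'⟩ := energy_multS_nat (⌊s⌋₊ + 1) (hm _)
  -- Interpolation with θ = s - ⌊s⌋ requires θ > 0, so an integer s is treated directly.
  rcases (Nat.floor_le hs).eq_or_lt with h | h
  · rw [h] at hC
    exact ⟨C, hC⟩
  · have h1 := Nat.lt_floor_add_one s
    have e : (2 * ((⌊s⌋₊ + 1 : ℕ) : ℝ)) = 2 * (⌊s⌋₊ : ℝ) + 2 := by push_cast; ring
    rw [e] at hC'
    refine ⟨2 * max C C', fun φ => ?_⟩
    have := energy_interpolation (multS m) (2 * (⌊s⌋₊ : ℝ)) (max C C')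
      (fun φ => (hC φ).trans (mul_le_mul_left (by exact_mod_cast le_max_left _ _) _))
      (fun φ => (hC' φ).trans (mul_le_mul_left (by exact_mod_cast le_max_right _ _) _))
      (θ := s - ⌊s⌋₊) (by linarith) (by linarith) φ
    rw [show 2 * (⌊s⌋₊ : ℝ) + 2 * (s - ⌊s⌋₊) = 2 * s by ring] at this
    exact_mod_cast this

/-! ### The weighted multipliers as operators on square integrable functions -/

theorem denseRange_toL2 : DenseRange (SchwartzMap.toLpCLM ℂ ℂ 2 (volume : Measure R3)) :=
  SchwartzMap.denseRange_toLpCLM (by simp)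

theorem inner_weightS (s : ℝ) (φ ψ : 𝓢(R3, ℂ)) :
    inner ℂ ((weightS s φ).toLp 2 : L2) (ψ.toLp 2) =
      inner ℂ (φ.toLp 2 : L2) ((weightS s ψ).toLp 2) := by
  rw [SchwartzMap.inner_toL2_toL2_eq _ _ volume, SchwartzMap.inner_toL2_toL2_eq _ _ volume]
  refine integral_congr_ae (Eventually.of_forall fun x => ?_)
  simp [weightS_apply]
  ring

theorem inner_multS {m : R3 → ℂ} (hm : m.HasTemperateGrowth)
    (hr : ∀ ξ, starRingEnd ℂ (m ξ) = m ξ) (φ ψ : 𝓢(R3, ℂ)) :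
    inner ℂ ((multS m φ).toLp 2 : L2) (ψ.toLp 2) =
      inner ℂ (φ.toLp 2 : L2) ((multS m ψ).toLp 2) := by
  rw [← SchwartzMap.inner_fourier_toL2_eq, ← SchwartzMap.inner_fourier_toL2_eq φ, multS_apply,
    multS_apply, FourierTransform.fourier_fourierInv_eq, FourierTransform.fourier_fourierInv_eq,
    SchwartzMap.inner_toL2_toL2_eq _ _ volume, SchwartzMap.inner_toL2_toL2_eq _ _ volume]
  refine integral_congr_ae (Eventually.of_forall fun x => ?_)
  simp only [SchwartzMap.smulLeftCLM_apply_apply hm, smul_eq_mul, RCLike.inner_apply, map_mul, hr]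
  ring

theorem norm_weighted_multS_nonneg {m : R3 → ℂ} (hm : IsRealSymbol m) {s : ℝ} (hs : 0 ≤ s) :
    ∃ C : ℝ, 0 ≤ C ∧ ∀ φ, ‖(weightS s (multS m (weightS (-s) φ))).toLp 2‖ ≤ C * ‖φ.toLp 2‖ := by
  obtain ⟨C, hC⟩ := energy_multS hm.symbol hs
  refine ⟨Real.sqrt C, Real.sqrt_nonneg _, fun φ => ?_⟩
  have h1 := hC (weightS (-s) φ)
  rw [energy_weight, energy_weight, weightS_weightS, add_neg_cancel, weightS_zero] at h1
  have h2 : (C : ℝ≥0∞) = ENNReal.ofReal (C : ℝ) := by simp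
  rw [h2, ← ENNReal.ofReal_mul (by positivity), ENNReal.ofReal_le_ofReal_iff (by positivity)] at h1
  refine le_of_sq_le_sq ?_ (by positivity)
  rw [mul_pow, Real.sq_sqrt (by positivity)]
  exact h1

/-- For s < 0 by duality: a real symbol makes m(D) symmetric, so the operator for s is the formal
adjoint of the operator for -s. -/
theorem norm_weighted_multS {m : R3 → ℂ} (hm : IsRealSymbol m) (s : ℝ) :
    ∃ C : ℝ, 0 ≤ C ∧ ∀ φ, ‖(weightS s (multS m (weightS (-s) φ))).toLp 2‖ ≤ C * ‖φ.toLp 2‖ := by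
  rcases le_total 0 s with hs | hs
  · exact norm_weighted_multS_nonneg hm hs
  · obtain ⟨C, hC0, hC⟩ := norm_weighted_multS_nonneg hm (neg_nonneg.2 hs)
    refine ⟨C, hC0, fun φ => ?_⟩
    set ψ := weightS s (multS m (weightS (-s) φ)) with hψ
    have h1 : inner ℂ (ψ.toLp 2 : L2) (ψ.toLp 2) =
        inner ℂ (φ.toLp 2 : L2) ((weightS (-s) (multS m (weightS s ψ))).toLp 2) := by
      conv_lhs => rw [hψ]
      rw [inner_weightS, inner_multS (hm.symbol 0).temperate hm.conj_eq, inner_weightS]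
    have h2 : ‖ψ.toLp 2‖ ^ 2 ≤ ‖φ.toLp 2‖ * (C * ‖ψ.toLp 2‖) := by
      have h3 := norm_inner_le_norm (𝕜 := ℂ) (φ.toLp 2 : L2)
        ((weightS (-s) (multS m (weightS s ψ))).toLp 2)
      rw [← h1, inner_self_eq_norm_sq_to_K] at h3
      have h4 := hC ψ
      rw [neg_neg] at h4
      have h5 : ‖((‖ψ.toLp 2 (volume : Measure R3)‖ : ℂ)) ^ 2‖ = ‖ψ.toLp 2‖ ^ 2 := by simp
      rw [← h5]
      exact h3.trans (mul_le_mul_of_nonneg_left h4 (norm_nonneg _))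
    rcases (norm_nonneg (ψ.toLp 2 (volume : Measure R3))).eq_or_lt with h | h
    · rw [← h]; positivity
    · nlinarith

/-- The operator `⟨x⟩ ^ s m(D) ⟨x⟩ ^ (-s)` on square integrable functions. -/
def weightedMult (m : R3 → ℂ) (s : ℝ) : L2 →L[ℂ] L2 :=
  LinearMap.extendOfNorm
    ((SchwartzMap.toLpCLM ℂ ℂ 2 (volume : Measure R3) ∘L weightS s ∘L multS m ∘L
      weightS (-s)).toLinearMap) (SchwartzMap.toLpCLM ℂ ℂ 2 (volume : Measure R3)).toLinearMap

theorem weightedMult_toLp {m : R3 → ℂ} (hm : IsRealSymbol m) (s : ℝ) (φ : 𝓢(R3, ℂ)) :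
    weightedMult m s (φ.toLp 2) = (weightS s (multS m (weightS (-s) φ))).toLp 2 := by
  obtain ⟨C, -, hC⟩ := norm_weighted_multS hm s
  exact LinearMap.extendOfNorm_eq denseRange_toL2 ⟨C, hC⟩ φ

theorem ext_toLp {E : Type*} [TopologicalSpace E] [T2Space E] {f g : L2 → E}
    (hf : Continuous f) (hg : Continuous g)
    (h : ∀ φ : 𝓢(R3, ℂ), f (φ.toLp 2) = g (φ.toLp 2)) (u : L2) : f u = g u :=
  congrFun (denseRange_toL2.equalizer hf hg (funext h)) u

open ContinuousLinearMap in
theorem adjoint_weightedMult {m : R3 → ℂ} (hm : IsRealSymbol m) (s : ℝ) :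
    adjoint (weightedMult m s) = weightedMult m (-s) := by
  symm
  rw [eq_adjoint_iff]
  intro f g
  refine ext_toLp (f := fun f => inner ℂ (weightedMult m (-s) f) g)
    (g := fun f => inner ℂ f (weightedMult m s g)) (by fun_prop) (by fun_prop) (fun φ => ?_) f
  refine ext_toLp (f := fun g => inner ℂ (weightedMult m (-s) (φ.toLp 2)) g)
    (g := fun g => inner ℂ (φ.toLp 2 : L2) (weightedMult m s g)) (by fun_prop) (by fun_prop)
    (fun ψ => ?_) g
  simp only
  rw [weightedMult_toLp hm, weightedMult_toLp hm, inner_weightS,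
    inner_multS (hm.symbol 0).temperate hm.conj_eq, inner_weightS, neg_neg]

/-! ### The Fourier representation of the Newton potential -/

/-- Fubini for K = ∫ k_t dt. Since k_t ≥ 0, integrability in both variables reduces to that of K F.
-/
theorem integral_superposition {X : Type*} [MeasurableSpace X] (μ : Measure X) [SFinite μ]
    {k : ℝ → X → ℝ} (hk : Measurable (Function.uncurry k)) {K : X → ℝ}
    (h0 : ∀ t ∈ Set.Ioi (0 : ℝ), ∀ z, 0 ≤ k t z)
    (hK : ∀ᵐ z ∂μ, IntegrableOn (fun t => k t z) (Set.Ioi 0) ∧ ∫ t in Set.Ioi (0 : ℝ), k t z = K z)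
    {F : X → ℂ} (hF : AEStronglyMeasurable F μ) (hKF : Integrable (fun z => (K z : ℂ) * F z) μ) :
    ∫ z, (K z : ℂ) * F z ∂μ = ∫ t in Set.Ioi (0 : ℝ), ∫ z, (k t z : ℂ) * F z ∂μ := by
  have hm : AEStronglyMeasurable (fun p : X × ℝ => (k p.2 p.1 : ℂ) * F p.1)
      (μ.prod (volume.restrict (Set.Ioi 0))) := by
    refine AEStronglyMeasurable.mul ?_ hF.comp_fst
    exact (Complex.measurable_ofReal.comp (hk.comp measurable_swap)).aestronglyMeasurable
  have hi : Integrable (fun p : X × ℝ => (k p.2 p.1 : ℂ) * F p.1)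
      (μ.prod (volume.restrict (Set.Ioi 0))) := by
    rw [integrable_prod_iff hm]
    constructor
    · filter_upwards [hK] with z hz
      exact hz.1.ofReal.mul_const _
    · refine hKF.norm.congr ?_
      filter_upwards [hK] with z hz
      have h1 : ∫ t in Set.Ioi (0 : ℝ), ‖(k t z : ℂ) * F z‖ = ∫ t in Set.Ioi (0 : ℝ), k t z * ‖F z‖ := by
        refine setIntegral_congr_fun measurableSet_Ioi fun t ht => ?_
        simp only [norm_mul, Complex.norm_real, Real.norm_of_nonneg (h0 t ht z)]
      rw [h1, integral_mul_const, hz.2, norm_mul, Complex.norm_real, Real.norm_of_nonneg]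
      rw [← hz.2]
      exact setIntegral_nonneg measurableSet_Ioi fun t ht => h0 t ht z
  rw [← integral_integral_swap (f := fun z t => (k t z : ℂ) * F z) hi]
  refine integral_congr_ae ?_
  filter_upwards [hK] with z hz
  rw [integral_mul_const, integral_complex_ofReal, hz.2]

/-- e^{-πt²|x|²} has the Fourier transform t^{-3}e^{-π|ξ|²/t²}. This lemma and the next write
1/(4π|x|) and 1/(4π²|ξ|²) as superpositions of these two Gaussians with the same density in t. -/
theorem integral_gaussian_scale {r : ℝ} (hr : 0 < r) :
    IntegrableOn (fun t => (2 * Real.pi)⁻¹ * Real.exp (-(Real.pi * r ^ 2) * t ^ 2)) (Set.Ioi 0) ∧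
      ∫ t in Set.Ioi (0 : ℝ), (2 * Real.pi)⁻¹ * Real.exp (-(Real.pi * r ^ 2) * t ^ 2) =
        (4 * Real.pi * r)⁻¹ := by
  have hp := Real.pi_pos
  refine ⟨((integrable_exp_neg_mul_sq (by positivity)).const_mul _).integrableOn, ?_⟩
  rw [integral_const_mul, integral_gaussian_Ioi]
  have h1 : Real.pi / (Real.pi * r ^ 2) = (r⁻¹) ^ 2 := by field_simp
  rw [h1, Real.sqrt_sq (by positivity)]
  field_simp
  norm_num

theorem integral_gaussian_inv_scale {r : ℝ} (hr : 0 < r) :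
    IntegrableOn (fun t : ℝ => (2 * Real.pi)⁻¹ *
        (t ^ (-3 : ℝ) * Real.exp (-(Real.pi * r ^ 2) * t ^ (-2 : ℝ)))) (Set.Ioi 0) ∧
      ∫ t in Set.Ioi (0 : ℝ), (2 * Real.pi)⁻¹ *
        (t ^ (-3 : ℝ) * Real.exp (-(Real.pi * r ^ 2) * t ^ (-2 : ℝ))) =
        (4 * Real.pi ^ 2 * r ^ 2)⁻¹ := by
  have hp := Real.pi_pos
  have hc : -(Real.pi * r ^ 2) < 0 := by
    have : 0 < Real.pi * r ^ 2 := by positivity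
    linarith
  -- The factor 2t^{-3} is the Jacobian of the substitution y = t^{-2}.
  have e : ∀ t : ℝ, (2 * Real.pi)⁻¹ * (t ^ (-3 : ℝ) * Real.exp (-(Real.pi * r ^ 2) * t ^ (-2 : ℝ))) =
      (4 * Real.pi)⁻¹ * ((|(-2 : ℝ)| * t ^ ((-2 : ℝ) - 1)) •
        Real.exp (-(Real.pi * r ^ 2) * t ^ (-2 : ℝ))) := by
    intro t
    rw [smul_eq_mul, show (-2 : ℝ) - 1 = -3 by norm_num, show |(-2 : ℝ)| = 2 by norm_num]
    field_simp
    ring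
  simp only [e]
  constructor
  · exact ((integrableOn_Ioi_comp_rpow_iff (fun y => Real.exp (-(Real.pi * r ^ 2) * y))
      (by norm_num : (-2 : ℝ) ≠ 0)).2 (integrableOn_exp_mul_Ioi hc 0)).const_mul _
  · rw [integral_const_mul, integral_comp_rpow_Ioi (fun y => Real.exp (-(Real.pi * r ^ 2) * y))
      (by norm_num : (-2 : ℝ) ≠ 0), integral_exp_mul_Ioi hc 0]
    simp
    field_simp

/-- Inserting ⟨x⟩^{±2} and ⟨y⟩^{±2} exhibits the integrand as a product of two square integrable
functions of (x, y). -/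
theorem integrable_newton_prod (φ ψ : 𝓢(R3, ℂ)) :
    Integrable (fun z : R3 × R3 => (((4 * Real.pi * ‖z.1 - z.2‖)⁻¹ : ℝ) : ℂ) * (φ z.2 * ψ z.1))
      (volume.prod volume) := by
  have h1 := memLp_weightedKernel (a := 2) (b := 2) (by norm_num) (by norm_num) (by norm_num)
  have h2 := memLp_tensor volume (((weightS 2 φ).memLp 2 volume).star) ((weightS 2 ψ).memLp 2 volume)
  refine (h1.integrable_mul h2).congr (Eventually.of_forall fun z => ?_)
  have e1 := (japanese_pos 2 z.1).ne'
  have e2 := (japanese_pos 2 z.2).ne'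
  simp only [weightedKernel, Pi.mul_apply, Pi.star_apply, weightS_apply, RCLike.star_def,
    Complex.conj_conj, japanese_neg]
  push_cast
  have e1' : (japanese 2 z.1 : ℂ) ≠ 0 := by exact_mod_cast e1
  have e2' : (japanese 2 z.2 : ℂ) ≠ 0 := by exact_mod_cast e2
  field_simp

theorem integral_newton_mul (φ ψ : 𝓢(R3, ℂ)) :
    ∫ x, newton φ x * ψ x = ∫ z : R3 × R3,
      (((4 * Real.pi * ‖z.1 - z.2‖)⁻¹ : ℝ) : ℂ) * (φ z.2 * ψ z.1) ∂(volume.prod volume) := by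
  rw [integral_prod _ (integrable_newton_prod φ ψ)]
  refine integral_congr_ae (Eventually.of_forall fun x => ?_)
  simp only [newton]
  rw [← integral_mul_const]
  simp only [mul_assoc]

/-- |x|^{-2} is integrable near the origin of R³, where F is bounded, and bounded elsewhere, where F
is integrable. -/
theorem integrable_norm_sq_inv_mul {F : R3 → ℂ} (hF : Integrable F) (hb : ∃ c : ℝ, ∀ x, ‖F x‖ ≤ c) :
    Integrable (fun x => (((4 * Real.pi ^ 2 * ‖x‖ ^ 2)⁻¹ : ℝ) : ℂ) * F x) := by
  obtain ⟨c, hc⟩ := hb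
  have h1 : IntegrableOn (fun z : R3 => (‖z‖ ^ 2)⁻¹) (Metric.closedBall 0 1) :=
    locallyIntegrable_norm_sq_inv.integrableOn_isCompact (isCompact_closedBall 0 1)
  have h2 : Integrable (fun x : R3 => c * (Metric.closedBall (0 : R3) 1).indicator
      (fun z => (‖z‖ ^ 2)⁻¹) x + ‖F x‖) :=
    ((h1.integrable_indicator Metric.isClosed_closedBall.measurableSet).const_mul c).add hF.norm
  refine h2.mono' (AEStronglyMeasurable.mul
    (Measurable.aestronglyMeasurable (by fun_prop)) hF.1) (Eventually.of_forall fun x => ?_)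
  have hp : 1 ≤ 4 * Real.pi ^ 2 := by nlinarith [Real.pi_gt_three]
  rw [norm_mul, Complex.norm_real, Real.norm_of_nonneg (by positivity), mul_inv]
  have h3 : (4 * Real.pi ^ 2)⁻¹ ≤ 1 := inv_le_one_of_one_le₀ hp
  have h4 : (4 * Real.pi ^ 2)⁻¹ * (‖x‖ ^ 2)⁻¹ ≤ (‖x‖ ^ 2)⁻¹ :=
    mul_le_of_le_one_left (by positivity) h3
  by_cases hx : x ∈ Metric.closedBall (0 : R3) 1
  · rw [Set.indicator_of_mem hx]
    have : (4 * Real.pi ^ 2)⁻¹ * (‖x‖ ^ 2)⁻¹ * ‖F x‖ ≤ (‖x‖ ^ 2)⁻¹ * c :=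
      mul_le_mul h4 (hc x) (norm_nonneg _) (by positivity)
    linarith [norm_nonneg (F x)]
  · rw [Set.indicator_of_notMem hx]
    have hx1 : 1 ≤ ‖x‖ ^ 2 := by
      simp only [Metric.mem_closedBall, dist_zero_right, not_le] at hx
      nlinarith
    have : (‖x‖ ^ 2)⁻¹ ≤ 1 := inv_le_one_of_one_le₀ hx1
    have := mul_le_mul_of_nonneg_right (h4.trans this) (norm_nonneg (F x))
    linarith

/-- The Gaussian centred at x is, up to a constant, the transform of a modulated Gaussian. The
multiplication formula moves the transform to φ, and Fubini gathers the plane waves with ψ into its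
inverse transform. -/
theorem integral_gaussian_pairing {b : ℝ} (hb : 0 < b) (φ ψ : 𝓢(R3, ℂ)) :
    ∫ z : R3 × R3, ((Real.exp (-(Real.pi ^ 2 / b) * ‖z.1 - z.2‖ ^ 2) : ℝ) : ℂ) * (φ z.2 * ψ z.1)
        ∂(volume.prod volume) =
      ∫ ξ : R3, (((Real.pi / b) ^ (-(3 / 2) : ℝ) * Real.exp (-b * ‖ξ‖ ^ 2) : ℝ) : ℂ) *
        (FourierTransform.fourier φ ξ * FourierTransform.fourierInv ψ ξ) := by
  have hp := Real.pi_pos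
  have hbc : 0 < (b : ℂ).re := by simpa using hb
  have hc0 : 0 < Real.pi / b := by positivity
  have hint : Integrable (fun z : R3 × R3 =>
      ((Real.exp (-(Real.pi ^ 2 / b) * ‖z.1 - z.2‖ ^ 2) : ℝ) : ℂ) * (φ z.2 * ψ z.1))
      (volume.prod volume) := by
    have h1 : Integrable (fun z : R3 × R3 => φ z.2 * ψ z.1) (volume.prod volume) := by
      refine ((ψ.integrable (μ := volume)).mul_prod (φ.integrable (μ := volume))).congr
        (Eventually.of_forall fun z => ?_)
      simp [mul_comm]
    refine h1.bdd_mul (c := 1) (Continuous.aestronglyMeasurable (by fun_prop))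
      (Eventually.of_forall fun z => ?_)
    rw [Complex.norm_real, Real.norm_of_nonneg (Real.exp_pos _).le, Real.exp_le_one_iff]
    have : 0 ≤ (Real.pi ^ 2 / b) * ‖z.1 - z.2‖ ^ 2 := by positivity
    linarith
  rw [integral_prod _ hint]
  have key : ∀ x : R3, ∫ y : R3, ((Real.exp (-(Real.pi ^ 2 / b) * ‖x - y‖ ^ 2) : ℝ) : ℂ) * φ y =
      (((Real.pi / b) ^ (-(3 / 2) : ℝ) : ℝ) : ℂ) *
        ∫ ξ : R3, Complex.exp (-b * ‖ξ‖ ^ 2 + 2 * Real.pi * Complex.I * (inner ℝ x ξ : ℝ)) *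
          FourierTransform.fourier φ ξ := by
    intro x
    have h := VectorFourier.integral_fourierIntegral_smul_eq_flip (μ := (volume : Measure R3))
      (ν := (volume : Measure R3)) (L := innerₗ R3) (e := Real.fourierChar)
      (f := fun v => Complex.exp (-b * ‖v‖ ^ 2 + 2 * Real.pi * Complex.I * (inner ℝ x v : ℝ)))
      (g := φ) Real.continuous_fourierChar continuous_inner ?_ φ.integrable
    · have e1 : ∀ y : R3, VectorFourier.fourierIntegral Real.fourierChar volume (innerₗ R3)
          (fun v => Complex.exp (-b * ‖v‖ ^ 2 + 2 * Real.pi * Complex.I * (inner ℝ x v : ℝ))) y =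
          (((Real.pi / b) ^ (3 / 2 : ℝ) : ℝ) : ℂ) *
            ((Real.exp (-(Real.pi ^ 2 / b) * ‖x - y‖ ^ 2) : ℝ) : ℂ) := by
        intro y
        refine (fourier_gaussian_innerProductSpace' hbc x y).trans ?_
        rw [Complex.ofReal_cpow hc0.le]
        push_cast
        congr 2
        · simp
        · ring
      simp only [e1, smul_eq_mul] at h
      have h' : (((Real.pi / b) ^ (3 / 2 : ℝ) : ℝ) : ℂ) *
          ∫ y : R3, ((Real.exp (-(Real.pi ^ 2 / b) * ‖x - y‖ ^ 2) : ℝ) : ℂ) * φ y =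
          ∫ ξ : R3, Complex.exp (-b * ‖ξ‖ ^ 2 + 2 * Real.pi * Complex.I * (inner ℝ x ξ : ℝ)) *
            FourierTransform.fourier φ ξ := by
        rw [← integral_const_mul]
        refine Eq.trans (integral_congr_ae (Eventually.of_forall fun y => ?_)) (h.trans ?_)
        · exact (mul_assoc _ _ _).symm
        · rw [flip_innerₗ, SchwartzMap.fourier_coe]
          rfl
      have e2 : (((Real.pi / b) ^ (3 / 2 : ℝ) : ℝ) : ℂ) ≠ 0 := by
        exact_mod_cast (Real.rpow_pos_of_pos hc0 _).ne'
      rw [Real.rpow_neg hc0.le, Complex.ofReal_inv, eq_inv_mul_iff_mul_eq₀ e2, h']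
    · have h3 := GaussianFourier.integrable_cexp_neg_mul_sq_norm_add hbc
        (2 * Real.pi * Complex.I) x
      exact h3
  have e3 : ∀ ξ : R3, FourierTransform.fourierInv ψ ξ =
      ∫ x : R3, Complex.exp (2 * Real.pi * Complex.I * (inner ℝ x ξ : ℝ)) * ψ x := by
    intro ξ
    rw [SchwartzMap.fourierInv_coe, Real.fourierInv_eq']
    refine integral_congr_ae (Eventually.of_forall fun x => ?_)
    simp only [smul_eq_mul]
    congr 2
    push_cast
    ring
  have hint2 : Integrable (Function.uncurry fun (x ξ : R3) =>
      Complex.exp (-b * ‖ξ‖ ^ 2 + 2 * Real.pi * Complex.I * (inner ℝ x ξ : ℝ)) *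
        (ψ x * FourierTransform.fourier φ ξ)) (volume.prod volume) := by
    refine ((ψ.integrable (μ := volume)).mul_prod
      ((FourierTransform.fourier φ).integrable (μ := volume))).bdd_mul (c := 1)
      (Continuous.aestronglyMeasurable (by fun_prop)) (Eventually.of_forall fun z => ?_)
    rw [Complex.norm_exp, Real.exp_le_one_iff]
    have h4 : (-b * ‖z.2‖ ^ 2 + 2 * Real.pi * Complex.I * (inner ℝ z.1 z.2 : ℝ) : ℂ) =
        ((-b * ‖z.2‖ ^ 2 : ℝ) : ℂ) + ((2 * Real.pi * inner ℝ z.1 z.2 : ℝ) : ℂ) * Complex.I := by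
      push_cast; ring
    rw [h4, Complex.add_re, Complex.ofReal_re, Complex.re_ofReal_mul, Complex.I_re]
    nlinarith [mul_nonneg hb.le (sq_nonneg ‖z.2‖)]
  calc _ = ∫ x : R3, (((Real.pi / b) ^ (-(3 / 2) : ℝ) : ℝ) : ℂ) * ∫ ξ : R3,
        Complex.exp (-b * ‖ξ‖ ^ 2 + 2 * Real.pi * Complex.I * (inner ℝ x ξ : ℝ)) *
        (ψ x * FourierTransform.fourier φ ξ) := by
        refine integral_congr_ae (Eventually.of_forall fun x => ?_)
        simp only [← mul_assoc]
        rw [integral_mul_const, key x, mul_assoc, ← integral_mul_const]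
        congr 1
        refine integral_congr_ae (Eventually.of_forall fun ξ => ?_)
        simp only
        ring
    _ = (((Real.pi / b) ^ (-(3 / 2) : ℝ) : ℝ) : ℂ) * ∫ ξ : R3, ∫ x : R3,
        Complex.exp (-b * ‖ξ‖ ^ 2 + 2 * Real.pi * Complex.I * (inner ℝ x ξ : ℝ)) *
        (ψ x * FourierTransform.fourier φ ξ) := by
        rw [integral_const_mul, integral_integral_swap hint2]
    _ = _ := by
        rw [← integral_const_mul]
        refine integral_congr_ae (Eventually.of_forall fun ξ => ?_)
        simp only [e3 ξ]
        rw [← integral_const_mul, ← integral_const_mul, ← integral_const_mul]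
        refine integral_congr_ae (Eventually.of_forall fun x => ?_)
        simp only [Complex.exp_add]
        push_cast
        ring

/-- The Fourier representation of the Newton potential. -/
theorem integral_newton_mul_eq_fourier (φ ψ : 𝓢(R3, ℂ)) :
    ∫ x, newton φ x * ψ x = ∫ ξ : R3, (((4 * Real.pi ^ 2 * ‖ξ‖ ^ 2)⁻¹ : ℝ) : ℂ) *
      (FourierTransform.fourier φ ξ * FourierTransform.fourierInv ψ ξ) := by
  have hp := Real.pi_pos
  -- The Gaussian representations fail only at r = 0: on the diagonal and at ξ = 0, both null sets.
  have hdiag : ∀ᵐ z : R3 × R3 ∂(volume.prod volume), z.1 - z.2 ≠ 0 := by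
    have hm : MeasurableSet {z : R3 × R3 | z.1 - z.2 ≠ 0} :=
      (measurableSet_singleton (0 : R3)).compl.preimage (by fun_prop)
    rw [Measure.ae_prod_iff_ae_ae hm]
    refine Eventually.of_forall fun x => ?_
    filter_upwards [Measure.ae_ne volume x] with y hy
    exact sub_ne_zero.2 (Ne.symm hy)
  have hzero : ∀ᵐ ξ : R3, ξ ≠ 0 := Measure.ae_ne volume 0
  rw [integral_newton_mul, integral_superposition (volume.prod volume)
    (k := fun t z => (2 * Real.pi)⁻¹ * Real.exp (-(Real.pi * ‖z.1 - z.2‖ ^ 2) * t ^ 2))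
    (by unfold Function.uncurry; fun_prop) (fun t _ z => by positivity) ?_ ?_
    (integrable_newton_prod φ ψ),
    integral_superposition volume (k := fun t ξ => (2 * Real.pi)⁻¹ *
        (t ^ (-3 : ℝ) * Real.exp (-(Real.pi * ‖ξ‖ ^ 2) * t ^ (-2 : ℝ))))
    (by unfold Function.uncurry; fun_prop)
    (fun t ht z => by have : (0 : ℝ) < t := ht; positivity) ?_ ?_ ?_]
  · refine setIntegral_congr_fun measurableSet_Ioi fun t ht => ?_
    have ht : (0 : ℝ) < t := ht
    have h := integral_gaussian_pairing (b := Real.pi / t ^ 2) (by positivity) φ ψ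
    simp only [Complex.ofReal_mul, mul_assoc] at h ⊢
    rw [integral_const_mul, integral_const_mul]
    congr 1
    have e1 : Real.pi ^ 2 / (Real.pi / t ^ 2) = Real.pi * t ^ 2 := by field_simp
    have e2 : (Real.pi / (Real.pi / t ^ 2)) ^ (-(3 / 2) : ℝ) = t ^ (-3 : ℝ) := by
      rw [show Real.pi / (Real.pi / t ^ 2) = t ^ (2 : ℝ) by rw [Real.rpow_two]; field_simp,
        ← Real.rpow_mul ht.le]
      norm_num
    have e3 : ∀ r : ℝ, -(Real.pi / t ^ 2) * r = -(Real.pi * r) * t ^ (-2 : ℝ) := by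
      intro r
      rw [Real.rpow_neg ht.le, Real.rpow_two]
      field_simp
    rw [e1, e2] at h
    simp only [e3] at h
    refine Eq.trans ?_ h
    refine integral_congr_ae (Eventually.of_forall fun z => ?_)
    simp only
    congr 3
    ring
  · filter_upwards [hzero] with ξ hξ
    exact integral_gaussian_inv_scale (norm_pos_iff.2 hξ)
  · exact (((FourierTransform.fourier φ).continuous.mul
      (FourierTransform.fourierInv ψ).continuous)).aestronglyMeasurable
  · refine integrable_norm_sq_inv_mul ?_ ?_
    · exact (((FourierTransform.fourier φ).memLp 2 volume).integrable_mul
        ((FourierTransform.fourierInv ψ).memLp 2 volume))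
    · refine ⟨‖(FourierTransform.fourier φ).toBoundedContinuousFunction‖ *
        ‖(FourierTransform.fourierInv ψ).toBoundedContinuousFunction‖, fun x => ?_⟩
      rw [norm_mul]
      exact mul_le_mul ((FourierTransform.fourier φ).toBoundedContinuousFunction.norm_coe_le_norm x)
        ((FourierTransform.fourierInv ψ).toBoundedContinuousFunction.norm_coe_le_norm x)
        (norm_nonneg _) (norm_nonneg _)
  · filter_upwards [hdiag] with z hz
    exact integral_gaussian_scale (norm_pos_iff.2 hz)
  · exact Continuous.aestronglyMeasurable (by fun_prop)

/-! ### Weights and Fourier multipliers on distributions -/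

/-- Fourier multipliers on tempered distributions. -/
def multD (m : R3 → ℂ) : Dist →L[ℂ] Dist := TemperedDistribution.fourierMultiplierCLM ℂ m

theorem bessel_eq_multD (k : ℝ) : bessel k = multD (besselSymbol k) := rfl

theorem multD_apply (m : R3 → ℂ) (u : Dist) (ψ : 𝓢(R3, ℂ)) :
    multD m u ψ = u (FourierTransform.fourier
      (SchwartzMap.smulLeftCLM ℂ m (FourierTransform.fourierInv ψ))) := by
  simp [multD, TemperedDistribution.fourierMultiplierCLM_apply_apply]

theorem multD_multD {m m' : R3 → ℂ} (hm : m.HasTemperateGrowth) (hm' : m'.HasTemperateGrowth)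
    (u : Dist) : multD m (multD m' u) = multD (m' * m) u :=
  TemperedDistribution.fourierMultiplierCLM_fourierMultiplierCLM_apply hm' hm u

theorem multD_one (u : Dist) : multD (fun _ => 1) u = u := by
  rw [multD, TemperedDistribution.fourierMultiplierCLM_const]
  simp

theorem bessel_bessel (k l : ℝ) (u : Dist) : bessel k (bessel l u) = bessel (k + l) u := by
  rw [bessel_eq_multD, bessel_eq_multD, bessel_eq_multD,
    multD_multD (besselSymbol_temperate k) (besselSymbol_temperate l)]
  congr 1
  congr 1
  ext ξ
  rw [Pi.mul_apply, ← besselSymbol_add, add_comm]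

theorem bessel_zero (u : Dist) : bessel 0 u = u := by
  have h : besselSymbol 0 = fun _ => (1 : ℂ) := by
    ext ξ
    simp [besselSymbol, japanese_zero]
  rw [bessel_eq_multD, h, multD_one]

theorem weight_apply (s : ℝ) (u : Dist) (ψ : 𝓢(R3, ℂ)) : weight s u ψ = u (weightS s ψ) := by
  simp [weight, weightS, TemperedDistribution.smulLeftCLM_apply_apply]

theorem weight_weight (s t : ℝ) (u : Dist) : weight s (weight t u) = weight (s + t) u := by
  ext ψ
  rw [weight_apply, weight_apply, weight_apply, weightS_weightS, add_comm]

theorem weight_zero (u : Dist) : weight 0 u = u := by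
  ext ψ
  rw [weight_apply, weightS_zero]

theorem weight_injective (s : ℝ) : Function.Injective (weight s) := by
  intro u v h
  have h2 := congrArg (weight (-s)) h
  rwa [weight_weight, weight_weight, neg_add_cancel, weight_zero, weight_zero] at h2

theorem sobolevRep_iff {k s : ℝ} {u : Dist} {f : L2} :
    SobolevRep k s u f ↔ bessel k u = weight (-s) (ofL2 f) := by
  unfold SobolevRep
  constructor
  · intro h
    rw [← h, weight_weight, neg_add_cancel, weight_zero]
  · intro h
    rw [h, weight_weight, add_neg_cancel, weight_zero]

theorem sobolevRep_iff' {k s : ℝ} {u : Dist} {f : L2} :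
    SobolevRep k s u f ↔ u = bessel (-k) (weight (-s) (ofL2 f)) := by
  rw [sobolevRep_iff]
  constructor
  · intro h
    rw [← h, bessel_bessel, neg_add_cancel, bessel_zero]
  · intro h
    rw [h, bessel_bessel, add_neg_cancel, bessel_zero]

theorem continuous_ofL2 : Continuous ofL2 :=
  (Lp.toTemperedDistributionCLM ℂ (volume : Measure R3) 2).continuous

theorem ofL2_add (f g : L2) : ofL2 (f + g) = ofL2 f + ofL2 g := map_add _ _ _

theorem ofL2_neg (f : L2) : ofL2 (-f) = -ofL2 f := map_neg _ _

theorem ofL2_apply (f : L2) (ψ : 𝓢(R3, ℂ)) : ofL2 f ψ = ∫ x, ψ x * f x := by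
  simp [ofL2, Lp.toTemperedDistribution_apply]

theorem schwartzDist_eq_ofL2 (φ : 𝓢(R3, ℂ)) : schwartzDist φ = ofL2 (φ.toLp 2) :=
  (Lp.toTemperedDistribution_toLp_eq (p := 2) φ).symm

theorem schwartzDist_apply (φ ψ : 𝓢(R3, ℂ)) : schwartzDist φ ψ = ∫ x, ψ x * φ x := by
  simp [schwartzDist, SchwartzMap.toTemperedDistributionCLM_apply_apply]

theorem weight_schwartzDist (s : ℝ) (φ : 𝓢(R3, ℂ)) :
    weight s (schwartzDist φ) = schwartzDist (weightS s φ) := by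
  ext ψ
  rw [weight_apply, schwartzDist_apply, schwartzDist_apply]
  refine integral_congr_ae (Eventually.of_forall fun x => ?_)
  simp only [weightS_apply]
  ring

theorem multD_schwartzDist {m : R3 → ℂ} (hm : m.HasTemperateGrowth) (φ : 𝓢(R3, ℂ)) :
    multD m (schwartzDist φ) = schwartzDist (multS m φ) :=
  TemperedDistribution.fourierMultiplierCLM_toTemperedDistributionCLM_eq hm φ

theorem ofL2_eq_inner (f : L2) (ψ : 𝓢(R3, ℂ)) :
    ofL2 f ψ = inner ℂ (star (ψ.toLp 2 : L2)) f := by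
  rw [ofL2_apply, L2.inner_def]
  refine integral_congr_ae ?_
  filter_upwards [Lp.coeFn_star (ψ.toLp 2 : L2), ψ.coeFn_toLp 2 volume] with x h1 h2
  rw [h1, Pi.star_apply, h2]
  simp [mul_comm]

/-- Both sides are continuous in f and agree on Schwartz functions. The lemma reduces multipliers on
weighted spaces of distributions to bounded operators on L². -/
theorem multD_weight {m : R3 → ℂ} (hm : IsRealSymbol m) (s : ℝ) (f : L2) :
    multD m (weight (-s) (ofL2 f)) = weight (-s) (ofL2 (weightedMult m s f)) := by
  have hc := continuous_ofL2
  refine ext_toLp (f := fun f => multD m (weight (-s) (ofL2 f)))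
    (g := fun f => weight (-s) (ofL2 (weightedMult m s f))) (by fun_prop) (by fun_prop)
    (fun φ => ?_) f
  simp only
  rw [weightedMult_toLp hm, ← schwartzDist_eq_ofL2, ← schwartzDist_eq_ofL2, weight_schwartzDist,
    weight_schwartzDist, multD_schwartzDist (hm.symbol 0).temperate, weightS_weightS,
    neg_add_cancel, weightS_zero]

/-! ### Distributions that are functions -/

theorem isFunction_ofL2 (f : L2) : IsFunction (ofL2 f) f :=
  ⟨(Lp.memLp f).locallyIntegrable (by norm_num), fun φ =>
    ⟨(φ.memLp 2 volume).integrable_mul (Lp.memLp f), ofL2_apply f φ⟩⟩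

theorem IsFunction.weight {T : Dist} {f : R3 → ℂ} (h : IsFunction T f) (s : ℝ) :
    IsFunction (weight s T) (fun x => (japanese s x : ℂ) * f x) := by
  refine ⟨?_, fun φ => ?_⟩
  · have h1 := h.1
    rw [← locallyIntegrableOn_univ] at h1 ⊢
    exact h1.continuousOn_mul (by
      have := continuous_japanese s
      fun_prop) isOpen_univ.isLocallyClosed
  · obtain ⟨h1, h2⟩ := h.2 (weightS s φ)
    have e : ∀ x, φ x * ((japanese s x : ℂ) * f x) = weightS s φ x * f x := by
      intro x
      rw [weightS_apply]; ring
    simp only [e]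
    exact ⟨h1, by rw [weight_apply, h2]⟩

/-! ### The Newton potential as a distribution -/

theorem weight_weightedNewton_apply {a b : ℝ} (ha : 1 / 2 < a) (hb : 1 / 2 < b) (hab : 2 < a + b)
    (f : L2) (ψ : 𝓢(R3, ℂ)) :
    weight a (ofL2 (weightedNewton a b f)) ψ = ∫ z : R3 × R3,
      (((4 * Real.pi * ‖z.1 - z.2‖)⁻¹ : ℝ) : ℂ) * ((japanese (-b) z.2 * f z.2) * ψ z.1)
        ∂(volume.prod volume) := by
  rw [weight_apply, ofL2_eq_inner, (inner_weightedNewton ha hb hab f _).2]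
  have h1 : ∀ᵐ x : R3, star ((weightS a ψ).toLp 2 volume : L2) x = star (weightS a ψ x) := by
    filter_upwards [Lp.coeFn_star ((weightS a ψ).toLp 2 volume : L2),
      (weightS a ψ).coeFn_toLp 2 volume] with x h1 h2
    rw [h1, Pi.star_apply, h2]
  refine integral_congr_ae ?_
  filter_upwards [Measure.quasiMeasurePreserving_fst.ae h1] with z hz
  rw [hz, weightS_apply, weightedKernel, japanese_neg a]
  have e : (japanese a z.1 : ℂ) ≠ 0 := by exact_mod_cast (japanese_pos a z.1).ne'
  simp only [RCLike.star_def, Complex.conj_conj]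
  push_cast
  field_simp

/-- The potential depends only on the density ⟨y⟩^{-b}f, not on the exponents used to represent it.
-/
theorem weightedNewton_congr {a b a' b' : ℝ} (ha : 1 / 2 < a) (hb : 1 / 2 < b) (hab : 2 < a + b)
    (ha' : 1 / 2 < a') (hb' : 1 / 2 < b') (hab' : 2 < a' + b') {f f' : L2}
    (h : weight (-b) (ofL2 f) = weight (-b') (ofL2 f')) :
    weight a (ofL2 (weightedNewton a b f)) = weight a' (ofL2 (weightedNewton a' b' f')) := by
  have h1 := (isFunction_ofL2 f).weight (-b)
  rw [h] at h1
  have h2 := h1.ae_eq ((isFunction_ofL2 f').weight (-b'))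
  ext ψ
  rw [weight_weightedNewton_apply ha hb hab, weight_weightedNewton_apply ha' hb' hab']
  refine integral_congr_ae ?_
  filter_upwards [Measure.quasiMeasurePreserving_snd.ae h2] with z hz
  rw [hz]

/-- The Newton potential of a Schwartz function as a distribution. -/
def newtonDist (φ : 𝓢(R3, ℂ)) : Dist :=
  weight 2 (ofL2 (weightedNewton 2 2 ((weightS 2 φ).toLp 2)))

theorem newtonDist_apply (φ ψ : 𝓢(R3, ℂ)) : newtonDist φ ψ = ∫ x, newton φ x * ψ x := by
  rw [newtonDist, weight_weightedNewton_apply (by norm_num) (by norm_num) (by norm_num),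
    integral_newton_mul]
  refine integral_congr_ae ?_
  filter_upwards [Measure.quasiMeasurePreserving_snd.ae ((weightS 2 φ).coeFn_toLp 2 volume)]
    with z hz
  have e : (japanese 2 z.2 : ℂ) ≠ 0 := by exact_mod_cast (japanese_pos 2 z.2).ne'
  rw [hz, weightS_apply, japanese_neg]
  push_cast
  field_simp

theorem newtonDist_weightS {a b : ℝ} (ha : 1 / 2 < a) (hb : 1 / 2 < b) (hab : 2 < a + b)
    (φ : 𝓢(R3, ℂ)) :
    weight a (ofL2 (weightedNewton a b (φ.toLp 2))) = newtonDist (weightS (-b) φ) := by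
  refine weightedNewton_congr ha hb hab (by norm_num) (by norm_num) (by norm_num) ?_
  rw [← schwartzDist_eq_ofL2, ← schwartzDist_eq_ofL2, weight_schwartzDist, weight_schwartzDist,
    weightS_weightS, weightS_weightS]
  norm_num

theorem newtonDist_apply_fourier (φ ψ : 𝓢(R3, ℂ)) :
    newtonDist φ ψ = ∫ ξ : R3, (((4 * Real.pi ^ 2 * ‖ξ‖ ^ 2)⁻¹ : ℝ) : ℂ) *
      (FourierTransform.fourier φ ξ * FourierTransform.fourierInv ψ ξ) := by
  rw [newtonDist_apply, integral_newton_mul_eq_fourier]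

/-- On the Fourier side both operators are multiplications, hence commute. -/
theorem multD_newtonDist {m : R3 → ℂ} (hm : m.HasTemperateGrowth) (φ : 𝓢(R3, ℂ)) :
    multD m (newtonDist φ) = newtonDist (multS m φ) := by
  ext ψ
  rw [multD_apply, newtonDist_apply_fourier, newtonDist_apply_fourier, multS_apply,
    FourierTransform.fourier_fourierInv_eq, FourierTransform.fourierInv_fourier_eq]
  refine integral_congr_ae (Eventually.of_forall fun ξ => ?_)
  simp only [SchwartzMap.smulLeftCLM_apply_apply hm, smul_eq_mul]
  ring

theorem integrable_fourier_pairing (φ ψ : 𝓢(R3, ℂ)) :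
    Integrable (fun ξ => FourierTransform.fourier φ ξ * FourierTransform.fourierInv ψ ξ) :=
  ((FourierTransform.fourier φ).memLp 2 volume).integrable_mul
    ((FourierTransform.fourierInv ψ).memLp 2 volume)

theorem integrable_newton_fourier (φ ψ : 𝓢(R3, ℂ)) :
    Integrable (fun ξ : R3 => (((4 * Real.pi ^ 2 * ‖ξ‖ ^ 2)⁻¹ : ℝ) : ℂ) *
      (FourierTransform.fourier φ ξ * FourierTransform.fourierInv ψ ξ)) := by
  refine integrable_norm_sq_inv_mul (integrable_fourier_pairing φ ψ)
    ⟨‖(FourierTransform.fourier φ).toBoundedContinuousFunction‖ *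
      ‖(FourierTransform.fourierInv ψ).toBoundedContinuousFunction‖, fun x => ?_⟩
  rw [norm_mul]
  exact mul_le_mul ((FourierTransform.fourier φ).toBoundedContinuousFunction.norm_coe_le_norm x)
    ((FourierTransform.fourierInv ψ).toBoundedContinuousFunction.norm_coe_le_norm x)
    (norm_nonneg _) (norm_nonneg _)

theorem schwartzDist_apply_fourier (φ ψ : 𝓢(R3, ℂ)) :
    schwartzDist φ ψ =
      ∫ ξ, FourierTransform.fourier φ ξ * FourierTransform.fourierInv ψ ξ := by
  rw [SchwartzMap.integral_fourier_mul_eq, FourierTransform.fourier_fourierInv_eq,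
    schwartzDist_apply]
  simp only [mul_comm]

/-- (1 + 4π²|ξ|²)/(4π²|ξ|²) = 1/(4π²|ξ|²) + 1 away from ξ = 0. -/
theorem bessel_two_newtonDist (φ : 𝓢(R3, ℂ)) :
    bessel 2 (newtonDist φ) = newtonDist φ + schwartzDist φ := by
  ext ψ
  rw [bessel_eq_multD, multD_apply, _root_.add_apply, newtonDist_apply_fourier,
    newtonDist_apply_fourier, schwartzDist_apply_fourier,
    ← integral_add (integrable_newton_fourier φ ψ) (integrable_fourier_pairing φ ψ),
    FourierTransform.fourierInv_fourier_eq]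
  refine integral_congr_ae ?_
  filter_upwards [Measure.ae_ne volume (0 : R3)] with ξ hξ
  simp only [SchwartzMap.smulLeftCLM_apply_apply (besselSymbol_temperate 2), smul_eq_mul]
  rw [besselSymbol, japanese_two, norm_smul, mul_pow, Real.norm_of_nonneg (by positivity)]
  have h1 : ((‖ξ‖ : ℝ) : ℂ) ≠ 0 := by simpa using hξ
  have h2 : (Real.pi : ℂ) ≠ 0 := by exact_mod_cast Real.pi_ne_zero
  push_cast
  field_simp
  ring

theorem bessel_two_weightedNewton {a b : ℝ} (ha : 1 / 2 < a) (hb : 1 / 2 < b) (hab : 2 < a + b)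
    (f : L2) : bessel 2 (weight a (ofL2 (weightedNewton a b f))) =
      weight a (ofL2 (weightedNewton a b f)) + weight (-b) (ofL2 f) := by
  have hc := continuous_ofL2
  refine ext_toLp (f := fun f => bessel 2 (weight a (ofL2 (weightedNewton a b f))))
    (g := fun f => weight a (ofL2 (weightedNewton a b f)) + weight (-b) (ofL2 f))
    (by fun_prop) (by fun_prop) (fun φ => ?_) f
  simp only
  rw [newtonDist_weightS ha hb hab, bessel_two_newtonDist, ← schwartzDist_eq_ofL2,
    weight_schwartzDist]

/-! ### The operator `G₀` -/

theorem multS_bessel (k l : ℝ) (φ : 𝓢(R3, ℂ)) :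
    multS (besselSymbol k) (multS (besselSymbol l) φ) = multS (besselSymbol (k + l)) φ := by
  rw [multS, multS, multS, SchwartzMap.fourierMultiplierCLM_fourierMultiplierCLM_apply
    (besselSymbol_temperate k) (besselSymbol_temperate l)]
  congr 1
  congr 1
  ext ξ
  rw [Pi.mul_apply, ← besselSymbol_add]

theorem multS_bessel_zero (φ : 𝓢(R3, ℂ)) : multS (besselSymbol 0) φ = φ := by
  have h : besselSymbol 0 = fun _ => (1 : ℂ) := by
    ext ξ
    simp [besselSymbol, japanese_zero]
  rw [multS, h, SchwartzMap.fourierMultiplierCLM_const]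
  simp

/-- G₀ commutes with Bessel potentials, so G₀φ = (1-Δ)^{1/2}G₀(1-Δ)^{-1/2}φ with (1-Δ)^{-1/2}φ =
⟨x⟩^{-s}F. The right-hand side is continuous in F, and this is the formula that extends to H^{-1,s}.
-/
theorem newtonDist_eq_of_sobolevRep {a s : ℝ} (ha : 1 / 2 < a) (hs : 1 / 2 < s) (has : 2 < a + s)
    {φ : 𝓢(R3, ℂ)} {F : L2} (h : SobolevRep (-1) s (schwartzDist φ) F) :
    newtonDist φ = bessel 1 (weight a (ofL2 (weightedNewton a s F))) := by
  have hF : F = (weightS s (multS (besselSymbol (-1)) φ)).toLp 2 := by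
    apply ofL2_injective
    rw [← h, ← schwartzDist_eq_ofL2, ← weight_schwartzDist, bessel_eq_multD,
      multD_schwartzDist (besselSymbol_temperate _)]
  rw [hF, newtonDist_weightS ha hs has, weightS_weightS, neg_add_cancel, weightS_zero,
    bessel_eq_multD, multD_newtonDist (besselSymbol_temperate _), multS_bessel, add_neg_cancel,
    multS_bessel_zero]

theorem isG0_unique_value {a s : ℝ} (ha : 1 / 2 < a) (hs : 1 / 2 < s) (has : 2 < a + s)
    {u : Dist} {f : L2} {φ : ℕ → 𝓢(R3, ℂ)} {F : ℕ → L2}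
    (hF : ∀ n, SobolevRep (-1) s (schwartzDist (φ n)) (F n)) (hlim : Tendsto F atTop (𝓝 f)) :
    (∀ ψ : 𝓢(R3, ℂ), Tendsto (fun n => ∫ x, newton (φ n) x * ψ x) atTop (𝓝 (u ψ))) ↔
      u = bessel 1 (weight a (ofL2 (weightedNewton a s f))) := by
  have h1 : ∀ ψ : 𝓢(R3, ℂ), Tendsto (fun n => ∫ x, newton (φ n) x * ψ x) atTop
      (𝓝 (bessel 1 (weight a (ofL2 (weightedNewton a s f))) ψ)) := by
    intro ψ
    simp only [← newtonDist_apply, fun n => newtonDist_eq_of_sobolevRep ha hs has (hF n)]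
    have hc := continuous_ofL2
    have hc2 : Continuous fun f : L2 => bessel 1 (weight a (ofL2 (weightedNewton a s f))) := by
      fun_prop
    exact PointwiseConvergenceCLM.tendsto_iff_forall_tendsto.1 ((hc2.tendsto f).comp hlim) ψ
  constructor
  · intro h
    ext ψ
    exact tendsto_nhds_unique (h ψ) (h1 ψ)
  · rintro rfl
    exact h1

/-- The approximation in `IsG0` may take place in some other H^{-1,s'}; `weightedNewton_congr` shows
that the limit is the same. Existence: if χₙ → f in L², then (1-Δ)^{1/2}⟨x⟩^{-s}χₙ approximates g.
-/
theorem isG0_iff {a s : ℝ} (ha : 1 / 2 < a) (hs : 1 / 2 < s) (has : 2 < a + s) {g u : Dist}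
    {f : L2} (hg : SobolevRep (-1) s g f) :
    IsG0 g u ↔ u = bessel 1 (weight a (ofL2 (weightedNewton a s f))) := by
  constructor
  · rintro ⟨s', hs', f', φ, F, hg', hF, hlim, hu⟩
    -- The exponent a = 2 is admissible for every s' > 1/2.
    have h1 := (isG0_unique_value (a := 2) (by norm_num) hs' (by linarith) hF hlim).1 hu
    rw [h1]
    congr 1
    refine weightedNewton_congr (by norm_num) hs' (by linarith) ha hs has ?_
    rw [← sobolevRep_iff.1 hg, ← sobolevRep_iff.1 hg']
  · intro hu
    obtain ⟨χ, hχ⟩ : ∃ χ : ℕ → 𝓢(R3, ℂ), Tendsto (fun n => ((χ n).toLp 2 : L2)) atTop (𝓝 f) := by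
      have h1 : f ∈ closure (Set.range (SchwartzMap.toLpCLM ℂ ℂ 2 (volume : Measure R3))) :=
        denseRange_toL2 f
      obtain ⟨x, hx, hlim⟩ := mem_closure_iff_seq_limit.1 h1
      choose χ hχ using hx
      refine ⟨χ, ?_⟩
      simp only [SchwartzMap.toLpCLM_apply] at hχ
      simpa only [hχ] using hlim
    have hF : ∀ n, SobolevRep (-1) s
        (schwartzDist (multS (besselSymbol 1) (weightS (-s) (χ n)))) ((χ n).toLp 2) := by
      intro n
      rw [sobolevRep_iff, bessel_eq_multD, multD_schwartzDist (besselSymbol_temperate _),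
        multS_bessel, neg_add_cancel, multS_bessel_zero, ← schwartzDist_eq_ofL2,
        weight_schwartzDist]
    exact ⟨s, hs, f, _, _, hg, hF, hχ, (isG0_unique_value ha hs has hF hχ).2 hu⟩

theorem G0_eq {a s : ℝ} (ha : 1 / 2 < a) (hs : 1 / 2 < s) (has : 2 < a + s) {g : Dist}
    {f : L2} (hg : SobolevRep (-1) s g f) :
    G0 g = bessel 1 (weight a (ofL2 (weightedNewton a s f))) := by
  have h : ∃ u, IsG0 g u := ⟨_, (isG0_iff ha hs has hg).2 rfl⟩
  unfold G0
  rw [dif_pos h]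
  exact (isG0_iff ha hs has hg).1 h.choose_spec

theorem isG0_G0 {s : ℝ} (hs : 1 / 2 < s) {g : Dist} {f : L2} (hg : SobolevRep (-1) s g f) :
    IsG0 g (G0 g) :=
  (isG0_iff (a := 2) (by norm_num) hs (by linarith) hg).2
    (G0_eq (by norm_num) hs (by linarith) hg)

theorem bessel_one_G0 {a s : ℝ} (ha : 1 / 2 < a) (hs : 1 / 2 < s) (has : 2 < a + s) {g : Dist}
    {f : L2} (hg : SobolevRep (-1) s g f) :
    bessel 1 (G0 g) = weight a (ofL2 (weightedNewton a s f)) + weight (-s) (ofL2 f) := by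
  rw [G0_eq ha hs has hg, bessel_bessel, ← bessel_two_weightedNewton ha hs has]
  norm_num

theorem bessel_two_eq (u : Dist) : bessel 2 u = u - Δ u := by
  have h1 : Function.HasTemperateGrowth (fun ξ : R3 => Complex.ofReal (‖ξ‖ ^ 2)) := by fun_prop
  rw [TemperedDistribution.laplacian_eq_fourierMultiplierCLM, neg_smul, sub_neg_eq_add]
  ext ψ
  have h2 : SchwartzMap.smulLeftCLM ℂ (besselSymbol 2) (FourierTransform.fourierInv ψ) =
      FourierTransform.fourierInv ψ + (((2 * Real.pi) ^ 2 : ℝ) : ℂ) •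
        SchwartzMap.smulLeftCLM ℂ (fun ξ : R3 => Complex.ofReal (‖ξ‖ ^ 2))
          (FourierTransform.fourierInv ψ) := by
    ext ξ
    rw [_root_.add_apply, _root_.smul_apply,
      SchwartzMap.smulLeftCLM_apply_apply (besselSymbol_temperate 2),
      SchwartzMap.smulLeftCLM_apply_apply h1, besselSymbol, japanese_two, norm_smul, mul_pow,
      Real.norm_of_nonneg (by positivity)]
    simp only [smul_eq_mul]
    push_cast
    ring
  rw [bessel_eq_multD, multD_apply, h2, FourierTransform.fourier_add,
    FourierTransform.fourier_smul, FourierTransform.fourier_fourierInv_eq, map_add, map_smul,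
    _root_.add_apply, ← Complex.coe_smul, _root_.smul_apply,
    TemperedDistribution.fourierMultiplierCLM_apply_apply]

/-- (1-Δ)G₀g = G₀g + g, and G₀g cancels. -/
theorem laplacian_G0 {s : ℝ} (hs : 1 / 2 < s) {g : Dist} {f : L2} (hg : SobolevRep (-1) s g f) :
    -(Δ (G0 g)) = g := by
  have ha : (1 / 2 : ℝ) < 2 := by norm_num
  have h1 := G0_eq ha hs (by linarith) hg
  have h2 : bessel 2 (G0 g) = G0 g + g := by
    rw [h1, bessel_bessel, add_comm, ← bessel_bessel,
      bessel_two_weightedNewton ha hs (by linarith), map_add, ← h1, ← sobolevRep_iff.1 hg,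
      bessel_bessel]
    norm_num [bessel_zero]
  rw [bessel_two_eq, sub_eq_add_neg] at h2
  exact add_left_cancel h2

/-! ### Multiplication operators -/

/-- Bounded measurable functions. -/
structure IsBoundedMeasurable (a : R3 → ℝ) : Prop where
  measurable : Measurable a
  bounded : ∃ c : ℝ, ∀ x, |a x| ≤ c

/-- Measurable functions that decay like `⟨x⟩ ^ (-p)`. -/
structure Decays (p : ℝ) (a : R3 → ℝ) : Prop where
  measurable : Measurable a
  decay : ∃ c : ℝ, ∀ x, |a x| ≤ c * japanese (-p) x

theorem IsBoundedMeasurable.memLp {a : R3 → ℝ} (ha : IsBoundedMeasurable a) (f : L2) :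
    MemLp (fun x => (a x : ℂ) * f x) 2 (volume : Measure R3) := by
  obtain ⟨c, hc⟩ := ha.bounded
  refine (Lp.memLp f).of_le_mul (c := c) ?_ (Eventually.of_forall fun x => ?_)
  · exact (Complex.measurable_ofReal.comp ha.measurable).aestronglyMeasurable.mul
      (Lp.aestronglyMeasurable f)
  · rw [norm_mul, Complex.norm_real]
    exact mul_le_mul_of_nonneg_right (hc x) (norm_nonneg _)

open Classical in
/-- Multiplication by a bounded measurable function. -/
def mulLp (a : R3 → ℝ) : L2 →L[ℂ] L2 :=
  if h : IsBoundedMeasurable a then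
    LinearMap.mkContinuous
      { toFun := fun f => (h.memLp f).toLp _
        map_add' := fun f g => by
          rw [← MemLp.toLp_add]
          refine MemLp.toLp_congr _ _ ?_
          filter_upwards [Lp.coeFn_add f g] with x hx
          rw [hx]
          simp [mul_add]
        map_smul' := fun c f => by
          rw [RingHom.id_apply, ← MemLp.toLp_const_smul]
          refine MemLp.toLp_congr _ _ ?_
          filter_upwards [Lp.coeFn_smul c f] with x hx
          rw [hx]
          simp
          ring } h.bounded.choose (fun f => by
      refine Lp.norm_le_mul_norm_of_ae_le_mul ?_
      filter_upwards [(h.memLp f).coeFn_toLp] with x hx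
      simp only [LinearMap.coe_mk, AddHom.coe_mk]
      rw [hx, norm_mul, Complex.norm_real]
      exact mul_le_mul_of_nonneg_right (h.bounded.choose_spec x) (norm_nonneg _))
  else 0

theorem coeFn_mulLp {a : R3 → ℝ} (h : IsBoundedMeasurable a) (f : L2) :
    mulLp a f =ᵐ[volume] fun x => (a x : ℂ) * f x := by
  unfold mulLp
  rw [dif_pos h]
  exact (h.memLp f).coeFn_toLp

open ContinuousLinearMap in
theorem adjoint_mulLp {a : R3 → ℝ} (h : IsBoundedMeasurable a) : adjoint (mulLp a) = mulLp a := by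
  symm
  rw [eq_adjoint_iff]
  intro f g
  rw [L2.inner_def, L2.inner_def]
  refine integral_congr_ae ?_
  filter_upwards [coeFn_mulLp h f, coeFn_mulLp h g] with x h1 h2
  rw [h1, h2]
  simp
  ring

theorem IsBoundedMeasurable.mul {a b : R3 → ℝ} (ha : IsBoundedMeasurable a)
    (hb : IsBoundedMeasurable b) : IsBoundedMeasurable (fun x => a x * b x) := by
  obtain ⟨c, hc⟩ := ha.bounded
  obtain ⟨d, hd⟩ := hb.bounded
  refine ⟨ha.measurable.mul hb.measurable, c * d, fun x => ?_⟩
  rw [abs_mul]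
  exact mul_le_mul (hc x) (hd x) (abs_nonneg _) ((abs_nonneg _).trans (hc x))

theorem mulLp_mulLp {a b : R3 → ℝ} (ha : IsBoundedMeasurable a) (hb : IsBoundedMeasurable b)
    (f : L2) : mulLp a (mulLp b f) = mulLp (fun x => a x * b x) f := by
  refine Lp.ext ?_
  filter_upwards [coeFn_mulLp ha (mulLp b f), coeFn_mulLp hb f, coeFn_mulLp (ha.mul hb) f]
    with x h1 h2 h3
  rw [h1, h2, h3]
  push_cast
  ring

theorem mulLp_one {a : R3 → ℝ} (h : IsBoundedMeasurable a) (h1 : ∀ x, a x = 1) (f : L2) :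
    mulLp a f = f := by
  refine Lp.ext ?_
  filter_upwards [coeFn_mulLp h f] with x hx
  rw [hx, h1]
  simp

theorem isBoundedMeasurable_japanese {s : ℝ} (hs : s ≤ 0) : IsBoundedMeasurable (japanese s) :=
  ⟨(continuous_japanese s).measurable, 1, fun x => by
    rw [abs_of_nonneg (japanese_pos _ _).le]
    exact japanese_le_one hs x⟩

theorem Decays.isBoundedMeasurable {p : ℝ} {a : R3 → ℝ} (h : Decays p a) :
    IsBoundedMeasurable (fun x => a x * japanese p x) := by
  obtain ⟨c, hc⟩ := h.decay
  refine ⟨h.measurable.mul (continuous_japanese p).measurable, c, fun x => ?_⟩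
  have hp := japanese_pos p x
  rw [abs_mul, abs_of_pos hp]
  calc _ ≤ c * japanese (-p) x * japanese p x := mul_le_mul_of_nonneg_right (hc x) hp.le
    _ = c := by rw [japanese_neg]; field_simp

theorem IsFunction.congr {T : Dist} {f g : R3 → ℂ} (h : IsFunction T f) (hfg : f =ᵐ[volume] g) :
    IsFunction T g := by
  refine ⟨h.1.congr hfg, fun φ => ?_⟩
  have e : (fun x => φ x * f x) =ᵐ[volume] fun x => φ x * g x := by
    filter_upwards [hfg] with x hx
    rw [hx]
  exact ⟨(h.2 φ).1.congr e, by rw [(h.2 φ).2, integral_congr_ae e]⟩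

theorem mul_eq {m : R3 → ℝ} {T S : Dist} (h : IsMul m T S) : mul m T = S := by
  have h' : ∃ S, IsMul m T S := ⟨S, h⟩
  unfold mul
  rw [dif_pos h']
  exact h'.choose_spec.unique h

theorem mul_weight_ofL2 {p : ℝ} {a : R3 → ℝ} (h : Decays p a) (t : ℝ) (f : L2) :
    mul a (weight t (ofL2 f)) = weight (t - p) (ofL2 (mulLp (fun x => a x * japanese p x) f)) := by
  refine mul_eq ⟨_, (isFunction_ofL2 f).weight t, ((isFunction_ofL2 _).weight (t - p)).congr ?_⟩
  filter_upwards [coeFn_mulLp h.isBoundedMeasurable f] with x hx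
  have e : japanese t x = japanese (t - p) x * japanese p x := by
    rw [← japanese_add]; congr 1; ring
  rw [hx, e]
  push_cast
  ring

theorem mul_ofL2 {a : R3 → ℝ} (h : IsBoundedMeasurable a) (f : L2) :
    mul a (ofL2 f) = ofL2 (mulLp a f) :=
  mul_eq ⟨_, isFunction_ofL2 f, (isFunction_ofL2 _).congr (coeFn_mulLp h f)⟩

theorem weight_ofL2 {s : ℝ} (hs : s ≤ 0) (f : L2) :
    weight s (ofL2 f) = ofL2 (mulLp (japanese s) f) := by
  have h := ((isFunction_ofL2 f).weight s)
  have h' := (isFunction_ofL2 (mulLp (japanese s) f)).congr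
    (coeFn_mulLp (isBoundedMeasurable_japanese hs) f)
  ext ψ
  rw [(h.2 ψ).2, (h'.2 ψ).2]

theorem toL2_ofL2 (f : L2) : toL2 (ofL2 f) = f := by
  have h : ∃ g : L2, ofL2 f = ofL2 g := ⟨f, rfl⟩
  unfold toL2
  rw [dif_pos h]
  exact (ofL2_injective h.choose_spec).symm

/-! ### Momentum -/

/-- The symbol of the momentum operator. -/
def coordSymbol (j : Fin 3) (ξ : R3) : ℂ := ((2 * Real.pi * inner ℝ ξ (unitVec j) : ℝ) : ℂ)

theorem temperate_coordSymbol (j : Fin 3) : (coordSymbol j).HasTemperateGrowth :=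
  coordSymbol_temperate j

theorem momentum_eq (j : Fin 3) (u : Dist) : momentum j u = multD (coordSymbol j) u := by
  have h1 : Function.HasTemperateGrowth (fun ξ : R3 => ((inner ℝ ξ (unitVec j) : ℝ) : ℂ)) := by
    fun_prop
  have h2 : coordSymbol j = (2 * Real.pi : ℂ) • fun ξ : R3 => ((inner ℝ ξ (unitVec j) : ℝ) : ℂ) := by
    ext ξ
    simp [coordSymbol]
  rw [momentum, TemperedDistribution.lineDeriv_eq_fourierMultiplierCLM, multD, h2,
    TemperedDistribution.fourierMultiplierCLM_smul h1, smul_smul, _root_.smul_apply]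
  congr 1
  linear_combination (-2 * Real.pi : ℂ) * Complex.I_sq

theorem momentum_bessel (j : Fin 3) (u : Dist) :
    momentum j (bessel (-1) u) = multD (rieszSymbol j) u := by
  rw [momentum_eq, bessel_eq_multD, multD_multD (temperate_coordSymbol j)
    (besselSymbol_temperate _), mul_comm]
  rfl

theorem bessel_momentum (j : Fin 3) (u : Dist) :
    bessel (-1) (momentum j u) = multD (rieszSymbol j) u := by
  rw [momentum_eq, bessel_eq_multD, multD_multD (besselSymbol_temperate _)
    (temperate_coordSymbol j)]
  rfl

/-! ### Weighted Sobolev spaces -/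

theorem sobolev_weight_mono {k s t : ℝ} (h : t ≤ s) {u : Dist} (hu : u ∈ sobolev k s) :
    u ∈ sobolev k t := by
  obtain ⟨f, hf⟩ := mem_sobolev_iff.1 hu
  refine mem_sobolev_iff.2 ⟨mulLp (japanese (t - s)) f, ?_⟩
  rw [sobolevRep_iff] at hf ⊢
  rw [hf, ← weight_ofL2 (by linarith), weight_weight]
  congr 2
  ring

theorem G0_mem_sobolev {a s : ℝ} (ha : 1 / 2 < a) (hs : 1 / 2 < s) (has : 2 < a + s) {g : Dist}
    (hg : g ∈ sobolev (-1) s) : G0 g ∈ sobolev 1 (-a) := by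
  obtain ⟨f, hf⟩ := mem_sobolev_iff.1 hg
  refine mem_sobolev_iff.2 ⟨weightedNewton a s f + mulLp (japanese (-(a + s))) f, ?_⟩
  rw [sobolevRep_iff, bessel_one_G0 ha hs has hf, ofL2_add, map_add, ← weight_ofL2 (by linarith),
    weight_weight, neg_neg]
  congr 3
  ring

/-! ### A Liouville theorem -/

theorem IsSymbol.comp_smul {n : ℕ} {m : R3 → ℂ} (h : IsSymbol n m) (c : ℝ) :
    IsSymbol n (fun ξ => m (c • ξ)) := by
  have h0 : ∀ {k : ℕ} {m : R3 → ℂ}, IsSymbol k m → IsSymbol 0 (fun ξ => m (c • ξ)) := by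
    intro k m h
    obtain ⟨h1, d, hd⟩ := h.zero_order
    have h2 : (fun ξ : R3 => (c • ContinuousLinearMap.id ℝ R3) ξ).HasTemperateGrowth :=
      ContinuousLinearMap.hasTemperateGrowth _
    exact ⟨h1.comp h2, d, fun ξ => hd _⟩
  induction n generalizing m with
  | zero => exact h0 h
  | succ n ih =>
    refine ⟨h0 h, fun j => ?_⟩
    have e : (fun ξ => fderiv ℝ (fun ξ => m (c • ξ)) ξ (unitVec j)) =
        fun ξ => (fun _ => (c : ℂ)) ξ * fderiv ℝ m (c • ξ) (unitVec j) := by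
      ext ξ
      rw [fderiv_comp_smul]
      simp
    rw [e]
    exact (IsSymbol.const n _).mul (ih (h.2 j))

/-- The symbol `(1 + |2 π n ξ|²)⁻¹` of `(1 - n² Δ)⁻¹`. -/
def resolventSymbol (n : ℝ) (ξ : R3) : ℂ := besselSymbol (-1) (n • ξ) * besselSymbol (-1) (n • ξ)

theorem isSymbol_resolvent (k : ℕ) (n : ℝ) : IsSymbol k (resolventSymbol n) :=
  ((isSymbol_bessel_riesz k).1.comp_smul n).mul ((isSymbol_bessel_riesz k).1.comp_smul n)

theorem resolventSymbol_eq (n : ℝ) (ξ : R3) :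
    resolventSymbol n ξ = (((1 + (2 * Real.pi) ^ 2 * n ^ 2 * ‖ξ‖ ^ 2)⁻¹ : ℝ) : ℂ) := by
  rw [resolventSymbol, ← besselSymbol_add, besselSymbol, show (-1 + -1 : ℝ) = -2 by norm_num,
    japanese_neg, japanese_two, norm_smul, norm_smul, mul_pow, mul_pow, Real.norm_eq_abs,
    Real.norm_eq_abs, sq_abs, sq_abs, mul_assoc]

theorem norm_resolventSymbol_le_one (n : ℝ) (ξ : R3) : ‖resolventSymbol n ξ‖ ≤ 1 := by
  rw [resolventSymbol_eq, Complex.norm_real, Real.norm_of_nonneg (by positivity)]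
  exact inv_le_one_of_one_le₀ (by nlinarith [show 0 ≤ (2 * Real.pi) ^ 2 * n ^ 2 * ‖ξ‖ ^ 2 by positivity])

theorem tendsto_resolventSymbol {ξ : R3} (hξ : ξ ≠ 0) :
    Tendsto (fun n : ℕ => ‖resolventSymbol n ξ‖) atTop (𝓝 0) := by
  have h : Tendsto (fun n : ℕ => (1 + (2 * Real.pi) ^ 2 * ‖ξ‖ ^ 2 * (n : ℝ) ^ 2)) atTop atTop := by
    refine tendsto_atTop_add_const_left _ _ (Tendsto.const_mul_atTop ?_ ?_)
    · have := norm_pos_iff.2 hξ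
      positivity
    · exact (tendsto_pow_atTop two_ne_zero).comp tendsto_natCast_atTop_atTop
  refine h.inv_tendsto_atTop.congr fun n => ?_
  rw [resolventSymbol_eq, Complex.norm_real, Real.norm_of_nonneg (by positivity), Pi.inv_apply]
  congr 2
  ring

/-- The derivative is bounded by 2/|ξ| uniformly in n. Its square is locally integrable in R³, which
is what allows one power of weight in the Liouville theorem. -/
theorem norm_fderiv_resolventSymbol {n : ℝ} (hn : 0 < n) (j : Fin 3) (ξ : R3) :
    ‖fderiv ℝ (resolventSymbol n) ξ (unitVec j)‖ * ‖ξ‖ ≤ 2 * ‖resolventSymbol n ξ‖ := by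
  have hd : Differentiable ℝ (besselSymbol (-1)) := (isSymbol_bessel_riesz 0).1.differentiable
  have hd' : DifferentiableAt ℝ (fun ξ : R3 => besselSymbol (-1) (n • ξ)) ξ := by fun_prop
  have h1 : fderiv ℝ (fun ξ : R3 => besselSymbol (-1) (n • ξ)) ξ (unitVec j) =
      n * (-(2 * Real.pi : ℂ) * (rieszSymbol j (n • ξ) * (besselSymbol (-1) (n • ξ) *
        besselSymbol (-1) (n • ξ)))) := by
    rw [fderiv_comp_smul, ← fderiv_besselSymbol]
    simp
  have h2 : fderiv ℝ (resolventSymbol n) ξ (unitVec j) =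
      -(2 * (2 * Real.pi * n * besselSymbol (-1) (n • ξ)) * rieszSymbol j (n • ξ)) *
        resolventSymbol n ξ := by
    unfold resolventSymbol
    rw [fderiv_fun_mul hd' hd']
    simp only [_root_.add_apply, _root_.smul_apply, smul_eq_mul, h1]
    ring
  have h3 : (2 * Real.pi * n * ‖besselSymbol (-1) (n • ξ)‖) * ‖ξ‖ ≤ 1 := by
    rw [besselSymbol, Complex.norm_real, Real.norm_of_nonneg (japanese_pos _ _).le, japanese_neg]
    have h4 := norm_le_japanese ((2 * Real.pi) • n • ξ)
    rw [norm_smul, norm_smul, Real.norm_of_nonneg (by positivity), Real.norm_of_nonneg hn.le] at h4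
    have h5 := japanese_pos 1 ((2 * Real.pi) • n • ξ)
    calc _ = (2 * Real.pi * (n * ‖ξ‖)) * (japanese 1 ((2 * Real.pi) • n • ξ))⁻¹ := by ring
      _ ≤ 1 := by rw [← div_eq_mul_inv]; exact (div_le_one h5).2 h4
  rw [h2, norm_mul, norm_neg, norm_mul, norm_mul, norm_mul, norm_mul, norm_mul]
  simp only [Complex.norm_real, Complex.norm_ofNat, Real.norm_of_nonneg Real.pi_pos.le,
    Real.norm_of_nonneg hn.le]
  have h6 := norm_rieszSymbol j (n • ξ)
  calc _ = 2 * ((2 * Real.pi * n * ‖besselSymbol (-1) (n • ξ)‖) * ‖ξ‖) * ‖rieszSymbol j (n • ξ)‖ *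
        ‖resolventSymbol n ξ‖ := by ring
    _ ≤ 2 * 1 * 1 * ‖resolventSymbol n ξ‖ := by gcongr
    _ = _ := by ring

theorem energy_multS_eq {m : R3 → ℂ} (hm : m.HasTemperateGrowth) (φ : 𝓢(R3, ℂ)) :
    energy (japanese 0) (multS m φ) =
      ∫⁻ ξ, ENNReal.ofReal (‖m ξ‖ ^ 2 * ‖FourierTransform.fourier φ ξ‖ ^ 2) := by
  have e : ∀ φ : 𝓢(R3, ℂ), energy (japanese 0) φ = ENNReal.ofReal (‖φ.toLp 2‖ ^ 2) := by
    intro φ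
    have := energy_weight 0 φ
    rwa [mul_zero, weightS_zero] at this
  rw [e, ← SchwartzMap.norm_fourier_toL2_eq, multS_apply, FourierTransform.fourier_fourierInv_eq,
    ← e]
  unfold energy
  refine lintegral_congr fun x => ?_
  rw [SchwartzMap.smulLeftCLM_apply_apply hm, norm_smul, japanese_zero, mul_one, mul_pow]

theorem tendsto_energy_multS {m : ℕ → R3 → ℂ} (hm : ∀ n, (m n).HasTemperateGrowth) {C : ℝ}
    (hC : ∀ᶠ n in atTop, ∀ ξ : R3, ξ ≠ 0 → ‖m n ξ‖ ^ 2 ≤ C * (1 + (‖ξ‖ ^ 2)⁻¹))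
    (hlim : ∀ ξ : R3, ξ ≠ 0 → Tendsto (fun n => ‖m n ξ‖) atTop (𝓝 0)) (φ : 𝓢(R3, ℂ)) :
    Tendsto (fun n => energy (japanese 0) (multS (m n) φ)) atTop (𝓝 0) := by
  simp only [fun n => energy_multS_eq (hm n) φ]
  set F := FourierTransform.fourier φ
  have hF : Measurable fun ξ => F ξ := F.continuous.measurable
  have hmm : ∀ n, Measurable (m n) := fun n => (hm n).1.continuous.measurable
  have hF2 : Integrable fun ξ => ‖F ξ‖ ^ 2 := (F.memLp 2 volume).integrable_norm_pow two_ne_zero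
  have hint : Integrable (fun ξ : R3 => (C * (1 + (‖ξ‖ ^ 2)⁻¹)) * ‖F ξ‖ ^ 2) := by
    have h1 := (integrable_norm_sq_inv_mul (F := fun ξ => F ξ * F ξ)
      ((F.memLp 2 volume).integrable_mul (F.memLp 2 volume))
      ⟨‖F.toBoundedContinuousFunction‖ ^ 2, fun x => by
        rw [norm_mul, ← sq]
        exact pow_le_pow_left₀ (norm_nonneg _)
          (F.toBoundedContinuousFunction.norm_coe_le_norm x) 2⟩).norm
    refine ((hF2.const_mul C).add (h1.const_mul (C * (4 * Real.pi ^ 2)))).congr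
      (Eventually.of_forall fun ξ => ?_)
    have hp := Real.pi_ne_zero
    simp only [Pi.add_apply, norm_mul, Complex.norm_real]
    rw [Real.norm_of_nonneg (by positivity), mul_inv]
    field_simp
  have hae : ∀ᵐ ξ : R3, ξ ≠ 0 := Measure.ae_ne volume 0
  have h := tendsto_lintegral_filter_of_dominated_convergence
    (F := fun n ξ => ENNReal.ofReal (‖m n ξ‖ ^ 2 * ‖F ξ‖ ^ 2)) (f := fun _ => 0) (l := atTop)
    (μ := (volume : Measure R3))
    (fun ξ : R3 => ENNReal.ofReal ((C * (1 + (‖ξ‖ ^ 2)⁻¹)) * ‖F ξ‖ ^ 2)) ?_ ?_ ?_ ?_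
  · simpa using h
  · exact Eventually.of_forall fun n => by
      have := hmm n
      fun_prop
  · filter_upwards [hC] with n hn
    filter_upwards [hae] with ξ hξ
    exact ENNReal.ofReal_le_ofReal (mul_le_mul_of_nonneg_right (hn ξ hξ) (by positivity))
  · exact ((lintegral_ofReal_le_lintegral_enorm _).trans_lt hint.2).ne
  · filter_upwards [hae] with ξ hξ
    have h1 := ((hlim ξ hξ).pow 2).mul_const (‖F ξ‖ ^ 2)
    have h2 := ENNReal.tendsto_ofReal h1
    simpa using h2

/-- Through ⟨x⟩² = 1 + Σ x_j² and the commutator formula, the claim reduces to dominated convergence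
for the resolvent symbol and its first derivatives. -/
theorem tendsto_energy_resolvent (ψ : 𝓢(R3, ℂ)) :
    Tendsto (fun n : ℕ => energy (japanese 2) (multS (resolventSymbol n) ψ)) atTop (𝓝 0) := by
  have h0 : ∀ φ : 𝓢(R3, ℂ), Tendsto (fun n : ℕ => energy (japanese 0)
      (multS (resolventSymbol n) φ)) atTop (𝓝 0) := by
    refine tendsto_energy_multS (fun n => (isSymbol_resolvent 0 n).temperate) (C := 1)
      (Eventually.of_forall fun n ξ _ => ?_) (fun ξ hξ => tendsto_resolventSymbol hξ)
    have h1 := pow_le_one₀ (n := 2) (norm_nonneg _) (norm_resolventSymbol_le_one n ξ)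
    have h2 : 0 ≤ (‖ξ‖ ^ 2)⁻¹ := by positivity
    linarith
  have h1 : ∀ j, Tendsto (fun n : ℕ => energy (japanese 0)
      (multS (fun ξ => fderiv ℝ (resolventSymbol n) ξ (unitVec j)) ψ)) atTop (𝓝 0) := by
    intro j
    have hb : ∀ n : ℕ, 0 < n → ∀ ξ : R3, ξ ≠ 0 →
        ‖fderiv ℝ (resolventSymbol n) ξ (unitVec j)‖ ≤ ‖resolventSymbol n ξ‖ * (2 / ‖ξ‖) := by
      intro n hn ξ hξ
      have h2 := norm_fderiv_resolventSymbol (n := n) (by exact_mod_cast hn) j ξ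
      have h3 := norm_pos_iff.2 hξ
      rw [mul_div_assoc', le_div_iff₀ h3]
      linarith
    refine tendsto_energy_multS (fun n => ((isSymbol_resolvent 1 n).2 j).temperate) (C := 4)
      ?_ (fun ξ hξ => ?_) ψ
    · filter_upwards [eventually_gt_atTop 0] with n hn ξ hξ
      have h3 := norm_pos_iff.2 hξ
      have h2 := (hb n hn ξ hξ).trans (mul_le_of_le_one_left (by positivity)
        (norm_resolventSymbol_le_one n ξ))
      have h4 := pow_le_pow_left₀ (norm_nonneg _) h2 2
      have h5 : (2 / ‖ξ‖) ^ 2 = 4 * (‖ξ‖ ^ 2)⁻¹ := by rw [div_pow]; ring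
      linarith
    · refine squeeze_zero' (Eventually.of_forall fun n => norm_nonneg _)
        ((eventually_gt_atTop 0).mono fun n hn => hb n hn ξ hξ) ?_
      simpa using (tendsto_resolventSymbol hξ).mul_const (2 / ‖ξ‖)
  set c : ℂ := -(2 * Real.pi * Complex.I)⁻¹
  have h2 : ∀ n : ℕ, energy (japanese 2) (multS (resolventSymbol n) ψ) ≤
      energy (japanese 0) (multS (resolventSymbol n) ψ) + ∑ j,
        (2 * energy (japanese 0) (multS (resolventSymbol n) (coordS j ψ)) +
          2 * (ENNReal.ofReal (‖c‖ ^ 2) * energy (japanese 0)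
            (multS (fun ξ => fderiv ℝ (resolventSymbol n) ξ (unitVec j)) ψ))) := by
    intro n
    have h3 := energy_succ 0 (multS (resolventSymbol n) ψ)
    rw [zero_add] at h3
    rw [h3]
    refine add_le_add le_rfl (Finset.sum_le_sum fun j _ => ?_)
    rw [coordS_multS (isSymbol_resolvent 1 n), ← energy_smul]
    exact energy_add_le (fun x => (japanese_pos 0 x).le) (continuous_japanese 0).measurable _ _
  refine tendsto_of_tendsto_of_tendsto_of_le_of_le tendsto_const_nhds ?_ (fun n => bot_le) h2
  have h4 : Tendsto (fun n : ℕ => energy (japanese 0) (multS (resolventSymbol n) ψ) + ∑ j,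
        (2 * energy (japanese 0) (multS (resolventSymbol n) (coordS j ψ)) +
          2 * (ENNReal.ofReal (‖c‖ ^ 2) * energy (japanese 0)
            (multS (fun ξ => fderiv ℝ (resolventSymbol n) ξ (unitVec j)) ψ)))) atTop
      (𝓝 (0 + ∑ j : Fin 3, (2 * 0 + 2 * (ENNReal.ofReal (‖c‖ ^ 2) * 0)))) := by
    refine (h0 ψ).add (tendsto_finsetSum _ fun j _ => ?_)
    refine (ENNReal.Tendsto.const_mul (h0 _) (Or.inr (by simp))).add
      (ENNReal.Tendsto.const_mul (ENNReal.Tendsto.const_mul (h1 j) (Or.inr ENNReal.ofReal_ne_top))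
        (Or.inr (by simp)))
  simpa using h4

theorem norm_star_L2 (f : L2) : ‖star f‖ = ‖f‖ := by
  have h : ∀ᵐ x, ‖(star f : L2) x‖ = ‖f x‖ := by
    filter_upwards [Lp.coeFn_star f] with x hx
    rw [hx, Pi.star_apply, norm_star]
  exact le_antisymm (Lp.norm_le_norm_of_ae_le (h.mono fun x hx => hx.le))
    (Lp.norm_le_norm_of_ae_le (h.mono fun x hx => hx.ge))

/-- The resolvent equation (1 - n²Δ)Rₙψ = ψ, in a form that can be tested against a harmonic
distribution. -/
theorem multS_resolvent_eq (n : ℝ) (ψ : 𝓢(R3, ℂ)) :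
    multS (resolventSymbol n) ψ = ψ + ((n : ℂ) ^ 2) • Δ (multS (resolventSymbol n) ψ) := by
  have h1 : Function.HasTemperateGrowth (fun ξ : R3 => ((‖ξ‖ ^ 2 : ℝ) : ℂ)) := by fun_prop
  have hr := (isSymbol_resolvent 0 n).temperate
  have h2 : Δ (multS (resolventSymbol n) ψ) =
      (-((2 * Real.pi) ^ 2 : ℝ) : ℂ) • multS (fun ξ : R3 => ((‖ξ‖ ^ 2 : ℝ) : ℂ))
        (multS (resolventSymbol n) ψ) := by
    rw [SchwartzMap.laplacian_eq_fourierMultiplierCLM, ← SchwartzMap.fourierMultiplierCLM_ofReal ℂ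
      (by fun_prop), ← Complex.coe_smul]
    push_cast
    rfl
  rw [h2]
  apply (FourierTransform.fourierEquiv ℂ 𝓢(R3, ℂ)).injective
  simp only [FourierTransform.fourierEquiv_apply]
  rw [FourierTransform.fourier_add, FourierTransform.fourier_smul, FourierTransform.fourier_smul,
    multS_apply (fun ξ : R3 => ((‖ξ‖ ^ 2 : ℝ) : ℂ)), FourierTransform.fourier_fourierInv_eq,
    multS_apply, FourierTransform.fourier_fourierInv_eq]
  ext ξ
  simp only [_root_.add_apply, _root_.smul_apply, SchwartzMap.smulLeftCLM_apply_apply h1,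
    SchwartzMap.smulLeftCLM_apply_apply hr, smul_eq_mul, resolventSymbol_eq]
  have h3 : (((1 + (2 * Real.pi) ^ 2 * n ^ 2 * ‖ξ‖ ^ 2 : ℝ)) : ℂ) ≠ 0 := by
    have : 0 < 1 + (2 * Real.pi) ^ 2 * n ^ 2 * ‖ξ‖ ^ 2 := by positivity
    exact_mod_cast this.ne'
  have h4 := mul_inv_cancel₀ h3
  push_cast at h4 ⊢
  linear_combination FourierTransform.fourier ψ ξ * h4

/-- A harmonic distribution in `L²` with the weight `⟨x⟩⁻¹` vanishes. -/
theorem eq_zero_of_laplacian_eq_zero {h : Dist} {k : L2} (hk : h = weight 1 (ofL2 k))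
    (hΔ : Δ h = 0) : h = 0 := by
  ext ψ
  -- A harmonic h does not distinguish ψ from Rₙψ, while Rₙψ tends to 0 in the weighted space on
  -- which h is continuous.
  have h1 : ∀ n : ℕ, h (multS (resolventSymbol n) ψ) = h ψ := by
    intro n
    have h2 : h (Δ (multS (resolventSymbol n) ψ)) = 0 := by
      rw [← TemperedDistribution.laplacian_apply_apply, hΔ]
      rfl
    rw [multS_resolvent_eq, map_add, map_smul, h2]
    simp
  have h3 : ∀ φ : 𝓢(R3, ℂ), ENNReal.ofReal (‖h φ‖ ^ 2) ≤
      ENNReal.ofReal (‖k‖ ^ 2) * energy (japanese 2) φ := by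
    intro φ
    have h4 := energy_weight 1 φ
    rw [mul_one] at h4
    rw [h4, ← ENNReal.ofReal_mul (by positivity), ← mul_pow, hk, weight_apply, ofL2_eq_inner]
    refine ENNReal.ofReal_le_ofReal (pow_le_pow_left₀ (norm_nonneg _) ?_ 2)
    refine (norm_inner_le_norm _ _).trans ?_
    rw [norm_star_L2, mul_comm]
  have h5 : Tendsto (fun n : ℕ => ENNReal.ofReal (‖k‖ ^ 2) *
      energy (japanese 2) (multS (resolventSymbol n) ψ)) atTop (𝓝 0) := by
    have := ENNReal.Tendsto.const_mul (tendsto_energy_resolvent ψ)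
      (Or.inr (ENNReal.ofReal_ne_top (r := ‖k‖ ^ 2)))
    rwa [mul_zero] at this
  have h6 : ENNReal.ofReal (‖h ψ‖ ^ 2) ≤ 0 :=
    ge_of_tendsto' h5 fun n => by
      rw [← h1 n]
      exact h3 _
  have h7 := ENNReal.ofReal_eq_zero.1 (le_antisymm h6 bot_le)
  have h8 : ‖h ψ‖ = 0 := by
    have := sq_nonneg ‖h ψ‖
    exact pow_eq_zero_iff two_ne_zero |>.1 (le_antisymm h7 this)
  simpa using h8

open ContinuousLinearMap (adjoint adjoint_comp adjoint_adjoint)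

/-! ### The compact remainder of the free resolvent -/

/-- Both sides are ⟨x⟩^{-ρ}m(D)⟨x⟩^{-ρ}. -/
theorem weightedMult_comp_japanese {m : R3 → ℂ} (hm : IsRealSymbol m) {ρ : ℝ} (hρ : 0 ≤ ρ) :
    weightedMult m (-ρ) ∘L mulLp (japanese (-(2 * ρ))) =
      mulLp (japanese (-(2 * ρ))) ∘L weightedMult m ρ := by
  ext1 f
  have hw : ∀ g : L2, weight ρ (ofL2 (mulLp (japanese (-(2 * ρ))) g)) = weight (-ρ) (ofL2 g) := by
    intro g
    rw [← weight_ofL2 (by linarith), weight_weight]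
    congr 2
    ring
  apply ofL2_injective
  apply weight_injective ρ
  have h1 := multD_weight hm (-ρ) (mulLp (japanese (-(2 * ρ))) f)
  rw [neg_neg] at h1
  simp only [ContinuousLinearMap.comp_apply]
  rw [← h1, hw, hw, multD_weight hm]

/-- This is G₀ = (1-Δ)⁻¹(G₀ + 1) between weights. -/
theorem weightedNewton_eq {ρ : ℝ} (hρ : 1 < ρ) :
    weightedNewton ρ ρ = weightedMult (besselSymbol (-1)) (-ρ) ∘L
      weightedMult (besselSymbol (-1)) (-ρ) ∘L
        (weightedNewton ρ ρ + mulLp (japanese (-(2 * ρ)))) := by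
  ext1 f
  apply ofL2_injective
  apply weight_injective ρ
  have h0 : ∀ g : L2, bessel (-1) (weight ρ (ofL2 g)) =
      weight ρ (ofL2 (weightedMult (besselSymbol (-1)) (-ρ) g)) := by
    intro g
    have := multD_weight isRealSymbol_bessel (-ρ) g
    rwa [neg_neg] at this
  have h1 := bessel_two_weightedNewton (a := ρ) (b := ρ) (by linarith) (by linarith)
    (by linarith) f
  have h2 : weight (-ρ) (ofL2 f) = weight ρ (ofL2 (mulLp (japanese (-(2 * ρ))) f)) := by
    rw [← weight_ofL2 (by linarith), weight_weight]
    congr 2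
    ring
  rw [h2, ← map_add, ← ofL2_add] at h1
  simp only [ContinuousLinearMap.comp_apply]
  rw [← h0, ← h0, _root_.add_apply, ← h1, bessel_bessel, bessel_bessel]
  norm_num [bessel_zero]

/-- `weightedNewton_eq` reads K = LLK + LLX, so LLX is compact because K is. With Y² = X and LX =
XL* one has LLX = (LY)(LY)*; hence (LY)* = YL* is compact, and so is LX = XL* = Y(YL*). -/
theorem isCompactOperator_weightedMult_japanese {ρ : ℝ} (hρ : 1 < ρ) :
    IsCompactOperator (weightedMult (besselSymbol (-1)) (-ρ) ∘L mulLp (japanese (-(2 * ρ)))) := by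
  set L := weightedMult (besselSymbol (-1)) (-ρ) with hL
  set X := mulLp (japanese (-(2 * ρ))) with hX
  set Y := mulLp (japanese (-ρ)) with hY
  set K := weightedNewton ρ ρ with hK
  have hYb := isBoundedMeasurable_japanese (s := -ρ) (by linarith)
  have hYY : Y ∘L Y = X := by
    ext1 f
    simp only [ContinuousLinearMap.comp_apply]
    rw [hY, mulLp_mulLp hYb hYb]
    congr 2
    ext x
    rw [← japanese_add]
    congr 1
    ring
  have hYadj : adjoint Y = Y := adjoint_mulLp hYb
  have hLadj : adjoint L = weightedMult (besselSymbol (-1)) ρ := by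
    rw [hL, adjoint_weightedMult isRealSymbol_bessel, neg_neg]
  have hLX : L ∘L X = X ∘L adjoint L := by
    rw [hLadj]
    exact weightedMult_comp_japanese isRealSymbol_bessel (by linarith)
  have hcK : IsCompactOperator K := isCompactOperator_weightedNewton ρ ρ
  have h1 : IsCompactOperator (L ∘L L ∘L X) := by
    have e : L ∘L L ∘L X = K - (L ∘L L) ∘L K := by
      have h2 := weightedNewton_eq hρ
      rw [← hK, ← hL, ← hX] at h2
      ext1 f
      have h3 := congrArg (fun T => T f) h2
      simp only [ContinuousLinearMap.comp_apply, _root_.add_apply, map_add] at h3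
      simp only [ContinuousLinearMap.comp_apply, _root_.sub_apply]
      rw [eq_sub_iff_add_eq', ← h3]
    rw [e]
    exact hcK.sub (hcK.clm_comp (L ∘L L))
  have h2 : (L ∘L Y) ∘L adjoint (L ∘L Y) = L ∘L L ∘L X := by
    rw [adjoint_comp, hYadj, hLX, ← hYY]
    rfl
  have h3 := isCompactOperator_adjoint_of_comp_adjoint (L ∘L Y) (by rw [h2]; exact h1)
  rw [adjoint_comp, hYadj] at h3
  have h4 := h3.clm_comp Y
  rw [hLX, ← hYY]
  exact h4

/-! ### The operators on the auxiliary space -/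

/-- The symbol of the differential part of a component of `w (1 - Δ) ^ (- 1 / 2)`. -/
def slotSymbol : Slot → R3 → ℂ
  | Sum.inl _ => besselSymbol (-1)
  | Sum.inr (Sum.inl _) => besselSymbol (-1)
  | Sum.inr (Sum.inr (Sum.inl _)) => besselSymbol (-1)
  | Sum.inr (Sum.inr (Sum.inr j)) => rieszSymbol j

theorem isRealSymbol_slot (i : Slot) : IsRealSymbol (slotSymbol i) := by
  rcases i with _ | _ | _ | j
  · exact isRealSymbol_bessel
  · exact isRealSymbol_bessel
  · exact isRealSymbol_bessel
  · exact isRealSymbol_riesz j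

/-- The coefficients of `w`. -/
def coef (V : R3 → ℝ) (A : R3 → R3) (C D : Fin 3 → R3 → ℝ) : Slot → R3 → ℝ
  | Sum.inl _ => sqrtAbs V
  | Sum.inr (Sum.inl j) => fun x => A x j
  | Sum.inr (Sum.inr (Sum.inl j)) => C j
  | Sum.inr (Sum.inr (Sum.inr j)) => D j

/-- A bounded operator into the auxiliary space with given components. -/
def toAux {E : Type*} [NormedAddCommGroup E] [NormedSpace ℂ E] (T : Slot → E →L[ℂ] L2) :
    E →L[ℂ] auxK :=
  (PiLp.continuousLinearEquiv 2 ℂ (fun _ : Slot => L2)).symm.toContinuousLinearMap ∘L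
    ContinuousLinearMap.pi T

theorem toAux_apply {E : Type*} [NormedAddCommGroup E] [NormedSpace ℂ E] (T : Slot → E →L[ℂ] L2)
    (f : E) (i : Slot) : toAux T f i = T i f := rfl

/-- A component of an element of the auxiliary space. -/
def slotProj (i : Slot) : auxK →L[ℂ] L2 := PiLp.proj 2 (fun _ : Slot => L2) i

theorem slotProj_apply (i : Slot) (f : auxK) : slotProj i f = f i := rfl

/-- The operator `w (1 - Δ) ^ (- 1 / 2) ⟨x⟩ ^ ρ`. -/
def fieldOp (ρ : ℝ) (a : Slot → R3 → ℝ) : L2 →L[ℂ] auxK :=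
  toAux fun i => mulLp (fun x => a i x * japanese ρ x) ∘L weightedMult (slotSymbol i) (-ρ)

theorem adjoint_fieldOp {ρ : ℝ} {a : Slot → R3 → ℝ} (ha : ∀ i, Decays ρ (a i)) (f : auxK) :
    adjoint (fieldOp ρ a) f =
      ∑ i, weightedMult (slotSymbol i) ρ (mulLp (fun x => a i x * japanese ρ x) (f i)) := by
  refine ext_inner_left ℂ fun g => ?_
  rw [ContinuousLinearMap.adjoint_inner_right, PiLp.inner_apply, inner_sum]
  refine Finset.sum_congr rfl fun i _ => ?_
  rw [fieldOp, toAux_apply, ContinuousLinearMap.comp_apply,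
    ← ContinuousLinearMap.adjoint_inner_right, adjoint_mulLp (ha i).isBoundedMeasurable,
    ← ContinuousLinearMap.adjoint_inner_right, adjoint_weightedMult (isRealSymbol_slot i),
    neg_neg]

/-- The bounded operator `𝒰`. -/
def calUOp (V : R3 → ℝ) : auxK →L[ℂ] auxK := toAux fun i => match i with
  | Sum.inl _ => mulLp (signU V) ∘L slotProj slotV
  | Sum.inr (Sum.inl j) => slotProj (slotA j)
  | Sum.inr (Sum.inr (Sum.inl j)) => -slotProj (slotD j)
  | Sum.inr (Sum.inr (Sum.inr j)) => -slotProj (slotC j)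

theorem isBoundedMeasurable_signU {V : R3 → ℝ} (hV : Measurable V) :
    IsBoundedMeasurable (signU V) :=
  ⟨Measurable.ite (measurableSet_lt hV measurable_const) measurable_const measurable_const, 1,
    fun x => by unfold signU; split_ifs <;> simp⟩

theorem calUOp_apply {V : R3 → ℝ} (hV : Measurable V) (f : auxK) : calUOp V f = calU V f := by
  ext1 i
  rcases i with _ | _ | _ | j
  · change _ = toL2 (mul (signU V) (ofL2 (f slotV)))
    rw [mul_ofL2 (isBoundedMeasurable_signU hV), toL2_ofL2]
    rfl
  all_goals rfl

theorem calUOp_calUOp {V : R3 → ℝ} (hV : Measurable V) (f : auxK) : calUOp V (calUOp V f) = f := by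
  have hs := isBoundedMeasurable_signU hV
  ext1 i
  rcases i with _ | _ | _ | j
  · change mulLp (signU V) (mulLp (signU V) (f slotV)) = f slotV
    rw [mulLp_mulLp hs hs]
    refine mulLp_one (hs.mul hs) (fun x => ?_) _
    unfold signU
    split_ifs <;> norm_num
  · rfl
  · exact neg_neg (f (slotC _))
  · exact neg_neg (f (slotD _))

theorem adjoint_calUOp {V : R3 → ℝ} (hV : Measurable V) : adjoint (calUOp V) = calUOp V := by
  have hs := isBoundedMeasurable_signU hV
  symm
  rw [ContinuousLinearMap.eq_adjoint_iff]
  intro f g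
  rw [PiLp.inner_apply, PiLp.inner_apply]
  simp only [Fintype.sum_sum_type, calUOp, toAux_apply, ContinuousLinearMap.comp_apply,
    slotProj_apply, _root_.neg_apply, inner_neg_left, inner_neg_right, Finset.univ_unique,
    Finset.sum_singleton, Finset.sum_neg_distrib]
  rw [← ContinuousLinearMap.adjoint_inner_right, adjoint_mulLp hs]
  congr 2
  exact add_comm _ _

/-- The projection onto the last block. -/
def projD : auxK →L[ℂ] auxK := toAux fun i => match i with
  | Sum.inl _ => 0
  | Sum.inr (Sum.inl _) => 0
  | Sum.inr (Sum.inr (Sum.inl _)) => 0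
  | Sum.inr (Sum.inr (Sum.inr j)) => slotProj (slotD j)

theorem adjoint_projD : adjoint projD = projD := by
  symm
  rw [ContinuousLinearMap.eq_adjoint_iff]
  intro f g
  rw [PiLp.inner_apply, PiLp.inner_apply]
  simp [Fintype.sum_sum_type, projD, toAux_apply, slotProj_apply]

/-- 𝒰 sends the D block to the C block, so its D–D entry is zero. -/
theorem projD_calUOp_projD (V : R3 → ℝ) (f : auxK) : projD (calUOp V (projD f)) = 0 := by
  ext1 i
  rcases i with _ | _ | _ | j
  · rfl
  · rfl
  · rfl
  · exact neg_zero

/-- The operator `w (1 - Δ) ^ (- 1 / 2) ⟨x⟩ ^ ρ` without its last block is the product of a bounded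
operator and `⟨x⟩ ^ (-ρ) (1 - Δ) ^ (- 1 / 2) ⟨x⟩ ^ ρ`. -/
theorem fieldOp_sub_projD (ρ : ℝ) (a : Slot → R3 → ℝ) : ∃ T : L2 →L[ℂ] auxK,
    fieldOp ρ a - projD ∘L fieldOp ρ a = T ∘L weightedMult (besselSymbol (-1)) (-ρ) := by
  refine ⟨toAux fun i => match i with
    | Sum.inl _ => mulLp (fun x => a slotV x * japanese ρ x)
    | Sum.inr (Sum.inl j) => mulLp (fun x => a (slotA j) x * japanese ρ x)
    | Sum.inr (Sum.inr (Sum.inl j)) => mulLp (fun x => a (slotC j) x * japanese ρ x)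
    | Sum.inr (Sum.inr (Sum.inr j)) => 0, ?_⟩
  ext1 f
  ext1 i
  rcases i with _ | _ | _ | j
  · exact sub_zero _
  · exact sub_zero _
  · exact sub_zero _
  · exact sub_self _

/-- The weighted resolvent `⟨x⟩ ^ (-ρ) (1 - Δ) ^ (1 / 2) G₀ (1 - Δ) ^ (1 / 2) ⟨x⟩ ^ (-ρ)`. -/
def freeOp (ρ : ℝ) : L2 →L[ℂ] L2 := weightedNewton ρ ρ + mulLp (japanese (-(2 * ρ)))

theorem adjoint_freeOp {ρ : ℝ} (hρ : 0 ≤ ρ) : adjoint (freeOp ρ) = freeOp ρ := by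
  rw [freeOp, map_add, adjoint_weightedNewton,
    adjoint_mulLp (isBoundedMeasurable_japanese (by linarith))]

/-- The operator `𝒰 + w G₀ w*`. -/
def auxOp (ρ : ℝ) (V : R3 → ℝ) (a : Slot → R3 → ℝ) : auxK →L[ℂ] auxK :=
  calUOp V + fieldOp ρ a ∘L freeOp ρ ∘L adjoint (fieldOp ρ a)

theorem adjoint_auxOp {ρ : ℝ} (hρ : 0 ≤ ρ) {V : R3 → ℝ} (hV : Measurable V)
    (a : Slot → R3 → ℝ) : adjoint (auxOp ρ V a) = auxOp ρ V a := by
  rw [auxOp, map_add, adjoint_calUOp hV, adjoint_comp, adjoint_comp, adjoint_adjoint,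
    adjoint_freeOp hρ]
  rfl

theorem auxOp_parametrix {ρ : ℝ} (hρ : 1 < ρ) {V : R3 → ℝ} (hV : Measurable V)
    (a : Slot → R3 → ℝ) : ∃ Q C : auxK →L[ℂ] auxK, IsCompactOperator C ∧
      Q ∘L auxOp ρ V a = 1 + C := by
  obtain ⟨T, hT⟩ := fieldOp_sub_projD ρ a
  set W := fieldOp ρ a with hW
  set L := weightedMult (besselSymbol (-1)) (-ρ) with hL
  set X := mulLp (japanese (-(2 * ρ))) with hX
  set E : auxK →L[ℂ] auxK := W ∘L X ∘L adjoint W with hE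
  have hXadj : adjoint X = X := adjoint_mulLp (isBoundedMeasurable_japanese (by linarith))
  have hLX : IsCompactOperator (L ∘L X) := isCompactOperator_weightedMult_japanese hρ
  have hXL : IsCompactOperator (X ∘L adjoint L) := by
    have e : X ∘L adjoint L = L ∘L X := by
      rw [hL, adjoint_weightedMult isRealSymbol_bessel, neg_neg]
      exact (weightedMult_comp_japanese isRealSymbol_bessel (by linarith)).symm
    rwa [e]
  -- Outside its last block 𝒲 factors through L, so every row of E except the last contains LX. The
  -- next step is the adjoint statement for columns.
  have h1 : IsCompactOperator (E - projD ∘L E) := by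
    have e : E - projD ∘L E = T ∘L (L ∘L X) ∘L adjoint W := by
      have : E - projD ∘L E = (W - projD ∘L W) ∘L X ∘L adjoint W := by
        ext1 f; simp [hE]
      rw [this, hT]
      rfl
    rw [e]
    exact (hLX.comp_clm (adjoint W)).clm_comp T
  have h2 : IsCompactOperator (E - E ∘L projD) := by
    have e : E - E ∘L projD = W ∘L (X ∘L adjoint L) ∘L adjoint T := by
      have h3 : adjoint W - adjoint W ∘L projD = adjoint L ∘L adjoint T := by
        rw [← adjoint_comp, ← hT, map_sub, adjoint_comp, adjoint_projD]
      have : E - E ∘L projD = W ∘L X ∘L (adjoint W - adjoint W ∘L projD) := by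
        ext1 f; simp [hE]
      rw [this, h3]
      rfl
    rw [e]
    exact (hXL.comp_clm (adjoint T)).clm_comp W
  have h3 : IsCompactOperator (E - projD ∘L E ∘L projD) := by
    have e : E - projD ∘L E ∘L projD = (E - projD ∘L E) + projD ∘L (E - E ∘L projD) := by
      ext1 f; simp
    rw [e]
    exact h1.add (h2.clm_comp projD)
  have h4 : IsCompactOperator (W ∘L weightedNewton ρ ρ ∘L adjoint W) :=
    ((isCompactOperator_weightedNewton ρ ρ).comp_clm (adjoint W)).clm_comp W
  set U := calUOp V with hU
  set F := projD ∘L E ∘L projD with hF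
  set R := W ∘L weightedNewton ρ ρ ∘L adjoint W + (E - F) with hR
  have hM : auxOp ρ V a = U + F + R := by
    ext1 f
    simp only [auxOp, freeOp, hR, hE, ContinuousLinearMap.comp_apply, _root_.add_apply,
      _root_.sub_apply, map_add]
    abel
  have hRc : IsCompactOperator R := h4.add h3
  have hUU : ∀ f, U (U f) = f := calUOp_calUOp hV
  -- (𝒰 - 𝒰F𝒰)(𝒰 + F) = 1 because 𝒰² = 1 and F𝒰F = 0; the compact R only adds a compact term.
  refine ⟨U - U ∘L F ∘L U, (U - U ∘L F ∘L U) ∘L R, hRc.clm_comp (U - U ∘L F ∘L U), ?_⟩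
  rw [hM]
  ext1 f
  have h5 : F (U (F f)) = 0 := by
    simp only [hF, ContinuousLinearMap.comp_apply, projD_calUOp_projD, hU, map_zero]
  simp only [ContinuousLinearMap.comp_apply, _root_.add_apply, _root_.sub_apply, map_add, hUU, h5,
    map_zero, one_apply_eq_self]
  abel

/-! ### Decay of the coefficients -/

theorem Decays.mono {p q : ℝ} {a : R3 → ℝ} (h : Decays p a) (hqp : q ≤ p) : Decays q a := by
  obtain ⟨c, hc⟩ := h.decay
  refine ⟨h.measurable, |c|, fun x => (hc x).trans ?_⟩
  exact mul_le_mul (le_abs_self c) (japanese_mono (by linarith) x) (japanese_pos _ _).le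
    (abs_nonneg c)

theorem Decays.bounded {p : ℝ} {a : R3 → ℝ} (h : Decays p a) (hp : 0 ≤ p) :
    IsBoundedMeasurable a := by
  obtain ⟨c, hc⟩ := (h.mono hp).decay
  refine ⟨h.measurable, c, fun x => (hc x).trans ?_⟩
  rw [neg_zero, japanese_zero, mul_one]

theorem Decays.mul {p q : ℝ} {a b : R3 → ℝ} (ha : Decays p a) (hb : Decays q b) :
    Decays (p + q) (fun x => a x * b x) := by
  obtain ⟨c, hc⟩ := ha.decay
  obtain ⟨d, hd⟩ := hb.decay
  refine ⟨ha.measurable.mul hb.measurable, c * d, fun x => ?_⟩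
  rw [abs_mul, neg_add, japanese_add]
  exact (mul_le_mul (hc x) (hd x) (abs_nonneg _) ((abs_nonneg _).trans (hc x))).trans_eq (by ring)

theorem FieldAssumption.decays_V {β : ℝ} {V : R3 → ℝ} {B : R3 → R3} (h : FieldAssumption β V B) :
    Decays β V := ⟨h.measurable_V, h.decay_V⟩

theorem FieldAssumption.decays_sqrtAbs {β : ℝ} {V : R3 → ℝ} {B : R3 → R3}
    (h : FieldAssumption β V B) : Decays (β / 2) (sqrtAbs V) := by
  obtain ⟨c, hc⟩ := h.decay_V
  refine ⟨h.measurable_V.abs.sqrt, Real.sqrt |c|, fun x => ?_⟩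
  rw [sqrtAbs, abs_of_nonneg (Real.sqrt_nonneg _)]
  have h1 : japanese (-(β / 2)) x = Real.sqrt (japanese (-β) x) := by
    rw [← Real.sqrt_sq (japanese_pos (-(β / 2)) x).le, japanese_sq]
    congr 2
    ring
  rw [h1, ← Real.sqrt_mul (abs_nonneg c)]
  exact Real.sqrt_le_sqrt ((hc x).trans
    (mul_le_mul_of_nonneg_right (le_abs_self c) (japanese_pos _ _).le))

theorem IsVectorPotential.decays_A {β : ℝ} {B A : R3 → R3} (h : IsVectorPotential β B A)
    (j : Fin 3) : Decays β (fun x => A x j) := by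
  obtain ⟨c, hc⟩ := h.decay_A
  have hm : Measurable A := h.contDiff_A.continuous.measurable
  exact ⟨by fun_prop, c, fun x => (PiLp.norm_apply_le (A x) j).trans (hc x)⟩

theorem IsVectorPotential.decays_norm_sq {β : ℝ} {B A : R3 → R3} (h : IsVectorPotential β B A) :
    Decays (β + β) (fun x => ‖A x‖ ^ 2) := by
  obtain ⟨c, hc⟩ := h.decay_A
  have hm : Measurable A := h.contDiff_A.continuous.measurable
  have h1 : Decays β (fun x => ‖A x‖) := ⟨by fun_prop, c, fun x => by
    rw [abs_norm]; exact hc x⟩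
  simpa only [sq] using h1.mul h1

theorem IsSplitting.decays_C' {β : ℝ} {A : R3 → R3} {C D : Fin 3 → R3 → ℝ}
    (h : IsSplitting β A C D) (j : Fin 3) : Decays (β / 2) (C j) :=
  ⟨h.measurable_C j, h.decay_C.choose, fun x => h.decay_C.choose_spec j x⟩

theorem IsSplitting.decays_D' {β : ℝ} {A : R3 → R3} {C D : Fin 3 → R3 → ℝ}
    (h : IsSplitting β A C D) (j : Fin 3) : Decays (β / 2) (D j) :=
  ⟨h.measurable_D j, h.decay_D.choose, fun x => h.decay_D.choose_spec j x⟩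

theorem decays_coef {β : ℝ} (hβ : 0 ≤ β) {V : R3 → ℝ} {B A : R3 → R3} {C D : Fin 3 → R3 → ℝ}
    (hVB : FieldAssumption β V B) (hA : IsVectorPotential β B A) (hCD : IsSplitting β A C D)
    (i : Slot) : Decays (β / 2) (coef V A C D i) := by
  rcases i with _ | _ | _ | j
  · exact hVB.decays_sqrtAbs
  · exact (hA.decays_A _).mono (by linarith)
  · exact hCD.decays_C' _
  · exact hCD.decays_D' j

/-! ### The operators `w`, `w*` and `W` on weighted Sobolev spaces -/

theorem SobolevRep.eq_weight {s : ℝ} {u : Dist} {h : L2} (hu : SobolevRep 1 (-s) u h) :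
    u = weight s (ofL2 (weightedMult (besselSymbol (-1)) (-s) h)) := by
  have h1 := multD_weight isRealSymbol_bessel (-s) h
  rw [neg_neg] at h1
  rw [← h1, sobolevRep_iff'.1 hu, neg_neg]
  rfl

theorem SobolevRep.momentum_eq_weight {s : ℝ} {u : Dist} {h : L2} (hu : SobolevRep 1 (-s) u h)
    (j : Fin 3) : momentum j u = weight s (ofL2 (weightedMult (rieszSymbol j) (-s) h)) := by
  have h1 := multD_weight (isRealSymbol_riesz j) (-s) h
  rw [neg_neg] at h1
  rw [← h1, sobolevRep_iff'.1 hu, neg_neg, momentum_bessel]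

theorem toL2_mul_weight {ρ : ℝ} {a : R3 → ℝ} (ha : Decays ρ a) (f : L2) :
    toL2 (mul a (weight ρ (ofL2 f))) = mulLp (fun x => a x * japanese ρ x) f := by
  rw [mul_weight_ofL2 ha, sub_self, weight_zero, toL2_ofL2]

theorem opw_eq {ρ : ℝ} {V : R3 → ℝ} {A : R3 → R3} {C D : Fin 3 → R3 → ℝ}
    (ha : ∀ i, Decays ρ (coef V A C D i)) {u : Dist} {h : L2} (hu : SobolevRep 1 (-ρ) u h) :
    opw V A C D u = fieldOp ρ (coef V A C D) h := by
  have h0 := hu.eq_weight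
  ext1 i
  rcases i with _ | j | j | j
  · change toL2 (mul (sqrtAbs V) u) = _
    rw [h0]
    exact toL2_mul_weight (ha slotV) _
  · change toL2 (mul (fun x => A x j) u) = _
    rw [h0]
    exact toL2_mul_weight (ha (slotA j)) _
  · change toL2 (mul (C j) u) = _
    rw [h0]
    exact toL2_mul_weight (ha (slotC j)) _
  · change toL2 (mul (D j) (momentum j u)) = _
    rw [hu.momentum_eq_weight]
    exact toL2_mul_weight (ha (slotD j)) _

theorem mul_ofL2_eq_weight {ρ : ℝ} {a : R3 → ℝ} (ha : Decays ρ a) (f : L2) :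
    mul a (ofL2 f) = weight (-ρ) (ofL2 (mulLp (fun x => a x * japanese ρ x) f)) := by
  have h := mul_weight_ofL2 ha 0 f
  rwa [weight_zero, zero_sub] at h

theorem bessel_mul_ofL2 {ρ : ℝ} {a : R3 → ℝ} (ha : Decays ρ a) (f : L2) :
    bessel (-1) (mul a (ofL2 f)) = weight (-ρ) (ofL2 (weightedMult (besselSymbol (-1)) ρ
      (mulLp (fun x => a x * japanese ρ x) f))) := by
  rw [mul_ofL2_eq_weight ha, bessel_eq_multD, multD_weight isRealSymbol_bessel]

theorem bessel_momentum_mul_ofL2 {ρ : ℝ} {a : R3 → ℝ} (ha : Decays ρ a) (j : Fin 3) (f : L2) :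
    bessel (-1) (momentum j (mul a (ofL2 f))) = weight (-ρ) (ofL2 (weightedMult (rieszSymbol j) ρ
      (mulLp (fun x => a x * japanese ρ x) f))) := by
  rw [bessel_momentum, mul_ofL2_eq_weight ha, multD_weight (isRealSymbol_riesz j)]

/-- w* is defined by components; this identifies ⟨x⟩^ρ(1-Δ)^{-1/2}w* with the adjoint of
w(1-Δ)^{-1/2}⟨x⟩^ρ. -/
theorem sobolevRep_opwStar {ρ : ℝ} {V : R3 → ℝ} {A : R3 → R3} {C D : Fin 3 → R3 → ℝ}
    (ha : ∀ i, Decays ρ (coef V A C D i)) (f : auxK) :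
    SobolevRep (-1) ρ (opwStar V A C D f) (adjoint (fieldOp ρ (coef V A C D)) f) := by
  have haV : Decays ρ (sqrtAbs V) := ha slotV
  have haA : ∀ j, Decays ρ (fun x => A x j) := fun j => ha (slotA j)
  have haC : ∀ j, Decays ρ (C j) := fun j => ha (slotC j)
  have haD : ∀ j, Decays ρ (D j) := fun j => ha (slotD j)
  have hs : ∀ g : Fin 3 → L2, ofL2 (∑ j, g j) = ∑ j, ofL2 (g j) := fun g => map_sum
    (Lp.toTemperedDistributionCLM ℂ (volume : Measure R3) 2) g Finset.univ
  rw [sobolevRep_iff, adjoint_fieldOp ha, opwStar]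
  simp only [Fintype.sum_sum_type, Finset.univ_unique, Finset.sum_singleton, map_add, map_sum,
    ofL2_add, hs]
  rw [bessel_mul_ofL2 haV, Finset.sum_congr rfl fun j _ => bessel_mul_ofL2 (haA j) _,
    Finset.sum_congr rfl fun j _ => bessel_mul_ofL2 (haC j) _,
    Finset.sum_congr rfl fun j _ => bessel_momentum_mul_ofL2 (haD j) j _]
  simp only [add_assoc]
  rfl

theorem mul_ofL2_mulLp {ρ : ℝ} {a b : R3 → ℝ} (ha : IsBoundedMeasurable a) (hb : Decays ρ b)
    (f : L2) : mul a (ofL2 (mulLp (fun x => b x * japanese ρ x) f)) =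
      mul (fun x => a x * b x) (weight ρ (ofL2 f)) := by
  have hb' := hb.isBoundedMeasurable
  rw [mul_ofL2 ha]
  symm
  refine mul_eq ⟨_, (isFunction_ofL2 f).weight ρ, (isFunction_ofL2 _).congr ?_⟩
  filter_upwards [coeFn_mulLp ha (mulLp (fun x => b x * japanese ρ x) f), coeFn_mulLp hb' f]
    with x h1 h2
  rw [h1, h2]
  push_cast
  ring

theorem sum_mul_weight {ρ : ℝ} {a : Fin 3 → R3 → ℝ} {b : R3 → ℝ} (ha : ∀ j, Decays ρ (a j))
    (hb : Decays ρ b) (hab : ∀ x, b x = ∑ j, a j x) (f : L2) :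
    mul b (weight ρ (ofL2 f)) = ∑ j, mul (a j) (weight ρ (ofL2 f)) := by
  have hs : ∀ g : Fin 3 → L2, ofL2 (∑ j, g j) = ∑ j, ofL2 (g j) := fun g => map_sum
    (Lp.toTemperedDistributionCLM ℂ (volume : Measure R3) 2) g Finset.univ
  simp only [fun j => mul_weight_ofL2 (ha j) ρ f, mul_weight_ofL2 hb ρ f, sub_self, weight_zero]
  rw [← hs]
  congr 1
  refine Lp.ext ?_
  have h1 : ∀ᵐ x : R3, ∀ j, mulLp (fun x => a j x * japanese ρ x) f x =
      ((a j x * japanese ρ x : ℝ) : ℂ) * f x :=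
    ae_all_iff.2 fun j => coeFn_mulLp (ha j).isBoundedMeasurable f
  filter_upwards [coeFn_mulLp hb.isBoundedMeasurable f, h1, Lp.coeFn_finsetSum Finset.univ
    (fun j => mulLp (fun x => a j x * japanese ρ x) f)] with x h2 h3 h4
  rw [h2, h4]
  simp only [Finset.sum_apply, h3, hab]
  push_cast
  simp only [Finset.sum_mul]

theorem mul_neg_ofL2 {a : R3 → ℝ} (ha : IsBoundedMeasurable a) (f : L2) :
    mul a (ofL2 (-f)) = -mul a (ofL2 f) := by
  rw [mul_ofL2 ha, mul_ofL2 ha, map_neg, ofL2_neg]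

theorem momentum_neg (j : Fin 3) (u : Dist) : momentum j (-u) = -momentum j u := by
  rw [momentum_eq, momentum_eq, map_neg]

/-- The slots give U|V| = V, Σ A_j² = |A|² and, after the exchange, -C_jD_jP_j = -A_jP_j and
-P_jD_jC_j = -P_jA_j. -/
theorem pertW_eq {β : ℝ} (hβ : 0 ≤ β) {V : R3 → ℝ} {B A : R3 → R3} {C D : Fin 3 → R3 → ℝ}
    (hVB : FieldAssumption β V B) (hA : IsVectorPotential β B A) (hCD : IsSplitting β A C D)
    {u : Dist} (hu : u ∈ sobolev 1 (-(β / 2))) :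
    opwStar V A C D (calU V (opw V A C D u)) = pertW V A u := by
  obtain ⟨h, hu⟩ := mem_sobolev_iff.1 hu
  have ha := decays_coef hβ hVB hA hCD
  have hρ : 0 ≤ β / 2 := by linarith
  have hsig := isBoundedMeasurable_signU hVB.measurable_V
  rw [opw_eq ha hu, ← calUOp_apply hVB.measurable_V]
  set ρ := β / 2 with hρdef
  have haV : Decays ρ (sqrtAbs V) := ha slotV
  have haA : ∀ j, Decays ρ (fun x => A x j) := fun j => ha (slotA j)
  have haC : ∀ j, Decays ρ (C j) := fun j => ha (slotC j)
  have haD : ∀ j, Decays ρ (D j) := fun j => ha (slotD j)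
  have hbV := haV.bounded hρ
  have hbA := fun j => (haA j).bounded hρ
  have hbC := fun j => (haC j).bounded hρ
  have hbD := fun j => (haD j).bounded hρ
  set w := weightedMult (besselSymbol (-1)) (-ρ) h with hw
  have h0 : u = weight ρ (ofL2 w) := hu.eq_weight
  have eV : mul (sqrtAbs V) (ofL2 (mulLp (signU V) (mulLp (fun x => sqrtAbs V x * japanese ρ x) w)))
      = mul V u := by
    have hd : Decays ρ (fun x => signU V x * sqrtAbs V x) := by
      obtain ⟨c, hc⟩ := haV.decay
      refine ⟨hsig.measurable.mul haV.measurable, c, fun x => ?_⟩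
      rw [abs_mul]
      refine le_trans (mul_le_of_le_one_left (abs_nonneg _) ?_) (hc x)
      unfold signU
      split_ifs <;> simp
    have e1 : mulLp (signU V) (mulLp (fun x => sqrtAbs V x * japanese ρ x) w) =
        mulLp (fun x => (signU V x * sqrtAbs V x) * japanese ρ x) w := by
      rw [mulLp_mulLp hsig haV.isBoundedMeasurable]
      simp only [mul_assoc]
    rw [e1, mul_ofL2_mulLp hbV hd, ← h0]
    congr 1
    ext x
    have e2 : sqrtAbs V x * sqrtAbs V x = |V x| := Real.mul_self_sqrt (abs_nonneg _)
    change sqrtAbs V x * (signU V x * sqrtAbs V x) = V x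
    rw [mul_left_comm, e2]
    unfold signU
    split_ifs with hx
    · rw [abs_of_neg hx]; ring
    · rw [abs_of_nonneg (not_lt.1 hx)]; ring
  have eA : mul (fun x => ‖A x‖ ^ 2) u =
      ∑ j, mul (fun x => A x j) (ofL2 (mulLp (fun x => A x j * japanese ρ x) w)) := by
    rw [Finset.sum_congr rfl fun j _ => mul_ofL2_mulLp (hbA j) (haA j) w, h0]
    refine sum_mul_weight (a := fun j x => A x j * A x j) (fun j => ?_)
      (hA.decays_norm_sq.mono (by linarith)) (fun x => ?_) w
    · exact ((hA.decays_A j).mul (hA.decays_A j)).mono (by linarith)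
    · rw [EuclideanSpace.norm_sq_eq]
      simp [sq]
  have eC : ∀ j, mul (C j) (ofL2 (-mulLp (fun x => D j x * japanese ρ x)
      (weightedMult (rieszSymbol j) (-ρ) h))) = -mul (fun x => A x j) (momentum j u) := by
    intro j
    rw [mul_neg_ofL2 (hbC j)]
    rw [mul_ofL2_mulLp (hbC j) (haD j), hu.momentum_eq_weight]
    congr 2
    ext x
    rw [hCD.split, mul_comm]
  have eD : ∀ j, momentum j (mul (D j) (ofL2 (-mulLp (fun x => C j x * japanese ρ x) w))) =
      -momentum j (mul (fun x => A x j) u) := by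
    intro j
    rw [mul_neg_ofL2 (hbD j), mul_ofL2_mulLp (hbD j) (haC j), ← h0,
      momentum_neg]
    congr 3
    ext x
    rw [hCD.split]
  have e : opwStar V A C D (calUOp V (fieldOp ρ (coef V A C D) h)) =
      mul (sqrtAbs V) (ofL2 (mulLp (signU V) (mulLp (fun x => sqrtAbs V x * japanese ρ x) w))) +
      (∑ j, mul (fun x => A x j) (ofL2 (mulLp (fun x => A x j * japanese ρ x) w))) +
      (∑ j, mul (C j) (ofL2 (-mulLp (fun x => D j x * japanese ρ x)
        (weightedMult (rieszSymbol j) (-ρ) h)))) +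
      ∑ j, momentum j (mul (D j) (ofL2 (-mulLp (fun x => C j x * japanese ρ x) w))) := rfl
  rw [e, eV, ← eA, Finset.sum_congr rfl fun j _ => eC j, Finset.sum_congr rfl fun j _ => eD j,
    Finset.sum_neg_distrib, Finset.sum_neg_distrib, pertW]
  abel

theorem weight_ofL2_mem_sobolev (t : ℝ) (f : L2) : weight t (ofL2 f) ∈ sobolev (-1) (-t) := by
  refine mem_sobolev_iff.2 ⟨weightedMult (besselSymbol (-1)) (-t) f, ?_⟩
  rw [sobolevRep_iff, ← multD_weight isRealSymbol_bessel, neg_neg, bessel_eq_multD]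

theorem momentum_weight_ofL2_mem_sobolev (j : Fin 3) (t : ℝ) (f : L2) :
    momentum j (weight t (ofL2 f)) ∈ sobolev (-1) (-t) := by
  refine mem_sobolev_iff.2 ⟨weightedMult (rieszSymbol j) (-t) f, ?_⟩
  rw [sobolevRep_iff, ← multD_weight (isRealSymbol_riesz j), neg_neg, bessel_momentum]

/-- All coefficients decay at least like ⟨x⟩^{-β}. The derivative in A·P is paid by u ∈ H¹, the one
in P·A by the target H^{-1}. -/
theorem pertW_mem_sobolev {β : ℝ} (hβ : 0 ≤ β) {V : R3 → ℝ} {B A : R3 → R3}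
    (hVB : FieldAssumption β V B) (hA : IsVectorPotential β B A) {s : ℝ} {u : Dist}
    (hu : u ∈ sobolev 1 (-s)) : pertW V A u ∈ sobolev (-1) (β - s) := by
  obtain ⟨h, hu⟩ := mem_sobolev_iff.1 hu
  have h0 := hu.eq_weight
  have e : β - s = -(s - β) := by ring
  rw [e]
  have hm : ∀ {a : R3 → ℝ}, Decays β a → mul a u ∈ sobolev (-1) (-(s - β)) := by
    intro a ha
    rw [h0, mul_weight_ofL2 ha]
    exact weight_ofL2_mem_sobolev _ _
  refine add_mem (add_mem (sub_mem (neg_mem (sum_mem fun j _ => ?_)) (sum_mem fun j _ => ?_))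
    (hm (hA.decays_norm_sq.mono (by linarith)))) (hm hVB.decays_V)
  · rw [h0, mul_weight_ofL2 (hA.decays_A j)]
    exact momentum_weight_ofL2_mem_sobolev _ _ _
  · rw [hu.momentum_eq_weight, mul_weight_ofL2 (hA.decays_A j)]
    exact weight_ofL2_mem_sobolev _ _

/-! ### Zero-energy solutions -/

theorem laplacian_G0_of_mem {s : ℝ} (hs : 1 / 2 < s) {g : Dist} (hg : g ∈ sobolev (-1) s) :
    -(Δ (G0 g)) = g := by
  obtain ⟨f, hf⟩ := mem_sobolev_iff.1 hg
  exact laplacian_G0 hs hf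

theorem laplacian_add (u v : Dist) : Δ (u + v) = Δ u + Δ v := by
  simp only [← TemperedDistribution.laplacianCLM_apply, map_add]

theorem laplacian_neg (u : Dist) : Δ (-u) = -Δ u := by
  simp only [← TemperedDistribution.laplacianCLM_apply, map_neg]

/-- Bootstrap: W sends H^{1,-s} to H^{-1,β-s}, and G₀ sends that to H^{1,-a} for every a > 1/2 with
a > s - (β-2). The inequality is strict, so each step uses half of the gain, and n bounds the number
of steps from s down to r. -/
theorem mem_sobolev_of_mem_spaceM {β : ℝ} (hβ : 2 < β) {V : R3 → ℝ} {B A : R3 → R3}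
    (hVB : FieldAssumption β V B) (hA : IsVectorPotential β B A) {r : ℝ} (hr : 1 / 2 < r)
    {u : Dist} (hu : u + G0 (pertW V A u) = 0) (n : ℕ) :
    ∀ s : ℝ, 1 / 2 < s → s < β - 1 / 2 → s ≤ r + n * ((β - 2) / 2) → u ∈ sobolev 1 (-s) →
      u ∈ sobolev 1 (-r) := by
  induction n with
  | zero =>
    intro s _ _ hsr hus
    exact sobolev_weight_mono (by push_cast at hsr; linarith) hus
  | succ n ih =>
    intro s hs hsβ hsr hus
    rcases le_total s r with h | h
    · exact sobolev_weight_mono (by linarith) hus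
    push_cast at hsr
    have h1 : r ≤ max r (s - (β - 2) / 2) := le_max_left _ _
    have h2 : s - (β - 2) / 2 ≤ max r (s - (β - 2) / 2) := le_max_right _ _
    have h3 : max r (s - (β - 2) / 2) ≤ s := max_le h (by linarith)
    have hn : (0 : ℝ) ≤ n * ((β - 2) / 2) := by
      have : (0 : ℝ) ≤ n := n.cast_nonneg
      nlinarith
    have h4 : max r (s - (β - 2) / 2) ≤ r + n * ((β - 2) / 2) :=
      max_le (by linarith) (by linarith)
    refine ih (max r (s - (β - 2) / 2)) (by linarith) (by linarith) h4 ?_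
    rw [eq_neg_of_add_eq_zero_left hu]
    exact neg_mem (G0_mem_sobolev (by linarith) (s := β - s) (by linarith) (by linarith)
      (pertW_mem_sobolev (by linarith) hVB hA hus))

/-- Both inclusions rest on Δ(u + G₀Wu) = Δu - Wu = -Hu. -/
theorem spaceM_eq_nullSpace {β : ℝ} (hβ : 2 < β) {V : R3 → ℝ} {B A : R3 → R3}
    (hVB : FieldAssumption β V B) (hA : IsVectorPotential β B A) {s : ℝ} (hs : 1 / 2 < s)
    (hsβ : s < β - 1 / 2) : spaceM V A s = nullSpace V A := by
  have hβ0 : 0 ≤ β := by linarith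
  have hmem : ∀ u : Dist, u ∈ sobolevMinus 1 (-(1 / 2)) ↔
      ∀ r : ℝ, 1 / 2 < r → u ∈ sobolev 1 (-r) := by
    intro u
    simp only [sobolevMinus, Submodule.mem_iInf]
    constructor
    · intro h r hr
      exact h (-r) (by linarith)
    · intro h r hr
      have := h (-r) (by linarith)
      rwa [neg_neg] at this
  ext u
  constructor
  · rintro ⟨hus, hu⟩
    refine ⟨(hmem u).2 fun r hr => ?_, ?_⟩
    · obtain ⟨n, hn⟩ := exists_nat_ge ((s - r) / ((β - 2) / 2))
      rw [div_le_iff₀ (by linarith)] at hn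
      exact mem_sobolev_of_mem_spaceM hβ hVB hA hr hu n s hs hsβ (by linarith) hus
    · have h1 := laplacian_G0_of_mem (s := β - s) (by linarith) (pertW_mem_sobolev hβ0 hVB hA hus)
      have h2 := eq_neg_of_add_eq_zero_left hu
      have h3 : Δ u = pertW V A u := by
        conv_lhs => rw [h2]
        rw [laplacian_neg, h1]
      rw [hamiltonian, h3, neg_add_cancel]
  · rintro ⟨hu, hH⟩
    rw [hmem] at hu
    refine ⟨hu s hs, ?_⟩
    -- The equation u + G₀Wu = 0 does not involve s, so it may be proved with the weight ⟨x⟩⁻¹ of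
    -- the Liouville theorem.
    have hp := pertW_mem_sobolev hβ0 hVB hA (hu 1 (by norm_num))
    have h1 := laplacian_G0_of_mem (s := β - 1) (by linarith) hp
    have h2 : u + G0 (pertW V A u) ∈ sobolev 1 (-1) :=
      add_mem (hu 1 (by norm_num)) (G0_mem_sobolev (by norm_num) (s := β - 1) (by linarith)
        (by linarith) hp)
    obtain ⟨k, hk⟩ := mem_sobolev_iff.1 h2
    refine eq_zero_of_laplacian_eq_zero hk.eq_weight ?_
    rw [laplacian_add, ← neg_eq_zero, neg_add, h1]
    exact hH

/-! ### The correspondence between zero-energy solutions and the kernel -/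

theorem sobolevRep_G0_opwStar {ρ : ℝ} (hρ : 1 < ρ) {V : R3 → ℝ} {A : R3 → R3}
    {C D : Fin 3 → R3 → ℝ} (ha : ∀ i, Decays ρ (coef V A C D i)) (f : auxK) :
    SobolevRep 1 (-ρ) (G0 (opwStar V A C D f))
      (freeOp ρ (adjoint (fieldOp ρ (coef V A C D)) f)) := by
  rw [sobolevRep_iff, bessel_one_G0 (a := ρ) (by linarith) (by linarith) (by linarith)
    (sobolevRep_opwStar ha f), freeOp, _root_.add_apply, ofL2_add, map_add,
    ← weight_ofL2 (by linarith), weight_weight, neg_neg]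
  congr 3
  ring

theorem auxOp_apply {ρ : ℝ} (hρ : 1 < ρ) {V : R3 → ℝ} (hV : Measurable V) {A : R3 → R3}
    {C D : Fin 3 → R3 → ℝ} (ha : ∀ i, Decays ρ (coef V A C D i)) (f : auxK) :
    auxOp ρ V (coef V A C D) f = calU V f + opw V A C D (G0 (opwStar V A C D f)) := by
  rw [opw_eq ha (sobolevRep_G0_opwStar hρ ha f), ← calUOp_apply hV]
  rfl

theorem SobolevRep.neg {k s : ℝ} {u : Dist} {f : L2} (h : SobolevRep k s u f) :
    SobolevRep k s (-u) (-f) := by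
  rw [sobolevRep_iff, map_neg, sobolevRep_iff.1 h, ← map_neg, ← ofL2_neg]

/-- The operator `- G₀ w*`. -/
def solutionOp (ρ : ℝ) (a : Slot → R3 → ℝ) : auxK →L[ℂ] Dist :=
  -(bessel (-1) ∘L weight ρ ∘L Lp.toTemperedDistributionCLM ℂ (volume : Measure R3) 2 ∘L
    freeOp ρ ∘L adjoint (fieldOp ρ a))

/-- `G0`, `mul` and hence `opwStar` are defined by choice; linearity of -G₀w* is read off from this
composition of linear maps. -/
theorem solutionOp_apply {ρ : ℝ} (hρ : 1 < ρ) {V : R3 → ℝ} {A : R3 → R3}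
    {C D : Fin 3 → R3 → ℝ} (ha : ∀ i, Decays ρ (coef V A C D i)) (f : auxK) :
    solutionOp ρ (coef V A C D) f = -G0 (opwStar V A C D f) := by
  rw [sobolevRep_iff'.1 (sobolevRep_G0_opwStar hρ ha f), neg_neg]
  rfl

end MagneticSchrodinger

end

/-! ### The main theorem -/

open MagneticSchrodinger
theorem proposition4p4 (β : ℝ) (hβ : 2 < β)
    (V : R3 → ℝ) (B A : R3 → R3) (C D : Fin 3 → R3 → ℝ)
    (hVB : FieldAssumption β V B) (hA : IsVectorPotential β B A) (hCD : IsSplitting β A C D) :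
    ∃ M₀ : auxK →L[ℂ] auxK,
      -- `M₀ = 𝒰 + w G₀ w*` is well defined and bounded
      (∀ f : auxK,
        opwStar V A C D f ∈ sobolev (-1) (β / 2) ∧
        IsG0 (opwStar V A C D f) (G0 (opwStar V A C D f)) ∧
        G0 (opwStar V A C D f) ∈ sobolev 1 (-(β / 2)) ∧
        M₀ f = calU V f + opw V A C D (G0 (opwStar V A C D f))) ∧
      FiniteDimensional ℂ (LinearMap.ker M₀.toLinearMap) ∧
      -- `0` is not an accumulation point of the spectrum, and lies in it only as an eigenvalue
      (∃ ε : ℝ, 0 < ε ∧ ∀ z ∈ spectrum ℂ M₀, z ≠ 0 → ε ≤ ‖z‖) ∧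
      (0 ∈ spectrum ℂ M₀ → LinearMap.ker M₀.toLinearMap ≠ ⊥) ∧
      -- `T₁ = - G₀ w*` and `T₂ = 𝒰 w` are mutually inverse between `ker M₀` and `null H = M`
      ∃ N : Submodule ℂ Dist,
        (N : Set Dist) = nullSpace V A ∧
        (∀ s : ℝ, 1 / 2 < s → s < β - 1 / 2 → (N : Set Dist) = spaceM V A s) ∧
        ∃ T : LinearMap.ker M₀.toLinearMap ≃ₗ[ℂ] N,
          (∀ f : LinearMap.ker M₀.toLinearMap, (T f : Dist) = -G0 (opwStar V A C D (f : auxK))) ∧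
          ∀ u : N, (T.symm u : auxK) = calU V (opw V A C D (u : Dist)) := by
  have hβ0 : 0 ≤ β := by linarith
  have hρ : 1 < β / 2 := by linarith
  have hV := hVB.measurable_V
  have ha := decays_coef hβ0 hVB hA hCD
  obtain ⟨Q, K, hK, hQ⟩ := auxOp_parametrix hρ hV (coef V A C D)
  set M := auxOp (β / 2) V (coef V A C D) with hM
  set S := solutionOp (β / 2) (coef V A C D) with hSdef
  have hM_apply : ∀ f, M f = calU V f + opw V A C D (G0 (opwStar V A C D f)) := auxOp_apply hρ hV ha
  have hS : ∀ f, S f = -G0 (opwStar V A C D f) := solutionOp_apply hρ ha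
  obtain ⟨hgap, hzero⟩ := spectrum_of_parametrix M Q K (adjoint_auxOp (by linarith) hV _) hK hQ
  have hUU : ∀ f, calU V (calU V f) = f := fun f => by
    rw [← calUOp_apply hV, ← calUOp_apply hV, calUOp_calUOp hV]
  -- `opw` is also defined by choice; on H^{1,-β/2} it inherits linearity from `fieldOp`.
  have hwneg : ∀ f, opw V A C D (-G0 (opwStar V A C D f)) =
      -opw V A C D (G0 (opwStar V A C D f)) := fun f => by
    have h1 := sobolevRep_G0_opwStar hρ ha f
    rw [opw_eq ha h1, opw_eq ha h1.neg, map_neg]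
  -- M₀f = 0 says 𝒰f = -wG₀w*f = wu for u = -G₀w*f, and 𝒰² = 1. Thus 𝒰w is a left inverse of T₁,
  -- which also gives injectivity.
  have hinv : ∀ f : LinearMap.ker M.toLinearMap, calU V (opw V A C D (S f)) = f := by
    rintro ⟨f, hf⟩
    have hf : M f = 0 := hf
    rw [hM_apply] at hf
    simp only
    rw [hS, hwneg, ← eq_neg_of_add_eq_zero_left hf, hUU]
  set T₁ : LinearMap.ker M.toLinearMap →ₗ[ℂ] Dist :=
    S.toLinearMap ∘ₗ (LinearMap.ker M.toLinearMap).subtype with hT₁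
  have hinj : Function.Injective T₁ := by
    intro f g hfg
    have hfg : S f = S g := hfg
    apply Subtype.ext
    rw [← hinv f, ← hinv g, hfg]
  -- Since W = w*𝒰w, the equation u = -G₀Wu is u = -G₀w*f with f = 𝒰wu. The exponent s = β/2 is the
  -- one on which w is bounded, and it lies in the admissible range.
  have hrange : (LinearMap.range T₁ : Set Dist) = spaceM V A (β / 2) := by
    ext u
    constructor
    · rintro ⟨f, rfl⟩
      have h1 : T₁ f = -G0 (opwStar V A C D f) := hS f
      have h2 : T₁ f ∈ sobolev 1 (-(β / 2)) := by
        rw [h1]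
        exact neg_mem (mem_sobolev_iff.2 ⟨_, sobolevRep_G0_opwStar hρ ha f⟩)
      refine ⟨h2, ?_⟩
      have h3 : calU V (opw V A C D (T₁ f)) = f := hinv f
      rw [← pertW_eq hβ0 hVB hA hCD h2, h3, h1, neg_add_cancel]
    · rintro ⟨hu, hu'⟩
      rw [← pertW_eq hβ0 hVB hA hCD hu] at hu'
      set f := calU V (opw V A C D u) with hf
      have h1 : u = -G0 (opwStar V A C D f) := eq_neg_of_add_eq_zero_left hu'
      have h2 : M f = 0 := by
        rw [hM_apply, ← neg_neg (opw V A C D (G0 (opwStar V A C D f))), ← hwneg, ← h1, hf, hUU,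
          add_neg_cancel]
      exact ⟨⟨f, h2⟩, (hS f).trans h1.symm⟩
  have hspace := fun (s : ℝ) (hs : 1 / 2 < s) (hsβ : s < β - 1 / 2) =>
    spaceM_eq_nullSpace hβ hVB hA hs hsβ
  have hnull : (LinearMap.range T₁ : Set Dist) = nullSpace V A :=
    hrange.trans (hspace (β / 2) (by linarith) (by linarith))
  refine ⟨M, fun f => ⟨mem_sobolev_iff.2 ⟨_, sobolevRep_opwStar ha f⟩,
    isG0_G0 (by linarith) (sobolevRep_opwStar ha f),
    mem_sobolev_iff.2 ⟨_, sobolevRep_G0_opwStar hρ ha f⟩, hM_apply f⟩,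
    finiteDimensional_ker_of_parametrix M Q K hK hQ, hgap, hzero, LinearMap.range T₁, hnull,
    fun s hs hsβ => hnull.trans (hspace s hs hsβ).symm, LinearEquiv.ofInjective T₁ hinj,
    fun f => hS f, fun u => ?_⟩
  obtain ⟨f, rfl⟩ := (LinearEquiv.ofInjective T₁ hinj).surjective u
  rw [LinearEquiv.symm_apply_apply]
  exact (hinv f).symm
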